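/- A binary CSP $(N,D,C)$ consists of a finite set $N$ of variables, a finite domain $D_i$ for each variable $i$, and a finite set $C$ of constraints, with at most one constraint $c_{ij}\subseteq D_i\times D_j$ for each pair of distinct variables $i,j$ (where $(a,b)\in c_{ij}$ if and only if $(b,a)\in c_{ji}$). Let $e$ be the number of constraints and $d$ the size of the largest domain. The constraint $c_{ij}$ is functional on $j$ if for every $a\in D_i$ there is at most one $b\in D_j$ with $(a,b)\in c_{ij}$. Constraints may be functional or non-functional. Let $P^F$ be the directed graph on $N$ with an edge $(i,j)$ whenever $c_{ij}\in C$ is functional on $j$. The algorithm Linear_Elimination computes an ordering of $N$ in which, whenever $j$ is reachable from $i$ in $P^F$ but $i$ is not reachable from $j$, $i$ comes before $j$. It then goes through this ordering. Each variable $i$ that has not been eliminated is used to eliminate, one after the other, all variables $j$ reachable from $i$ through constraints that were functional at the start and are still present: every present constraint $c_{jk}$ with $k\neq i$ is replaced by $c_{ik}\leftarrow (c_{jk}\circ c_{ij})\cap c_{ik}$ (an absent $c_{ik}$ counts as the universal relation). Arc consistency is added as follows: when $j$ has been eliminated using $c_{ij}$, the values of $D_i$ without a support in $D_j$ with respect to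 $c_{ij}$ are removed. The answer is "unsatisfiable" if some domain is empty at the start or becomes empty, and "satisfiable" otherwise. The algorithm runs on a unit-cost random access machine whose input includes the constraints as tables, so that testing a tuple takes constant time. There is a universal constant $K$ such that the following holds for every CSP (in every numbering of its variables, values and constraints) that has a variable from which every variable is reachable in $P^F$. Linear_Elimination with arc consistency added halts after at most $K\,\max(e,1)\,\max(d,1)^2$ steps, that is, in $O(ed^2)$ time, and its answer is "satisfiable" if and only if the CSP has a solution. Moreover, the resulting CSP has the same solutions as the given one, and it is in canonical functional form: for every constraint $c_{ij}$ functional on $j$, if $c_{ji}$ is functional on $i$ then $i$ or $j$ is on no other constraint, and otherwise $j$ is on no other constraint. It is a star graph: there is a variable $c$ such that the constraints are exactly the constraints $c_{cv}$ with $v\neq c$, and each of these is functional on $v$. Every value left in the domain of $c$ extends to a solution. -/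

import Mathlib

namespace FunCSP

/-! ### Binary constraint satisfaction problems -/

/-- A binary CSP with variables `V` and values in `α`. There is at most one constraint for each
pair of distinct variables; `graph.Adj i j` says that `c_{ij} ∈ C`, and then `rel i j a b` says
that `(a, b) ∈ c_{ij}`. If `i` and `j` are not adjacent, `rel i j` is never used. -/
structure CSP (V α : Type*) where
  dom : V → Finset α
  graph : SimpleGraph V
  rel : V → V → α → α → Prop
  rel_symm : ∀ i j a b, rel i j a b ↔ rel j i b a

namespace CSP

variable {V α : Type*}

/-- The assignment `s` takes its values in the domains and satisfies all constraints. -/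
def IsSolution (P : CSP V α) (s : V → α) : Prop :=
  (∀ v, s v ∈ P.dom v) ∧ ∀ u v, P.graph.Adj u v → P.rel u v (s u) (s v)

def Satisfiable (P : CSP V α) : Prop := ∃ s, P.IsSolution s

/-- Two problems are equivalent if they have the same solution space. -/
def Equivalent (P Q : CSP V α) : Prop := ∀ s, P.IsSolution s ↔ Q.IsSolution s

/-- The constraint `c_{ij}` is functional on `j`. -/
def FunctionalOn (P : CSP V α) (i j : V) : Prop :=
  ∀ a ∈ P.dom i, ∀ b ∈ P.dom j, ∀ b' ∈ P.dom j, P.rel i j a b → P.rel i j a b' → b = b'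

/-- The edges of the directed graph of the functional constraints. -/
def FunEdge (P : CSP V α) (i j : V) : Prop := P.graph.Adj i j ∧ P.FunctionalOn i j

/-- `j` is reachable from `i` in the directed graph of the functional constraints. -/
def Reachable (P : CSP V α) (i j : V) : Prop := Relation.ReflTransGen P.FunEdge i j

/-- No constraint other than `c_{ij}` is on `j`. -/
def OnlyConstraint (P : CSP V α) (i j : V) : Prop := ∀ k, P.graph.Adj j k → k = i

/-- Canonical functional form. -/
def IsCanonical (P : CSP V α) : Prop :=
  ∀ i j, P.graph.Adj i j → P.FunctionalOn i j →
    (P.FunctionalOn j i → P.OnlyConstraint j i ∨ P.OnlyConstraint i j) ∧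
    (¬ P.FunctionalOn j i → P.OnlyConstraint i j)

/-- The constraints form a star graph that contains all variables: the center `c` (the free
variable) is joined to every other variable `v`, there are no other constraints, and `c_{cv}` is
functional on `v`. -/
def IsStar (P : CSP V α) (c : V) : Prop :=
  (∀ u v, P.graph.Adj u v ↔ u ≠ v ∧ (u = c ∨ v = c)) ∧ ∀ v, v ≠ c → P.FunctionalOn c v

/-- The number `e` of constraints. -/
noncomputable def numCon (P : CSP V α) : ℕ := P.graph.edgeSet.ncard

/-- The size `d` of the largest domain. -/
noncomputable def maxDom [Fintype V] (P : CSP V α) : ℕ :=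
  Finset.univ.sup fun v => (P.dom v).card

end CSP

/-! ### A random access machine with a step count

A memory consists of finitely many named arrays of natural numbers (of up to four dimensions); a
scalar variable is an array without indices. Programs are while programs; every node of an
expression that is evaluated and every command that is executed costs one step. -/

/-- The names of the arrays and scalars of the program below. -/
inductive Name
  /- The input: the numbers of variables and of constraints, the two ends of each constraint,
  the sizes of the domains, and the constraints as tables. -/
  | nVar | nCon | conA | conB | size | rel
  /- The current CSP: the values left in each domain, the constraints that are present, and, for
  each variable, an array that contains its neighbours. -/
  | alive | inC | deg | nbr
  /- Which constraints are functional at the start. -/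
  | fun0
  /- For the elimination ordering. -/
  | vis | vis' | ptr | stk | sp | fin | nFin | ord | nOrd
  /- For the elimination. -/
  | elim | lst | inL | nL | consistent
  /- Local variables. -/
  | i | j | k | p | q | s | u | v | a | b | c | cnt | found | sup | new
  deriving DecidableEq

abbrev Mem := Name → List ℕ → ℕ

/-- Expressions; in a truth value, `0` is false and everything else is true. -/
inductive Exp
  | num (t : ℕ)
  | get (x : Name) (idx : List Exp)
  | add (e f : Exp)
  | sub (e f : Exp)
  | lt (e f : Exp)
  | eq (e f : Exp)
  | and (e f : Exp)
  | or (e f : Exp)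
  | not (e : Exp)

mutual
def Exp.eval (m : Mem) : Exp → ℕ
  | .num t => t
  | .get x idx => m x (Exp.evalList m idx)
  | .add e f => e.eval m + f.eval m
  | .sub e f => e.eval m - f.eval m
  | .lt e f => if e.eval m < f.eval m then 1 else 0
  | .eq e f => if e.eval m = f.eval m then 1 else 0
  | .and e f => if e.eval m ≠ 0 ∧ f.eval m ≠ 0 then 1 else 0
  | .or e f => if e.eval m ≠ 0 ∨ f.eval m ≠ 0 then 1 else 0
  | .not e => if e.eval m = 0 then 1 else 0
def Exp.evalList (m : Mem) : List Exp → List ℕ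
  | [] => []
  | e :: es => e.eval m :: Exp.evalList m es
end

mutual
/-- The number of steps of the evaluation. -/
def Exp.cost : Exp → ℕ
  | .num _ => 1
  | .get _ idx => 1 + Exp.costList idx
  | .add e f => 1 + e.cost + f.cost
  | .sub e f => 1 + e.cost + f.cost
  | .lt e f => 1 + e.cost + f.cost
  | .eq e f => 1 + e.cost + f.cost
  | .and e f => 1 + e.cost + f.cost
  | .or e f => 1 + e.cost + f.cost
  | .not e => 1 + e.cost
def Exp.costList : List Exp → ℕ
  | [] => 0
  | e :: es => e.cost + Exp.costList es
end

inductive Cmd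
  | skip
  | put (x : Name) (idx : List Exp) (e : Exp)
  | seq (P Q : Cmd)
  | ite (e : Exp) (P Q : Cmd)
  | while (e : Exp) (P : Cmd)

/-- Write `w` into one memory cell. -/
def Mem.write (m : Mem) (x : Name) (idx : List ℕ) (w : ℕ) : Mem :=
  fun y idx' => if y = x ∧ idx' = idx then w else m y idx'

/-- `Exec P m m' t`: started in the memory `m`, the program `P` halts in the memory `m'` after
exactly `t` steps. -/
inductive Exec : Cmd → Mem → Mem → ℕ → Prop
  | skip (m : Mem) : Exec .skip m m 1
  | put (x : Name) (idx : List Exp) (e : Exp) (m : Mem) :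
      Exec (.put x idx e) m (m.write x (Exp.evalList m idx) (e.eval m))
        (1 + Exp.costList idx + e.cost)
  | seq {P Q : Cmd} {m m' m'' : Mem} {t t' : ℕ} (hP : Exec P m m' t) (hQ : Exec Q m' m'' t') :
      Exec (.seq P Q) m m'' (1 + t + t')
  | ite_true {e : Exp} {P Q : Cmd} {m m' : Mem} {t : ℕ} (h : e.eval m ≠ 0)
      (hP : Exec P m m' t) : Exec (.ite e P Q) m m' (1 + e.cost + t)
  | ite_false {e : Exp} {P Q : Cmd} {m m' : Mem} {t : ℕ} (h : e.eval m = 0)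
      (hQ : Exec Q m m' t) : Exec (.ite e P Q) m m' (1 + e.cost + t)
  | while_true {e : Exp} {P : Cmd} {m m' m'' : Mem} {t t' : ℕ} (h : e.eval m ≠ 0)
      (hP : Exec P m m' t) (hW : Exec (.while e P) m' m'' t') :
      Exec (.while e P) m m'' (1 + e.cost + t + t')
  | while_false {e : Exp} {P : Cmd} {m : Mem} (h : e.eval m = 0) :
      Exec (.while e P) m m (1 + e.cost)

/-! ### The algorithm -/

namespace Program

open Name Cmd Exp

instance (t : ℕ) : OfNat Exp t := ⟨.num t⟩

instance : Coe Name Exp := ⟨fun x => .get x []⟩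

instance : CoeFun Name (fun _ => List Exp → Exp) := ⟨Exp.get⟩

def block : List Cmd → Cmd
  | [] => .skip
  | P :: l => .seq P (block l)

/-- `if e then P` -/
def when (e : Exp) (P : Cmd) : Cmd := .ite e P .skip

/-- `x ← e` for a scalar `x` -/
def assign (x : Name) (e : Exp) : Cmd := .put x [] e

/-- `x ← x + 1` -/
def inc (x : Name) : Cmd := assign x (add x 1)

/-- `x ← x - 1` -/
def dec (x : Name) : Cmd := assign x (sub x 1)

/-- `for x = 0, 1, …` while `x < e`, do `P`. -/
def forBelow (x : Name) (e : Exp) (P : Cmd) : Cmd :=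
  block [assign x 0, .while (lt x e) (block [P, inc x])]

/-- Enter `y` into the array of the neighbours of `x`. -/
def addNbr (x y : Name) : Cmd :=
  block [put nbr [x, deg [x]] y, put deg [x] (add (deg [x]) 1)]

/-- Put the constraint `c_{xy}` into `C` (as `c_{yx}` too). -/
def addCon (x y : Name) : Cmd :=
  block [put inC [x, y] 1, put inC [y, x] 1, addNbr x y, addNbr y x]

/-- Find out whether `c_{xy}` is functional on `y`. -/
def testFun (x y : Name) : Cmd :=
  block [
    put fun0 [x, y] 1,
    forBelow a (size [x]) (block [
      assign cnt 0,
      forBelow b (size [y]) (when (rel [x, y, a, b]) (inc cnt)),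
      when (lt 1 cnt) (put fun0 [x, y] 0)])]

/-- Set up the domains, the constraint graph and the table of the functional constraints. A
problem with an empty domain is inconsistent. -/
def setup : Cmd :=
  block [
    assign consistent 1,
    forBelow i nVar (block [
      put elim [i] 0,
      forBelow a (size [i]) (put alive [i, a] 1),
      when (eq (size [i]) 0) (assign consistent 0)]),
    forBelow p nCon (block [
      assign i (conA [p]),
      assign j (conB [p]),
      addCon i j,
      testFun i j,
      testFun j i])]

/-- Depth-first search in the directed graph of the functional constraints; `fin` lists the
variables in the order in which they are finished. -/
def firstSearch : Cmd :=
  forBelow s nVar (when (not (vis [s])) (block [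
    put vis [s] 1,
    put stk [0] s,
    assign sp 1,
    .while (lt 0 sp) (block [
      assign u (stk [sub sp 1]),
      .ite (lt (ptr [u]) (deg [u]))
        (block [
          assign v (nbr [u, ptr [u]]),
          put ptr [u] (add (ptr [u]) 1),
          when (and (fun0 [u, v]) (not (vis [v]))) (block [
            put vis [v] 1,
            put stk [sp] v,
            inc sp])])
        (block [
          dec sp,
          put fin [nFin] u,
          inc nFin])])]))

/-- Search in the reversed graph, with the roots taken in the reverse order of `fin`. Each of
these searches finds a strongly connected component, and the components are found in a
topological order; `ord` lists the variables in the order in which they are visited. -/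
def secondSearch : Cmd :=
  forBelow q nVar (block [
    assign s (fin [sub nVar (add q 1)]),
    when (not (vis' [s])) (block [
      put vis' [s] 1,
      put stk [0] s,
      assign sp 1,
      .while (lt 0 sp) (block [
        dec sp,
        assign u (stk [sp]),
        put ord [nOrd] u,
        inc nOrd,
        forBelow p (deg [u]) (block [
          assign v (nbr [u, p]),
          when (and (fun0 [v, u]) (not (vis' [v]))) (block [
            put vis' [v] 1,
            put stk [sp] v,
            inc sp])])])])])

/-- Find a functional elimination ordering. -/
def findOrdering : Cmd := block [firstSearch, secondSearch]

/-- `L ← L ∪ {x}` -/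
def insertL (x : Name) : Cmd :=
  when (not (inL [x])) (block [put inL [x] 1, put lst [nL] x, inc nL])

/-- `c_{ik} ← (c_{jk} ∘ c_{ij}) ∩ c_{ik}`, where `c_{ij}` is functional on `j` and where `c_{ik}`
is the universal relation if there is no constraint on `i` and `k`. -/
def compose : Cmd :=
  forBelow a (size [i]) (block [
    assign found 0,
    forBelow b (size [j]) (when (and (alive [j, b]) (rel [i, j, a, b])) (block [
      assign found 1,
      assign sup b])),
    forBelow c (size [k]) (block [
      assign new (and (and found (rel [j, k, sup, c]))
        (or (not (inC [i, k])) (rel [i, k, a, c]))),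
      put rel [i, k, a, c] new,
      put rel [k, i, c, a] new])])

/-- Substitute `j` by `i` in `c_{jk}`. -/
def substitute : Cmd :=
  block [
    compose,
    when (not (inC [i, k])) (addCon i k),
    put inC [j, k] 0,
    put inC [k, j] 0]

/-- Revise the domain of `i` with respect to `c_{ij}`: remove every value without a support in
the domain of `j`. If the domain of `i` becomes empty, the problem is inconsistent. -/
def revise : Cmd :=
  block [
    assign cnt 0,
    forBelow a (size [i]) (when (alive [i, a]) (block [
      assign found 0,
      forBelow b (size [j]) (when (and (alive [j, b]) (rel [i, j, a, b])) (assign found 1)),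
      .ite found (inc cnt) (put alive [i, a] 0)])),
    when (eq cnt 0) (assign consistent 0)]

/-- Eliminate `j` using `c_{ij}`. -/
def eliminate : Cmd :=
  block [
    forBelow p (deg [j]) (block [
      assign k (nbr [j, p]),
      when (and (inC [j, k]) (not (eq k i))) (block [
        substitute,
        when (fun0 [j, k]) (insertL k)])]),
    revise,
    put elim [j] 1]

/-- Substitute `i` for all variables that are reachable from it through qualified constraints. -/
def process : Cmd :=
  block [
    assign nL 0,
    forBelow p (deg [i]) (block [
      assign j (nbr [i, p]),
      when (and (inC [i, j]) (fun0 [i, j])) (insertL j)]),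
    .while (lt 0 nL) (block [
      dec nL,
      assign j (lst [nL]),
      put inL [j] 0,
      eliminate])]

/-- The algorithm `Linear_Elimination` with arc consistency added. -/
def linearElimination : Cmd :=
  block [
    setup,
    findOrdering,
    forBelow q nVar (block [
      assign i (ord [q]),
      when (not (elim [i])) process])]

end Program

/-! ### Input and output -/

/-- A way to write the problem `P` into the memory: a numbering of the variables, a numbering of
the values of each domain, and a list of the constraints, in an arbitrary order. -/
structure Encoding {V α : Type*} [Fintype V] (P : CSP V α) where
  num : V ≃ Fin (Fintype.card V)
  idx : V → α → ℕ
  idx_bijOn : ∀ v, Set.BijOn (idx v) (P.dom v) (Set.Iio (P.dom v).card)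
  cons : List (V × V)
  cons_nodup : (cons.map fun c => s(c.1, c.2)).Nodup
  mem_cons : ∀ z, z ∈ cons.map (fun c => s(c.1, c.2)) ↔ z ∈ P.graph.edgeSet

namespace Encoding

variable {V α : Type*} [Fintype V] {P : CSP V α}

open Classical in
/-- The initial memory: it contains the problem, and all other cells are `0`. -/
noncomputable def init (E : Encoding P) : Mem
  | .nVar, [] => Fintype.card V
  | .nCon, [] => E.cons.length
  | .conA, [p] => (E.cons.map fun c => (E.num c.1 : ℕ)).getD p 0
  | .conB, [p] => (E.cons.map fun c => (E.num c.2 : ℕ)).getD p 0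
  | .size, [i] => if h : i < Fintype.card V then (P.dom (E.num.symm ⟨i, h⟩)).card else 0
  | .rel, [i, j, a, b] =>
      if ∃ u v, P.graph.Adj u v ∧ (E.num u : ℕ) = i ∧ (E.num v : ℕ) = j ∧
        ∃ x ∈ P.dom u, ∃ y ∈ P.dom v, E.idx u x = a ∧ E.idx v y = b ∧ P.rel u v x y
      then 1 else 0
  | _, _ => 0

open Classical in
/-- The problem that a memory contains. -/
noncomputable def decode (E : Encoding P) (m : Mem) : CSP V α where
  dom v := (P.dom v).filter fun x => m .alive [E.num v, E.idx v x] = 1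
  graph := SimpleGraph.fromRel fun u v => m .inC [E.num u, E.num v] = 1
  rel u v x y := m .rel [E.num u, E.num v, E.idx u x, E.idx v y] = 1 ∧
    m .rel [E.num v, E.num u, E.idx v y, E.idx u x] = 1
  rel_symm _ _ _ _ := and_comm

end Encoding

end FunCSP

open FunCSP

-- Since some variable reaches all others in $P^F$, a single center does all the work. Depth-first
-- search finishes last a variable `c` from which everything is reachable: let `s` be the root of
-- the tree in which the given variable `r` is first visited. Then `s` reaches `r`, hence
-- everything; that tree absorbs all variables not yet visited, so it is the last one; and a root is
-- finished after the rest of its tree (`halts_firstSearch`). The second search starts from the last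
-- finished variable, so `c` comes first in the ordering (`halts_secondSearch`). Nothing more about
-- strongly connected components is needed: the first round of the main loop eliminates every
-- variable other than `c`, and the later rounds find nothing to do (`halts_eliminateAll`).
--
-- Why elimination is correct: let $c_{cj}$ be functional on $j$. In a solution the value of $j$ is
-- the unique support of the value of $c$, so $c_{jk}$ may be replaced by its composition with
-- $c_{cj}$ without changing the solutions (`Elim.substitute`). Removing a value of $c$ without
-- support in $D_j$ loses no solution either (`Elim.finish`). Afterwards $j$ is constrained only
-- with $c$, and this remains so, because only constraints of variables not yet eliminated are
-- rewritten. Domains other than that of $c$ are never reduced, so a support found once persists.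
--
-- Why everything is eliminated: the field `cover` of `Elim` says that each initial functional edge
-- $(u,v)$ has $v$ excused, waiting in the list or eliminated, or else $u\neq c$ is not eliminated
-- and $c_{uv}$ is still present. When the list is empty, induction along a path from $c$ shows that
-- every variable other than $c$ has been eliminated (`Elim.elim_of_reachable`). The result is a
-- star in which every live value of $c$ has a support at each leaf. These supports together form a
-- solution, so the answer depends only on whether the domain of $c$ is empty, given that no initial
-- domain is.
--
-- Why the time is $O(ed^2)$: eliminating $j$ scans its array of neighbours and spends $O(d^2)$ per
-- entry. Entries are never deleted, but a variable other than $c$ gains at most one, namely $c$. So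
-- the total is $O(d^2)$ times $\sum_j(\deg j+2)=2e+2n$, and $n\le e+1$ because the constraint graph
-- is connected (`CSP.card_le_numCon`). Both searches take $O(n+e)$ steps. All of this is proved in
-- a Hoare logic for total correctness whose loop rule uses a potential that bounds the steps and
-- proves termination at once (`Halts.loop`).

namespace FunCSP

-- A Hoare logic with step counts

/-- The names that a program may write to. -/
def Cmd.writes : Cmd → List Name
  | .skip => []
  | .put x _ _ => [x]
  | .seq P Q => P.writes ++ Q.writes
  | .ite _ P Q => P.writes ++ Q.writes
  | .while _ P => P.writes

/-- The two memories agree on all names that `P` does not write to. -/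
def Frame (P : Cmd) (m m' : Mem) : Prop := ∀ y, y ∉ P.writes → m' y = m y

/-- `P`, started in `m`, halts in a memory `m'` after `t` steps such that `Q m' t`. -/
def Halts (P : Cmd) (m : Mem) (Q : Mem → ℕ → Prop) : Prop := ∃ m' t, Exec P m m' t ∧ Q m' t

namespace Mem

theorem write_of_ne {x y : Name} (h : y ≠ x) (m : Mem) (l : List ℕ) (w : ℕ) :
    m.write x l w y = m y := by
  funext l'; simp [write, h]

theorem write_same (m : Mem) (x : Name) (l l' : List ℕ) (w : ℕ) :
    m.write x l w x l' = if l' = l then w else m x l' := by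
  simp [write]

end Mem

theorem Frame.refl (P : Cmd) (m : Mem) : Frame P m m := fun _ _ => rfl

/-- For a concrete program the side condition is a finite check on names, so the default argument
discharges it. -/
theorem Frame.eq {P : Cmd} {m m' : Mem} (h : Frame P m m') (y : Name)
    (hy : y ∉ P.writes := by decide) : m' y = m y := h y hy

theorem Frame.trans {P : Cmd} {m m' m'' : Mem} (h : Frame P m m') (h' : Frame P m' m'') :
    Frame P m m'' := fun y hy => (h' y hy).trans (h y hy)

theorem Exec.frame {P : Cmd} {m m' : Mem} {t : ℕ} (h : Exec P m m' t) : Frame P m m' := by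
  induction h with
  | skip m => exact .refl _ _
  | put x idx e m =>
    intro y hy
    exact Mem.write_of_ne (by simpa [Cmd.writes] using hy) _ _ _
  | seq _ _ h₁ h₂ =>
    intro y hy
    simp only [Cmd.writes, List.mem_append, not_or] at hy
    exact (h₂ y hy.2).trans (h₁ y hy.1)
  | ite_true _ _ h₁ =>
    intro y hy
    simp only [Cmd.writes, List.mem_append, not_or] at hy
    exact h₁ y hy.1
  | ite_false _ _ h₁ =>
    intro y hy
    simp only [Cmd.writes, List.mem_append, not_or] at hy
    exact h₁ y hy.2
  | while_true _ _ _ h₁ h₂ =>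
    intro y hy
    exact (h₂ y hy).trans (h₁ y hy)
  | while_false _ => exact .refl _ _

namespace Halts

variable {P Q : Cmd} {m : Mem} {R S : Mem → ℕ → Prop}

theorem mono (h : Halts P m R) (hRS : ∀ m' t, R m' t → S m' t) : Halts P m S :=
  let ⟨m', t, hP, hR⟩ := h
  ⟨m', t, hP, hRS m' t hR⟩

theorem frame (h : Halts P m R) : Halts P m fun m' t => R m' t ∧ Frame P m m' :=
  let ⟨m', t, hP, hR⟩ := h
  ⟨m', t, hP, hR, hP.frame⟩

/-- The rule of consequence, with the frame condition. -/
theorem framed (h : Halts P m R) (hRS : ∀ m' t, R m' t → Frame P m m' → S m' t) : Halts P m S :=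
  h.frame.mono fun m' t ⟨h₁, h₂⟩ => hRS m' t h₁ h₂

theorem skip (h : R m 1) : Halts .skip m R := ⟨m, 1, .skip m, h⟩

theorem put {x : Name} {idx : List Exp} {e : Exp}
    (h : R (m.write x (Exp.evalList m idx) (e.eval m)) (1 + Exp.costList idx + e.cost)) :
    Halts (.put x idx e) m R := ⟨_, _, .put x idx e m, h⟩

/-- The nested postcondition lets a proof execute a block from front to back while the step counts
add up. -/
theorem seq (h : Halts P m fun m' t => Halts Q m' fun m'' t' => R m'' (1 + t + t')) :
    Halts (.seq P Q) m R :=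
  let ⟨_, _, hP, _, _, hQ, hR⟩ := h
  ⟨_, _, .seq hP hQ, hR⟩

theorem ite {e : Exp} (h₁ : e.eval m ≠ 0 → Halts P m fun m' t => R m' (1 + e.cost + t))
    (h₂ : e.eval m = 0 → Halts Q m fun m' t => R m' (1 + e.cost + t)) :
    Halts (.ite e P Q) m R := by
  by_cases h : e.eval m = 0
  · obtain ⟨_, _, hQ, hR⟩ := h₂ h
    exact ⟨_, _, .ite_false h hQ, hR⟩
  · obtain ⟨_, _, hP, hR⟩ := h₁ h
    exact ⟨_, _, .ite_true h hP, hR⟩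

/-- The rule for `while`: `I` is an invariant, and `Φ` pays for the steps. -/
theorem loop {e : Exp} (I : Mem → Prop) (Φ : Mem → ℕ) (h0 : I m)
    (step : ∀ m', I m' → Frame P m m' → e.eval m' ≠ 0 →
      Halts P m' fun m'' t => I m'' ∧ t + Φ m'' + (1 + e.cost) ≤ Φ m') :
    Halts (.while e P) m fun m' t =>
      I m' ∧ e.eval m' = 0 ∧ Frame P m m' ∧ t + Φ m' ≤ Φ m + (1 + e.cost) := by
  -- Each round costs at least one step, so `Φ` strictly decreases: strong induction on its value
  -- gives termination together with the time bound.
  suffices H : ∀ B m', Φ m' = B → I m' → Frame P m m' →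
      Halts (.while e P) m' fun m'' t =>
        I m'' ∧ e.eval m'' = 0 ∧ Frame P m m'' ∧ t + Φ m'' ≤ Φ m' + (1 + e.cost) from
    H _ m rfl h0 (.refl _ _)
  intro B
  induction B using Nat.strong_induction_on with
  | _ B ih =>
    intro m' hB hI hF
    by_cases h : e.eval m' = 0
    · exact ⟨m', _, .while_false h, hI, h, hF, by omega⟩
    · obtain ⟨m'', t, hP, hI', ht⟩ := step m' hI hF h
      obtain ⟨m₃, t', hW, h₁, h₂, h₃, h₄⟩ :=
        ih (Φ m'') (by omega) m'' rfl hI' (hF.trans hP.frame)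
      exact ⟨m₃, _, .while_true h hP hW, h₁, h₂, h₃, by omega⟩

end Halts

namespace Program

@[simp] theorem eval_zero (m : Mem) : Exp.eval m 0 = 0 := rfl
@[simp] theorem eval_one (m : Mem) : Exp.eval m 1 = 1 := rfl
@[simp] theorem cost_zero : Exp.cost 0 = 1 := rfl
@[simp] theorem cost_one : Exp.cost 1 = 1 := rfl

variable {P Q : Cmd} {m : Mem} {R : Mem → ℕ → Prop}

theorem halts_nil (h : R m 1) : Halts (block []) m R := Halts.skip h

theorem halts_cons {l : List Cmd}
    (h : Halts P m fun m' t => Halts (block l) m' fun m'' t' => R m'' (1 + t + t')) :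
    Halts (block (P :: l)) m R := Halts.seq h

theorem halts_when {e : Exp} (h₁ : e.eval m ≠ 0 → Halts P m fun m' t => R m' (1 + e.cost + t))
    (h₂ : e.eval m = 0 → R m (1 + e.cost + 1)) : Halts (when e P) m R :=
  Halts.ite h₁ fun h => Halts.skip (h₂ h)

theorem halts_assign {x : Name} {e : Exp} (h : R (m.write x [] (e.eval m)) (1 + e.cost)) :
    Halts (assign x e) m R := Halts.put h

theorem halts_inc {x : Name} (h : R (m.write x [] (m x [] + 1)) 4) :
    Halts (inc x) m R := Halts.put h

theorem halts_dec {x : Name} (h : R (m.write x [] (m x [] - 1)) 4) :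
    Halts (dec x) m R := Halts.put h

@[simp] theorem writes_put (x : Name) (idx : List Exp) (e : Exp) :
    (Cmd.put x idx e).writes = [x] := rfl
@[simp] theorem writes_ite (e : Exp) (P Q : Cmd) :
    (Cmd.ite e P Q).writes = P.writes ++ Q.writes := rfl
@[simp] theorem writes_while (e : Exp) (P : Cmd) : (Cmd.while e P).writes = P.writes := rfl
@[simp] theorem writes_block_nil : (block []).writes = [] := rfl
@[simp] theorem writes_block_cons (P : Cmd) (l : List Cmd) :
    (block (P :: l)).writes = P.writes ++ (block l).writes := rfl
@[simp] theorem writes_when (e : Exp) (P : Cmd) : (when e P).writes = P.writes := by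
  simp [when, Cmd.writes]
@[simp] theorem writes_assign (x : Name) (e : Exp) : (assign x e).writes = [x] := rfl
@[simp] theorem writes_inc (x : Name) : (inc x).writes = [x] := rfl
@[simp] theorem writes_dec (x : Name) : (dec x).writes = [x] := rfl
@[simp] theorem writes_forBelow (x : Name) (e : Exp) (P : Cmd) :
    (forBelow x e P).writes = x :: (P.writes ++ [x]) := by
  simp [forBelow]

/-- The rule for `for` loops: `I k` holds before the round with number `k`, and `Φ` pays for the
steps in excess of `T`. -/
theorem halts_forBelow {x : Name} {e : Exp} (n T : ℕ) (I : ℕ → Mem → Prop) (Φ : Mem → ℕ)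
    (hx : x ∉ P.writes)
    (he : ∀ k m', I k m' → Frame (forBelow x e P) m m' → e.eval m' = n)
    (h0 : I 0 (m.write x [] 0))
    (step : ∀ k m', k < n → I k m' → m' x [] = k → Frame (forBelow x e P) m m' →
      Halts P m' fun m'' t => I (k + 1) (m''.write x [] (k + 1)) ∧
        t + Φ (m''.write x [] (k + 1)) ≤ T + Φ m') :
    Halts (forBelow x e P) m fun m' t => I n m' ∧ m' x [] = n ∧ Frame (forBelow x e P) m m' ∧
      t + Φ m' ≤ n * (T + e.cost + 12) + e.cost + 12 + Φ (m.write x [] 0) := by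
  have hF : ∀ m', Frame (forBelow x e P) m m' → ∀ w, Frame (forBelow x e P) m (m'.write x [] w) := by
    intro m' h w y hy
    rw [Mem.write_of_ne _ _ _ _, h y hy]
    rintro rfl
    simp [forBelow, block, Cmd.writes, assign] at hy
  have hP : ∀ m' m'', Frame P m' m'' → Frame (forBelow x e P) m m' →
      Frame (forBelow x e P) m m'' := by
    intro m' m'' h h' y hy
    rw [h y _, h' y hy]
    simp only [forBelow, block, Cmd.writes, assign, List.mem_append, not_or] at hy
    exact hy.2.1.1
  refine halts_cons (halts_assign ?_)
  refine halts_cons ?_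
  -- The loop variable itself records the number of the round. Each of the `n - m' x []` remaining
  -- rounds is prepaid with `T + e.cost + 12`, where 12 exceeds the overhead of the test, the
  -- increment and the sequencing nodes.
  refine Halts.mono (Halts.loop
    (fun m' => ∃ k, k ≤ n ∧ m' x [] = k ∧ I k m' ∧ Frame (forBelow x e P) m m')
    (fun m' => (n - m' x []) * (T + e.cost + 12) + Φ m')
    ⟨0, Nat.zero_le _, by simp [Mem.write_same, Exp.eval], h0, hF _ (.refl _ _) _⟩ ?_) ?_
  · rintro m' ⟨k, hk, hxk, hI, hfr⟩ - hlt
    have hn := he k m' hI hfr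
    have hlt' : k < n := by
      by_contra hcon
      simp [Exp.eval, Exp.evalList, hxk, hn, hcon] at hlt
    refine halts_cons ((step k m' hlt' hI hxk hfr).framed ?_)
    rintro m'' t ⟨hI', ht⟩ hfr'
    have hx' : m'' x [] = k := by rw [hfr' x hx, hxk]
    refine halts_cons (halts_inc (halts_nil ⟨⟨k + 1, hlt', ?_, ?_, ?_⟩, ?_⟩))
    · simp [Mem.write_same, hx']
    · rwa [hx']
    · exact hF _ (hP _ _ hfr' hfr) _
    · simp only [hx', Mem.write_same, if_true, hxk]
      obtain ⟨d, rfl⟩ : ∃ d, n = k + 1 + d := ⟨n - (k + 1), by omega⟩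
      have h1 : k + 1 + d - k = d + 1 := by omega
      have h2 : k + 1 + d - (k + 1) = d := by omega
      simp only [h1, h2, Exp.cost, Exp.costList]
      have : (d + 1) * (T + e.cost + 12) = d * (T + e.cost + 12) + (T + e.cost + 12) := by ring
      omega
  · rintro m' t ⟨⟨k, hk, hxk, hI, hfr⟩, h0', -, ht⟩
    have hn := he k m' hI hfr
    have : k = n := by
      by_contra hcon
      have : k < n := by omega
      simp [Exp.eval, Exp.evalList, hxk, hn, this] at h0'
    subst this
    refine halts_nil ⟨hI, hxk, hfr, ?_⟩
    simp only [hxk, Mem.write_same, if_true, Nat.sub_self, Nat.zero_mul, Exp.cost, Exp.costList,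
      eval_zero, Nat.sub_zero] at ht ⊢
    omega

/-- The rule for `for` loops with the same bound for all rounds. -/
theorem halts_for {x : Name} {e : Exp} (n T : ℕ) (I : ℕ → Mem → Prop) (hx : x ∉ P.writes)
    (hI : ∀ k m' w, I k m' → I k (m'.write x [] w))
    (he : ∀ k m', I k m' → Frame (forBelow x e P) m m' → e.eval m' = n) (h0 : I 0 m)
    (step : ∀ k m', k < n → I k m' → m' x [] = k → Frame (forBelow x e P) m m' →
      Halts P m' fun m'' t => I (k + 1) m'' ∧ t ≤ T) :
    Halts (forBelow x e P) m fun m' t => I n m' ∧ Frame (forBelow x e P) m m' ∧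
      t ≤ n * (T + e.cost + 12) + e.cost + 12 :=
  (halts_forBelow n T I (fun _ => 0) hx he (hI _ _ _ h0) fun k m' hk h₁ h₂ h₃ =>
    (step k m' hk h₁ h₂ h₃).mono fun _ _ h => ⟨hI _ _ _ h.1, h.2⟩).mono
  fun _ _ h => ⟨h.1, h.2.2.1, h.2.2.2⟩

end Program
end FunCSP

-- Testing functionality and inserting constraints

namespace FunCSP

/-- The relation that the memory contains for `x`, `y` is functional on `y`. -/
def Mem.Fun (m : Mem) (x y : ℕ) : Prop :=
  ∀ a < m .size [x], ∀ b < m .size [y], ∀ b' < m .size [y],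
    m .rel [x, y, a, b] ≠ 0 → m .rel [x, y, a, b'] ≠ 0 → b = b'

namespace Program

open Classical in
theorem halts_testFun {x y : Name} (hxy : x = .i ∧ y = .j ∨ x = .j ∧ y = .i) (m : Mem) {D : ℕ}
    (hx : m .size [m x []] ≤ D) (hy : m .size [m y []] ≤ D) :
    Halts (testFun x y) m fun m' t => t ≤ 200 * (D + 1) ^ 2 ∧
      ∀ l, m' .fun0 l = if l = [m x [], m y []] then (if m.Fun (m x []) (m y []) then 1 else 0)
        else m .fun0 l := by
  have hX : x ∉ [Name.fun0, .a, .b, .cnt] := by rcases hxy with ⟨rfl, rfl⟩ | ⟨rfl, rfl⟩ <;> decide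
  have hY : y ∉ [Name.fun0, .a, .b, .cnt] := by rcases hxy with ⟨rfl, rfl⟩ | ⟨rfl, rfl⟩ <;> decide
  simp only [List.mem_cons, List.not_mem_nil, or_false, not_or] at hX hY
  -- The supports of `a` among the first `k` values: `cnt` is their number, and functionality means
  -- at most one support in each row.
  let S (a : ℕ) (k : ℕ) : Finset ℕ :=
    (Finset.range k).filter fun b => m .rel [m x [], m y [], a, b] ≠ 0
  have hFun : m.Fun (m x []) (m y []) ↔
      ∀ a < m .size [m x []], (S a (m .size [m y []])).card ≤ 1 := by
    simp only [Mem.Fun, Finset.card_le_one, S, Finset.mem_filter, Finset.mem_range]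
    grind
  refine halts_cons (Halts.put ?_)
  simp only [Exp.eval, Exp.evalList, Exp.cost, Exp.costList]
  refine halts_cons ((halts_for (m .size [m x []]) (26 * D + 60)
    (fun k m' => ∀ l, m' .fun0 l = if l = [m x [], m y []] then
      (if ∀ a < k, (S a (m .size [m y []])).card ≤ 1 then 1 else 0) else m .fun0 l)
    (by simp)
    (by simp [Mem.write_of_ne]) ?_ (by simp [Mem.write_same]) ?_).mono ?_)
  · intro k m' _ hF
    simp only [Exp.eval, Exp.evalList]
    rw [hF .size (by simp),
      hF x (by simp [hX]),
      Mem.write_of_ne (by simp), Mem.write_of_ne (by simp [hX])]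
  · intro a m₁ ha hI hma hF
    have h₁ : m₁ .size = m .size := by
      rw [hF .size (by simp),
        Mem.write_of_ne (by simp)]
    have h₂ : m₁ .rel = m .rel := by
      rw [hF .rel (by simp),
        Mem.write_of_ne (by simp)]
    have h₃ : m₁ x = m x := by
      rw [hF x (by simp [hX]),
        Mem.write_of_ne (by simp [hX])]
    have h₄ : m₁ y = m y := by
      rw [hF y (by simp [hY]),
        Mem.write_of_ne (by simp [hY])]
    refine halts_cons (halts_assign (halts_cons ((halts_for (m .size [m y []]) 11
      (fun k m' => m' .cnt [] = (S a k).card)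
      (by simp)
      (by simp [Mem.write_of_ne]) ?_ (by simp [S, Mem.write_same]) ?_).framed ?_)))
    · intro k m' _ hF'
      simp only [Exp.eval, Exp.evalList]
      rw [hF' .size (by simp),
        hF' y (by simp [hY]),
        Mem.write_of_ne (by simp), Mem.write_of_ne (by simp [hY]), h₁, h₄]
    · intro b m₂ hb hI₂ hmb hF'
      have g₁ : m₂ .rel [m₂ x [], m₂ y [], m₂ .a [], m₂ .b []] =
          m .rel [m x [], m y [], a, b] := by
        rw [hF' .rel (by simp),
          hF' .a (by simp),
          hF' x (by simp [hX]),
          hF' y (by simp [hY])]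
        simp [Mem.write_of_ne, *]
      have hS : S a (b + 1) = if m .rel [m x [], m y [], a, b] ≠ 0 then insert b (S a b)
          else S a b := by
        simp only [S, Finset.range_add_one, Finset.filter_insert]
      refine halts_when (fun h => halts_inc ⟨?_, ?_⟩) (fun h => ⟨?_, ?_⟩)
      · simp only [Exp.eval, Exp.evalList, g₁] at h
        rw [hS, if_pos h, Finset.card_insert_of_notMem (by simp [S])]
        simp [Mem.write_same, hI₂]
      · simp [Exp.cost, Exp.costList]
      · simp only [Exp.eval, Exp.evalList, g₁] at h
        rw [hS, if_neg (by simpa using h), hI₂]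
      · simp [Exp.cost, Exp.costList]
    · rintro m₂ t ⟨hI₂, hF₂, ht⟩ -
      have g₁ : m₂ .fun0 = m₁ .fun0 := by
        rw [hF₂ .fun0 (by simp),
          Mem.write_of_ne (by simp)]
      have g₂ : m₂ x = m₁ x := by
        rw [hF₂ x (by simp [hX]),
          Mem.write_of_ne (by simp [hX])]
      have g₃ : m₂ y = m₁ y := by
        rw [hF₂ y (by simp [hY]),
          Mem.write_of_ne (by simp [hY])]
      have hlt : (∀ a' < a + 1, (S a' (m .size [m y []])).card ≤ 1) ↔
          (∀ a' < a, (S a' (m .size [m y []])).card ≤ 1) ∧ (S a (m .size [m y []])).card ≤ 1 :=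
        Nat.forall_lt_succ_right
      simp only [Exp.cost, Exp.costList] at ht
      have : m .size [m y []] * (11 + (1 + (1 + 0 + 0)) + 12) ≤ 26 * D := by omega
      refine halts_cons (halts_when (fun h => Halts.put (halts_nil ⟨?_, ?_⟩))
        fun h => halts_nil ⟨?_, ?_⟩)
      · intro l
        simp only [Exp.eval, Exp.evalList, hI₂] at h
        have h' : ¬ (S a (m .size [m y []])).card ≤ 1 := fun h' => h (if_neg (by omega))
        simp only [Mem.write_same, Exp.evalList, Exp.eval, g₁, g₂, g₃, h₃, h₄, hI l, hlt, h',
          and_false, if_false]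
        split_ifs <;> rfl
      · simp [Exp.cost, Exp.costList]
        omega
      · intro l
        simp only [Exp.eval, Exp.evalList, hI₂] at h
        have h' : (S a (m .size [m y []])).card ≤ 1 := by
          by_contra h'
          rw [if_pos (by omega)] at h
          exact one_ne_zero h
        simp only [g₁, hI l, hlt, h', and_true]
      · simp [Exp.cost, Exp.costList]
        omega
  · rintro m' t ⟨hI, -, ht⟩
    refine halts_nil ⟨?_, ?_⟩
    · simp only [Exp.cost, Exp.costList] at ht ⊢
      have := Nat.mul_le_mul hx (le_refl (26 * D + 60 + (1 + (1 + 0 + 0)) + 12))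
      nlinarith
    · simpa only [hFun] using hI

/-- Since the ends are distinct, raising `deg` at one end does not move the slot used at the other.
-/
theorem halts_addCon {x y : Name} (hx : x ∉ [Name.inC, .nbr, .deg]) (hy : y ∉ [Name.inC, .nbr, .deg])
    (m : Mem) (hne : m x [] ≠ m y []) :
    Halts (addCon x y) m fun m' t => t ≤ 100 ∧
      (∀ l, m' .inC l = if l = [m x [], m y []] ∨ l = [m y [], m x []] then 1 else m .inC l) ∧
      (∀ l, m' .deg l = if l = [m x []] ∨ l = [m y []] then m .deg l + 1 else m .deg l) ∧
      (∀ l, m' .nbr l = if l = [m x [], m .deg [m x []]] then m y [] else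
        if l = [m y [], m .deg [m y []]] then m x [] else m .nbr l) := by
  simp only [List.mem_cons, List.not_mem_nil, or_false, not_or] at hx hy
  refine halts_cons (Halts.put (halts_cons (Halts.put (halts_cons (halts_cons (Halts.put (halts_cons
    (Halts.put (halts_nil (halts_cons (halts_cons (Halts.put (halts_cons (Halts.put (halts_nil
    (halts_nil ?_))))))))))))))))
  simp only [Exp.eval, Exp.evalList, Exp.cost, Exp.costList,
    Mem.write_of_ne, Mem.write_same, ne_eq, hx, hy, not_false_eq_true, reduceCtorEq]
  refine ⟨by omega, ?_, ?_, ?_⟩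
  · intro l
    split_ifs <;> simp_all
  · intro l
    split_ifs <;> simp_all
  · intro l
    split_ifs <;> simp_all

/-- Every neighbour of a variable is in its array of neighbours. -/
def _root_.FunCSP.Mem.NbrOK (m : Mem) : Prop :=
  ∀ u v, m .inC [u, v] ≠ 0 → ∃ q < m .deg [u], m .nbr [u, q] = v

/-- New entries are written just behind the used part of the arrays, so the old ones survive. -/
theorem nbrOK_addCon {m m' : Mem} (h : m.NbrOK) {x y : ℕ} (hne : x ≠ y)
    (h₁ : ∀ l, m' .inC l = if l = [x, y] ∨ l = [y, x] then 1 else m .inC l)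
    (h₂ : ∀ l, m' .deg l = if l = [x] ∨ l = [y] then m .deg l + 1 else m .deg l)
    (h₃ : ∀ l, m' .nbr l = if l = [x, m .deg [x]] then y else
      if l = [y, m .deg [y]] then x else m .nbr l) : m'.NbrOK := by
  intro u v huv
  have key : ∀ q < m .deg [u], m' .nbr [u, q] = m .nbr [u, q] := by
    intro q hq
    rw [h₃, if_neg, if_neg] <;>
    · simp only [List.cons.injEq, and_true, not_and]
      rintro rfl
      exact hq.ne
  have hdeg : m .deg [u] ≤ m' .deg [u] := by
    rw [h₂]; split_ifs <;> omega
  by_cases hxy : u = x ∧ v = y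
  · obtain ⟨rfl, rfl⟩ := hxy
    exact ⟨m .deg [u], by simp [h₂], by simp [h₃]⟩
  by_cases hyx : u = y ∧ v = x
  · obtain ⟨rfl, rfl⟩ := hyx
    exact ⟨m .deg [u], by simp [h₂], by simp [h₃, hne.symm]⟩
  rw [h₁, if_neg (by simpa [not_or] using ⟨fun h => by simpa [h] using hxy, fun h => by simpa [h] using hyx⟩)] at huv
  obtain ⟨q, hq, hv⟩ := h u v huv
  exact ⟨q, by omega, by rw [key q hq, hv]⟩

end Program
end FunCSP

-- The memory after the setup

namespace FunCSP

namespace Mem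

/-- One of the first `k` constraints is on `u` and `v`. -/
def ConBelow (m : Mem) (k u v : ℕ) : Prop :=
  ∃ p < k, m .conA [p] = u ∧ m .conB [p] = v ∨ m .conA [p] = v ∧ m .conB [p] = u

def Con (m : Mem) (u v : ℕ) : Prop := m.ConBelow (m .nCon []) u v

/-- The memory contains the tables of a problem with domains of size at most `D`. -/
structure Tables (m : Mem) (D : ℕ) : Prop where
  size_le : ∀ v, m .size [v] ≤ D
  conA_lt : ∀ p < m .nCon [], m .conA [p] < m .nVar []
  conB_lt : ∀ p < m .nCon [], m .conB [p] < m .nVar []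
  con_ne : ∀ p < m .nCon [], m .conA [p] ≠ m .conB [p]
  rel_symm : ∀ u v a b, m .rel [u, v, a, b] = m .rel [v, u, b, a]
  rel_le : ∀ u v a b, m .rel [u, v, a, b] ≤ 1

/-- The memory contains an input, and all other cells are `0`. -/
structure IsInput (m : Mem) (D : ℕ) : Prop extends m.Tables D where
  zero : ∀ y ∉ [Name.nVar, .nCon, .conA, .conB, .size, .rel], ∀ l, m y l = 0

/-- The arrays have been set up. -/
structure Ready (m : Mem) (D : ℕ) : Prop extends m.Tables D where
  elim : ∀ v < m .nVar [], m .elim [v] = 0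
  alive : ∀ v < m .nVar [], ∀ a < m .size [v], m .alive [v, a] = 1
  consistent : m .consistent [] = 1 ↔ ∀ v < m .nVar [], 0 < m .size [v]
  inC_le : ∀ u v, m .inC [u, v] ≤ 1
  inC_iff : ∀ u v, m .inC [u, v] ≠ 0 ↔ m.Con u v
  fun0_iff : ∀ u v, m .fun0 [u, v] ≠ 0 ↔ m.Con u v ∧ m.Fun u v
  nbrOK : m.NbrOK
  sum_deg : ∑ v ∈ Finset.range (m .nVar []), m .deg [v] = 2 * m .nCon []

theorem Fun.congr {m m' : Mem} (h₁ : m' .size = m .size) (h₂ : m' .rel = m .rel) (u v : ℕ) :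
    m'.Fun u v ↔ m.Fun u v := by
  simp only [Fun, h₁, h₂]

theorem ConBelow.congr {m m' : Mem} (h₁ : m' .conA = m .conA) (h₂ : m' .conB = m .conB)
    (k u v : ℕ) : m'.ConBelow k u v ↔ m.ConBelow k u v := by
  simp only [ConBelow, h₁, h₂]

theorem ConBelow.symm {m : Mem} {k u v : ℕ} (h : m.ConBelow k u v) : m.ConBelow k v u :=
  let ⟨p, hp, h⟩ := h
  ⟨p, hp, h.symm⟩

theorem conBelow_succ {m : Mem} {k u v : ℕ} : m.ConBelow (k + 1) u v ↔ m.ConBelow k u v ∨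
    [u, v] = [m .conA [k], m .conB [k]] ∨ [u, v] = [m .conB [k], m .conA [k]] := by
  simp only [ConBelow, Nat.exists_lt_succ_right]
  grind

theorem sum_deg_add {m m' : Mem} {x y n : ℕ} (hne : x ≠ y) (hx : x < n) (hy : y < n)
    (h : ∀ l, m' .deg l = if l = [x] ∨ l = [y] then m .deg l + 1 else m .deg l) :
    ∑ v ∈ Finset.range n, m' .deg [v] = ∑ v ∈ Finset.range n, m .deg [v] + 2 := by
  have : ∀ v, m' .deg [v] = m .deg [v] + ((if v = x then 1 else 0) + if v = y then 1 else 0) := by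
    intro v
    rw [h]
    by_cases h₁ : v = x <;> by_cases h₂ : v = y <;> simp_all
  simp [this, Finset.sum_add_distrib, hx, hy]

end Mem

namespace Program

theorem halts_setup_vars {m : Mem} {D : ℕ} (hm : ∀ v, m .size [v] ≤ D)
    (h : m .consistent [] = 1) :
    Halts (forBelow .i (.get .nVar []) (block [
      .put .elim [.get .i []] 0,
      forBelow .a (.get .size [.get .i []]) (.put .alive [.get .i [], .get .a []] 1),
      when (.eq (.get .size [.get .i []]) 0) (assign .consistent 0)])) m
    fun m' t => t ≤ 200 * (m .nVar [] + 1) * (D + 1) ∧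
      (∀ v < m .nVar [], m' .elim [v] = 0) ∧
      (∀ v < m .nVar [], ∀ a < m .size [v], m' .alive [v, a] = 1) ∧
      (m' .consistent [] = 1 ↔ ∀ v < m .nVar [], 0 < m .size [v]) := by
  refine (halts_for (m .nVar []) (30 * D + 60)
    (fun k m' => (∀ v < k, m' .elim [v] = 0) ∧ (∀ v < k, ∀ a < m .size [v], m' .alive [v, a] = 1) ∧
      (m' .consistent [] = 1 ↔ ∀ v < k, 0 < m .size [v])) (by decide)
    (by simp [Mem.write_of_ne]) ?_ ⟨by simp, by simp, by simpa using h⟩ ?_).mono ?_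
  · intro k m' _ hF
    simp only [Exp.eval, Exp.evalList, hF.eq .nVar]
  · rintro k m₁ hk ⟨h₁, h₂, h₃⟩ hki hF
    have hs := hF.eq .size
    refine halts_cons (Halts.put (halts_cons ((halts_for (m .size [k]) 10
      (fun b m' => (∀ v < k, ∀ a < m .size [v], m' .alive [v, a] = 1) ∧
        ∀ a < b, m' .alive [k, a] = 1) (by decide) (by simp [Mem.write_of_ne]) ?_
        ⟨by simpa [Mem.write_of_ne] using h₂, by simp⟩ ?_).mono ?_)))
    · intro b m' _ hF'
      simp only [Exp.eval, Exp.evalList, hF'.eq .size, hF'.eq .i]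
      simp [Mem.write_of_ne, hs, hki]
    · rintro b m₂ hb ⟨g₁, g₂⟩ hbi hF'
      have hi : m₂ .i [] = k := by rw [hF'.eq .i]; simp [Mem.write_of_ne, hki]
      refine Halts.put ⟨⟨?_, ?_⟩, by simp [Exp.cost, Exp.costList]⟩
      · intro v hv a ha
        simp [Mem.write_same, Exp.eval, Exp.evalList, g₁ v hv a ha]
      · intro a ha
        rcases Nat.lt_succ_iff_lt_or_eq.1 ha with ha | rfl
        · simp [Mem.write_same, Exp.eval, Exp.evalList, g₂ a ha]
        · simp [Mem.write_same, Exp.eval, Exp.evalList, hi, hbi]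
    · rintro m₂ t ⟨⟨g₁, g₂⟩, hF', ht⟩
      have e₁ : ∀ v < k + 1, m₂ .elim [v] = 0 := by
        intro v hv
        rw [hF'.eq .elim]
        simp only [Mem.write_same, Exp.evalList, Exp.eval, hki]
        split_ifs with hvk
        · rfl
        · exact h₁ v (by simp at hvk; omega)
      have e₂ : ∀ v < k + 1, ∀ a < m .size [v], m₂ .alive [v, a] = 1 := by
        intro v hv a ha
        rcases Nat.lt_succ_iff_lt_or_eq.1 hv with hv | rfl
        · exact g₁ v hv a ha
        · exact g₂ a ha
      have e₃ : m₂ .consistent [] = m₁ .consistent [] := by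
        rw [hF'.eq .consistent]; simp [Mem.write_of_ne]
      have e₄ : m₂ .size [m₂ .i []] = m .size [k] := by
        rw [hF'.eq .size, hF'.eq .i]; simp [Mem.write_of_ne, hs, hki]
      have := hm k
      have : m .size [k] * (10 + (Exp.get .size [.get .i []]).cost + 12) ≤ 30 * D := by
        simp only [Exp.cost, Exp.costList]; omega
      simp only [Exp.cost, Exp.costList] at this ht
      refine halts_cons (halts_when (fun h => halts_assign (halts_nil ⟨⟨?_, ?_, ?_⟩, ?_⟩))
        fun h => halts_nil ⟨⟨e₁, e₂, ?_⟩, ?_⟩)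
      · simpa [Mem.write_of_ne] using e₁
      · simpa [Mem.write_of_ne] using e₂
      · simp only [Exp.eval, Exp.evalList, e₄] at h
        have : m .size [k] = 0 := by by_contra h'; simp [h'] at h
        simp only [Mem.write_same, if_true, eval_zero, zero_ne_one, false_iff]
        exact fun h' => (h' k (by omega)).ne' this
      · simp only [Exp.cost, Exp.costList]
        omega
      · simp only [Exp.eval, Exp.evalList, e₄] at h
        have : 0 < m .size [k] := by
          by_contra h'
          have : m .size [k] = 0 := by omega
          simp [this] at h
        rw [e₃, h₃, Nat.forall_lt_succ_right]
        simp [this]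
      · simp only [Exp.cost, Exp.costList]
        omega
  · rintro m' t ⟨h, -, ht⟩
    simp only [Exp.cost, Exp.costList] at ht
    exact ⟨by nlinarith, h⟩

open Classical in
-- After `k` rounds the arrays describe the graph of the first `k` constraints. Each round enters
-- one edge at both ends, which yields the handshake identity on which the later time bounds rest.
theorem halts_setup_cons {m : Mem} {D : ℕ} (hm : m.Tables D) (h₁ : ∀ l, m .inC l = 0)
    (h₂ : ∀ l, m .fun0 l = 0) (h₃ : ∀ l, m .deg l = 0) :
    Halts (forBelow .p (.get .nCon []) (block [
      assign .i (.get .conA [.get .p []]),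
      assign .j (.get .conB [.get .p []]),
      addCon .i .j,
      testFun .i .j,
      testFun .j .i])) m
    fun m' t => t ≤ 600 * (m .nCon [] + 1) * (D + 1) ^ 2 ∧
      (∀ u v, m' .inC [u, v] = if m.Con u v then 1 else 0) ∧
      (∀ u v, m' .fun0 [u, v] = if m.Con u v ∧ m.Fun u v then 1 else 0) ∧
      m'.NbrOK ∧
      ∑ v ∈ Finset.range (m .nVar []), m' .deg [v] = 2 * m .nCon [] := by
  refine (halts_for (m .nCon []) (400 * (D + 1) ^ 2 + 150)
    (fun k m' => (∀ u v, m' .inC [u, v] = if m.ConBelow k u v then 1 else 0) ∧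
      (∀ u v, m' .fun0 [u, v] = if m.ConBelow k u v ∧ m.Fun u v then 1 else 0) ∧
      m'.NbrOK ∧
      ∑ v ∈ Finset.range (m .nVar []), m' .deg [v] = 2 * k) (by decide)
    (by simp [Mem.write_of_ne, Mem.NbrOK]) ?_ ?_ ?_).mono ?_
  · intro k m' _ hF
    simp only [Exp.eval, Exp.evalList, hF.eq .nCon]
  · simp [Mem.ConBelow, Mem.NbrOK, h₁, h₂, h₃]
  · rintro k m₁ hk ⟨f₁, f₂, f₃, f₄⟩ hkp hF
    refine halts_cons (halts_assign (halts_cons (halts_assign ?_)))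
    simp only [Exp.eval, Exp.evalList, Exp.cost, Exp.costList, hkp]
    simp only [Mem.write_of_ne, ne_eq, reduceCtorEq, not_false_eq_true, hkp, hF.eq .conA,
      hF.eq .conB]
    generalize hm₂ : (m₁.write .i [] (m .conA [k])).write .j [] (m .conB [k]) = m₂
    have hF₂ : ∀ y, y ≠ .i → y ≠ .j → m₂ y = m₁ y := by
      intro y hi hj
      rw [← hm₂, Mem.write_of_ne hj, Mem.write_of_ne hi]
    have hi : m₂ .i [] = m .conA [k] := by rw [← hm₂]; simp [Mem.write]
    have hj : m₂ .j [] = m .conB [k] := by rw [← hm₂]; simp [Mem.write]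
    have hne := hm.con_ne k hk
    refine halts_cons ((halts_addCon (by decide) (by decide) _ (by rwa [hi, hj])).framed ?_)
    rintro m₃ t₃ ⟨ht₃, g₁, g₂, g₃⟩ hF₃
    rw [hi, hj] at g₁ g₂ g₃
    have s₃ : m₃ .size = m .size := by
      rw [hF₃.eq .size, hF₂ _ (by decide) (by decide), hF.eq .size]
    have r₃ : m₃ .rel = m .rel := by
      rw [hF₃.eq .rel, hF₂ _ (by decide) (by decide), hF.eq .rel]
    refine halts_cons ((halts_testFun (.inl ⟨rfl, rfl⟩) m₃ (D := D) (s₃ ▸ hm.size_le _)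
      (s₃ ▸ hm.size_le _)).framed ?_)
    rintro m₄ t₄ ⟨ht₄, g₄⟩ hF₄
    have s₄ : m₄ .size = m .size := by rw [hF₄.eq .size, s₃]
    have r₄ : m₄ .rel = m .rel := by rw [hF₄.eq .rel, r₃]
    refine halts_cons ((halts_testFun (.inr ⟨rfl, rfl⟩) m₄ (D := D) (s₄ ▸ hm.size_le _)
      (s₄ ▸ hm.size_le _)).framed ?_)
    rintro m₅ t₅ ⟨ht₅, g₅⟩ hF₅
    rw [hF₄.eq .i, hF₄.eq .j, hF₃.eq .i, hF₃.eq .j, hi, hj, Mem.Fun.congr s₄ r₄] at g₅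
    rw [hF₃.eq .i, hF₃.eq .j, hi, hj, Mem.Fun.congr s₃ r₃] at g₄
    refine halts_nil ⟨⟨?_, ?_, ?_, ?_⟩, ?_⟩
    · intro u v
      rw [hF₅.eq .inC, hF₄.eq .inC, g₁, hF₂ _ (by decide) (by decide), f₁, Mem.conBelow_succ]
      by_cases h : [u, v] = [m .conA [k], m .conB [k]] ∨ [u, v] = [m .conB [k], m .conA [k]] <;>
        simp only [h, or_true, or_false, if_true, if_false]
    · intro u v
      rw [g₅, g₄, hF₃.eq .fun0, hF₂ _ (by decide) (by decide), f₂, Mem.conBelow_succ]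
      -- The two tests write to different cells because the ends are distinct, so the second does
      -- not overwrite the result of the first.
      by_cases h : [u, v] = [m .conA [k], m .conB [k]]
      · have h' : [u, v] ≠ [m .conB [k], m .conA [k]] := by
          rintro h'; rw [h] at h'; simp at h'; exact hne h'.1
        simp only [List.cons.injEq, and_true] at h
        obtain ⟨rfl, rfl⟩ := h
        simp [h']
      · by_cases h' : [u, v] = [m .conB [k], m .conA [k]]
        · simp only [List.cons.injEq, and_true] at h'
          obtain ⟨rfl, rfl⟩ := h'
          simp
        · simp only [h, h', or_false, if_false]
    · have := nbrOK_addCon (m := m₂) (m' := m₃) (by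
        simpa only [Mem.NbrOK, hF₂ .inC (by decide) (by decide), hF₂ .deg (by decide) (by decide),
          hF₂ .nbr (by decide) (by decide)] using f₃) hne g₁ g₂ g₃
      simpa only [Mem.NbrOK, hF₅.eq .inC, hF₅.eq .deg, hF₅.eq .nbr, hF₄.eq .inC, hF₄.eq .deg,
        hF₄.eq .nbr] using this
    · rw [hF₅.eq .deg, hF₄.eq .deg, Mem.sum_deg_add hne (hm.conA_lt k hk) (hm.conB_lt k hk) g₂,
        hF₂ .deg (by decide) (by decide), f₄]
      ring
    · omega
  · rintro m' t ⟨h, -, ht⟩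
    simp only [Exp.cost, Exp.costList] at ht
    refine ⟨?_, h⟩
    nlinarith [Nat.zero_le (m .nCon [] * D), Nat.zero_le (m .nCon [] * D ^ 2), sq_nonneg D]

theorem halts_setup {m : Mem} {D : ℕ} (hm : m.IsInput D) :
    Halts setup m fun m' t => t ≤ 1000 * (m .nVar [] + m .nCon [] + 1) * (D + 1) ^ 2 ∧
      m'.Ready D := by
  refine halts_cons (halts_assign (halts_cons ((halts_setup_vars (D := D) ?_ ?_).framed ?_)))
  · simpa [Mem.write_of_ne] using hm.size_le
  · simp [Mem.write_same]
  rintro m₁ t₁ ⟨ht₁, f₁, f₂, f₃⟩ hF₁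
  have e₁ : ∀ y, y ∉ [Name.consistent, .i, .elim, .a, .alive] → m₁ y = m y := by
    intro y hy
    simp only [List.mem_cons, List.not_mem_nil, or_false, not_or] at hy
    rw [hF₁ y (by simp [hy]), Mem.write_of_ne hy.1]
  have e₂ := e₁ .nVar (by decide)
  have e₃ := e₁ .nCon (by decide)
  have e₄ := e₁ .size (by decide)
  rw [Mem.write_of_ne (by decide)] at f₁ ht₁
  rw [Mem.write_of_ne (by decide), Mem.write_of_ne (by decide)] at f₂ f₃
  have hT : m₁.Tables D := by
    constructor <;> simp only [e₂, e₃, e₄, e₁ .conA (by decide), e₁ .conB (by decide),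
      e₁ .rel (by decide)]
    exacts [hm.size_le, hm.conA_lt, hm.conB_lt, hm.con_ne, hm.rel_symm, hm.rel_le]
  refine halts_cons ((halts_setup_cons hT ?_ ?_ ?_).framed ?_)
  · rw [e₁ .inC (by decide)]; exact hm.zero _ (by decide)
  · rw [e₁ .fun0 (by decide)]; exact hm.zero _ (by decide)
  · rw [e₁ .deg (by decide)]; exact hm.zero _ (by decide)
  rintro m₂ t₂ ⟨ht₂, g₁, g₂, g₃, g₄⟩ hF₂
  have hA := hF₂.eq .conA
  have hB := hF₂.eq .conB
  have hs := hF₂.eq .size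
  have hr := hF₂.eq .rel
  have hn := hF₂.eq .nVar
  have hc := hF₂.eq .nCon
  have hCon : ∀ u v, m₂.Con u v ↔ m₁.Con u v := by
    intro u v
    rw [Mem.Con, Mem.Con, Mem.ConBelow.congr hA hB, hc]
  refine halts_nil ⟨?_, ?_⟩
  · rw [e₃] at ht₂
    simp only [cost_one]
    nlinarith [Nat.zero_le (m .nCon [] * D), Nat.zero_le (m .nCon [] * D ^ 2), sq_nonneg D,
      Nat.zero_le (m .nVar [] * D), Nat.zero_le (m .nVar [] * D ^ 2)]
  · constructor
    · constructor <;> simp only [hA, hB, hs, hr, hn, hc]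
      exacts [hT.size_le, hT.conA_lt, hT.conB_lt, hT.con_ne, hT.rel_symm, hT.rel_le]
    · rw [hF₂.eq .elim, hn, e₂]; exact f₁
    · rw [hF₂.eq .alive, hn, hs, e₂, e₄]; exact f₂
    · rw [hF₂.eq .consistent, hn, hs, e₂, e₄]; exact f₃
    · intro u v
      rw [g₁]; split_ifs <;> omega
    · intro u v
      rw [g₁, hCon]; simp
    · intro u v
      rw [g₂, hCon, Mem.Fun.congr hs hr]; simp
    · exact g₃
    · rw [hn, hc]; exact g₄

end Program
end FunCSP

-- Depth-first search and the variable finished last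

namespace FunCSP

theorem Mem.write_self (m : Mem) (x : Name) (l : List ℕ) (w : ℕ) :
    m.write x l w x = Function.update (m x) l w := by
  funext l'
  simp [write_same, Function.update_apply]

/-- The first `k` entries of an array. -/
def arr (f : List ℕ → ℕ) (k : ℕ) : List ℕ := (List.range k).map fun p => f [p]

theorem arr_succ (f : List ℕ → ℕ) (k : ℕ) : arr f (k + 1) = arr f k ++ [f [k]] := by
  simp [arr, List.range_succ]

@[simp] theorem arr_zero (f : List ℕ → ℕ) : arr f 0 = [] := rfl

@[simp] theorem length_arr (f : List ℕ → ℕ) (k : ℕ) : (arr f k).length = k := by simp [arr]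

theorem arr_congr {f g : List ℕ → ℕ} {k : ℕ} (h : ∀ p < k, f [p] = g [p]) : arr f k = arr g k := by
  simpa [arr] using h

theorem mem_arr {f : List ℕ → ℕ} {k v : ℕ} : v ∈ arr f k ↔ ∃ p < k, f [p] = v := by simp [arr]

@[simp] theorem arr_update (f : List ℕ → ℕ) (k w : ℕ) : arr (Function.update f [k] w) k = arr f k :=
  arr_congr fun p hp => Function.update_of_ne (by simp [hp.ne]) _ _

theorem arr_update_succ (f : List ℕ → ℕ) (k w : ℕ) :
    arr (Function.update f [k] w) (k + 1) = arr f k ++ [w] := by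
  simp [arr_succ]

/-- The variables visited by a search are on the stack or have been put out, once each. -/
structure Visit (n : ℕ) (vis stk out : List ℕ → ℕ) (sp k : ℕ) : Prop where
  nodup : (arr stk sp ++ arr out k).Nodup
  mem : ∀ v, v ∈ arr stk sp ++ arr out k ↔ v < n ∧ vis [v] ≠ 0

namespace Visit

variable {n : ℕ} {vis stk out : List ℕ → ℕ} {sp k : ℕ}

theorem push (h : Visit n vis stk out sp k) {v : ℕ} (hv : v < n) (hvis : vis [v] = 0) :
    Visit n (Function.update vis [v] 1) (Function.update stk [sp] v) out (sp + 1) k := by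
  have hmem := (h.mem v).not.2 (by simp [hvis])
  constructor
  · rw [arr_update_succ, List.append_assoc, List.singleton_append, List.nodup_middle]
    exact List.nodup_cons.2 ⟨hmem, h.nodup⟩
  · intro u
    have := h.mem u
    rw [arr_update_succ]
    by_cases huv : u = v
    · subst huv; simp [hv]
    · simpa [huv, Function.update_of_ne] using this

/-- Moving the top of the stack to the output only permutes the concatenated list. -/
theorem pop (h : Visit n vis stk out (sp + 1) k) :
    Visit n vis stk (Function.update out [k] (stk [sp])) sp (k + 1) := by
  have hp : (arr stk (sp + 1) ++ arr out k).Perm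
      (arr stk sp ++ arr (Function.update out [k] (stk [sp])) (k + 1)) := by
    rw [arr_succ, arr_update_succ, List.append_assoc]
    exact List.Perm.append_left _ List.perm_append_comm
  exact ⟨hp.nodup_iff.1 h.nodup, fun v => hp.mem_iff.symm.trans (h.mem v)⟩

theorem top (h : Visit n vis stk out (sp + 1) k) : stk [sp] < n ∧ vis [stk [sp]] ≠ 0 :=
  (h.mem _).1 (by simp [arr_succ])

/-- This ensures that the truncated difference `nVar - nFin` in the potential really drops when a
variable is put out. -/
theorem add_le (h : Visit n vis stk out sp k) : sp + k ≤ n := by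
  have h₁ := List.toFinset_card_of_nodup h.nodup
  have h₂ : (arr stk sp ++ arr out k).toFinset ⊆ Finset.range n := fun v hv =>
    Finset.mem_range.2 ((h.mem v).1 (by simpa using hv)).1
  have := Finset.card_le_card h₂
  rw [h₁] at this
  simpa using this

theorem eq_of_all (h : Visit n vis stk out 0 k) (hall : ∀ v < n, vis [v] ≠ 0) : k = n := by
  have h₁ := List.toFinset_card_of_nodup h.nodup
  have h₂ : (arr stk 0 ++ arr out k).toFinset = Finset.range n := by
    ext v
    have := hall v
    rw [List.mem_toFinset, h.mem]
    simp; tauto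
  rw [h₂] at h₁
  simpa using h₁.symm

end Visit

def Mem.Edge (m : Mem) (u v : ℕ) : Prop := m .fun0 [u, v] ≠ 0

/-- The invariant of the depth-first search from `s`, where `m` contains the graph, and `vis₀`
has been visited before. -/
structure DFS (m : Mem) (vis₀ : ℕ → Prop) (s : ℕ) (vis stk out ptr : List ℕ → ℕ) (sp k : ℕ) : Prop
    extends Visit (m .nVar []) vis stk out sp k where
  done : ∀ u ∈ arr out k, m .deg [u] ≤ ptr [u]
  seen : ∀ u < m .nVar [], ∀ q < m .deg [u], q < ptr [u] → m.Edge u (m .nbr [u, q]) →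
    vis [m .nbr [u, q]] ≠ 0
  old : ∀ v < m .nVar [], vis₀ v → vis [v] ≠ 0
  reach : ∀ v < m .nVar [], vis [v] ≠ 0 → vis₀ v ∨ Relation.ReflTransGen m.Edge s v
  stack : ∀ v ∈ arr stk sp, Relation.ReflTransGen m.Edge s v
  root : 0 < sp ∧ stk [0] = s ∨ sp = 0 ∧ 0 < k ∧ out [k - 1] = s

namespace DFS

variable {m : Mem} {vis₀ : ℕ → Prop} {s : ℕ} {vis stk out ptr : List ℕ → ℕ} {sp k : ℕ}

theorem advance (h : DFS m vis₀ s vis stk out ptr sp k) {u : ℕ}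
    (hv : m.Edge u (m .nbr [u, ptr [u]]) → vis [m .nbr [u, ptr [u]]] ≠ 0) :
    DFS m vis₀ s vis stk out (Function.update ptr [u] (ptr [u] + 1)) sp k := by
  refine { h with done := ?_, seen := ?_ }
  · intro w hw
    have := h.done w hw
    by_cases hwu : w = u
    · subst hwu; simp; omega
    · simpa [hwu, Function.update_of_ne] using this
  · intro w hw q hq hq'
    by_cases hwu : w = u
    · subst hwu
      simp only [Function.update_self] at hq'
      rcases Nat.lt_succ_iff_lt_or_eq.1 hq' with hq' | rfl
      · exact h.seen w hw q hq hq'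
      · exact hv
    · rw [Function.update_of_ne (by simpa using hwu)] at hq'
      exact h.seen w hw q hq hq'

theorem push (h : DFS m vis₀ s vis stk out ptr (sp + 1) k) {v : ℕ} (hv : v < m .nVar [])
    (hvis : vis [v] = 0) (hE : m.Edge (stk [sp]) v) :
    DFS m vis₀ s (Function.update vis [v] 1) (Function.update stk [sp + 1] v) out ptr (sp + 2) k := by
  have hmono : ∀ w, vis [w] ≠ 0 → Function.update vis [v] 1 [w] ≠ 0 := by
    intro w hw
    by_cases hwv : w = v
    · subst hwv; simp
    · rwa [Function.update_of_ne (by simpa using hwv)]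
  have hsv : Relation.ReflTransGen m.Edge s v := (h.stack _ (by simp [arr_succ])).tail hE
  refine { h.toVisit.push hv hvis with
    done := h.done, seen := ?_, old := ?_, reach := ?_, stack := ?_, root := ?_ }
  · exact fun u hu q hq hq' hE => hmono _ (h.seen u hu q hq hq' hE)
  · exact fun w hw hw' => hmono _ (h.old w hw hw')
  · intro w hw hw'
    by_cases hwv : w = v
    · subst hwv
      exact .inr hsv
    · rw [Function.update_of_ne (by simpa using hwv)] at hw'
      exact h.reach w hw hw'
  · intro w hw
    rw [arr_update_succ] at hw
    rcases List.mem_append.1 hw with hw | hw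
    · exact h.stack w hw
    · rwa [List.mem_singleton.1 hw]
  · have := h.root
    simp at this
    exact .inl ⟨by omega, by rw [Function.update_of_ne (by simp), this]⟩

theorem pop (h : DFS m vis₀ s vis stk out ptr (sp + 1) k) (hd : m .deg [stk [sp]] ≤ ptr [stk [sp]]) :
    DFS m vis₀ s vis stk (Function.update out [k] (stk [sp])) ptr sp (k + 1) := by
  refine { h.toVisit.pop with
    done := ?_, seen := h.seen, old := h.old, reach := h.reach, root := ?_
    stack := fun v hv => h.stack v (by rw [arr_succ]; exact List.mem_append_left _ hv) }
  · intro u hu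
    rw [arr_update_succ] at hu
    rcases List.mem_append.1 hu with hu | hu
    · exact h.done u hu
    · rw [List.mem_singleton.1 hu]; exact hd
  · have := h.root
    simp at this
    rcases Nat.eq_zero_or_pos sp with rfl | hsp
    · exact .inr ⟨rfl, by omega, by simp [this]⟩
    · exact .inl ⟨hsp, this⟩

/-- With an empty stack every visited variable has been put out, so its whole array has been
scanned, and scanned edges lead to visited variables. This covers the earlier trees as well. -/
theorem closed (h : DFS m vis₀ s vis stk out ptr 0 k)
    (hE : ∀ u v, m.Edge u v → v < m .nVar [] ∧ ∃ q < m .deg [u], m .nbr [u, q] = v) {u v : ℕ}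
    (hu : u < m .nVar []) (hvis : vis [u] ≠ 0) (huv : m.Edge u v) : vis [v] ≠ 0 := by
  have h₁ := h.done u (by simpa using (h.mem u).2 ⟨hu, hvis⟩)
  obtain ⟨-, q, hq, rfl⟩ := hE u v huv
  exact h.seen u hu q hq (hq.trans_le h₁) huv

end DFS

/-- The first part of the potential counts the entries not yet scanned; advancing one pointer uses
up one of them. -/
theorem sum_sub_update {n u : ℕ} {f g : List ℕ → ℕ} (hu : u < n) (h : g [u] < f [u]) :
    ∑ x ∈ Finset.range n, (f [x] - Function.update g [u] (g [u] + 1) [x]) + 1 =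
      ∑ x ∈ Finset.range n, (f [x] - g [x]) := by
  have hu' := Finset.mem_range.2 hu
  rw [← Finset.add_sum_erase _ _ hu', ← Finset.add_sum_erase _ (fun x => f [x] - g [x]) hu',
    Finset.sum_congr rfl (g := fun x => f [x] - g [x])]
  · simp only [Function.update_self]; omega
  · intro x hx
    rw [Function.update_of_ne (by simpa using (Finset.mem_erase.1 hx).1)]

namespace Program

/-- Every round either advances a pointer or puts out a variable. Either way one unit of potential,
worth 100 steps, is released. -/
theorem halts_firstSearch_loop {m : Mem} {m₀ : Mem} {vis₀ : ℕ → Prop} {s : ℕ}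
    (hE : ∀ u v, m.Edge u v → v < m .nVar [] ∧ ∃ q < m .deg [u], m .nbr [u, q] = v)
    (h₀ : ∀ y ∈ [Name.deg, .nbr, .fun0], m₀ y = m y)
    (hI : DFS m vis₀ s (m₀ .vis) (m₀ .stk) (m₀ .fin) (m₀ .ptr) (m₀ .sp []) (m₀ .nFin [])) :
    Halts (.while (.lt 0 (.get .sp [])) (block [
        assign .u (.get .stk [.sub (.get .sp []) 1]),
        .ite (.lt (.get .ptr [.get .u []]) (.get .deg [.get .u []]))
          (block [
            assign .v (.get .nbr [.get .u [], .get .ptr [.get .u []]]),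
            .put .ptr [.get .u []] (.add (.get .ptr [.get .u []]) 1),
            when (.and (.get .fun0 [.get .u [], .get .v []]) (.not (.get .vis [.get .v []]))) (block [
              .put .vis [.get .v []] 1,
              .put .stk [.get .sp []] (.get .v []),
              inc .sp])])
          (block [
            dec .sp,
            .put .fin [.get .nFin []] (.get .u []),
            inc .nFin])])) m₀ fun m' t =>
      DFS m vis₀ s (m' .vis) (m' .stk) (m' .fin) (m' .ptr) 0 (m' .nFin []) ∧
      t + 100 * (∑ u ∈ Finset.range (m .nVar []), (m .deg [u] - m' .ptr [u]) +
          (m .nVar [] - m' .nFin [])) ≤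
        100 * (∑ u ∈ Finset.range (m .nVar []), (m .deg [u] - m₀ .ptr [u]) +
          (m .nVar [] - m₀ .nFin [])) + 10 := by
  refine Halts.mono (Halts.loop
    (fun m' => DFS m vis₀ s (m' .vis) (m' .stk) (m' .fin) (m' .ptr) (m' .sp []) (m' .nFin []))
    (fun m' => 100 * (∑ u ∈ Finset.range (m .nVar []), (m .deg [u] - m' .ptr [u]) +
          (m .nVar [] - m' .nFin []))) hI ?_) ?_
  · intro m₁ h hF hsp
    have h₁ : m₁ .deg = m .deg := by rw [hF.eq .deg, h₀ .deg (by decide)]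
    have h₂ : m₁ .nbr = m .nbr := by rw [hF.eq .nbr, h₀ .nbr (by decide)]
    have h₃ : m₁ .fun0 = m .fun0 := by rw [hF.eq .fun0, h₀ .fun0 (by decide)]
    obtain ⟨d, hd⟩ : ∃ d, m₁ .sp [] = d + 1 := by
      refine Nat.exists_eq_succ_of_ne_zero fun h' => hsp ?_
      simp [Exp.eval, Exp.evalList, h']
    rw [hd] at h
    refine halts_cons (halts_assign (halts_cons (Halts.ite (fun hlt => ?_) fun hlt => ?_)))
    · refine halts_cons (halts_assign (halts_cons (Halts.put (halts_cons
        (halts_when (fun hw => ?_) fun hw => ?_)))))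
      · refine halts_cons (Halts.put (halts_cons (Halts.put (halts_cons (halts_inc
          (halts_nil (halts_nil (halts_nil ?_))))))))
        simp [Mem.write_of_ne, Mem.write_self, Exp.eval, Exp.evalList, Exp.cost, Exp.costList, hd, h₁, h₂, h₃] at hlt hw ⊢
        -- The program advances the pointer before it pushes. The invariant is followed in the
        -- opposite order, because a pointer may pass an edge only when its target has been visited.
        refine ⟨(h.push (hE _ _ hw.1).1 hw.2 hw.1).advance fun _ => ?_, ?_⟩
        · simp
        · have := sum_sub_update h.top.1 hlt
          omega
      · refine halts_nil (halts_nil ?_)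
        simp [Mem.write_of_ne, Mem.write_self, Exp.eval, Exp.evalList, Exp.cost, Exp.costList, hd, h₁, h₂, h₃] at hlt hw ⊢
        refine ⟨h.advance hw, ?_⟩
        have := sum_sub_update h.top.1 hlt
        omega
    · refine halts_cons (halts_dec (halts_cons (Halts.put (halts_cons (halts_inc
          (halts_nil (halts_nil ?_)))))))
      simp [Mem.write_of_ne, Mem.write_self, Exp.eval, Exp.evalList, Exp.cost, Exp.costList, hd, h₁] at hlt ⊢
      have := h.add_le
      exact ⟨h.pop hlt, by omega⟩
  · rintro m' t ⟨hI', hsp, hF, ht⟩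
    have : m' .sp [] = 0 := by
      by_contra h'
      have h'' : 0 < m' .sp [] := by omega
      simp [Exp.eval, Exp.evalList, h''] at hsp
    rw [this] at hI'
    refine ⟨hI', ht.trans ?_⟩
    simp [Exp.cost, Exp.costList]

/-- The last clause of the loop invariant carries the idea: as soon as `r` has been visited, all
variables have been, and the last one put out reaches everything. No later tree can then be started,
so this variable stays last. -/
theorem halts_firstSearch {m : Mem} {r : ℕ}
    (hE : ∀ u v, m.Edge u v → v < m .nVar [] ∧ ∃ q < m .deg [u], m .nbr [u, q] = v)
    (h₀ : ∀ y ∈ [Name.vis, .ptr, .nFin], ∀ l, m y l = 0)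
    (hr : r < m .nVar []) (hreach : ∀ v < m .nVar [], Relation.ReflTransGen m.Edge r v) :
    Halts firstSearch m fun m' t =>
      t ≤ 100 * (∑ v ∈ Finset.range (m .nVar []), m .deg [v]) + 200 * (m .nVar [] + 1) ∧
      (∀ v, v ∈ arr (m' .fin) (m .nVar []) ↔ v < m .nVar []) ∧
      ∀ v < m .nVar [], Relation.ReflTransGen m.Edge (m' .fin [m .nVar [] - 1]) v := by
  refine (halts_forBelow (m .nVar []) 80
    (fun k m' => Visit (m .nVar []) (m' .vis) (m' .stk) (m' .fin) 0 (m' .nFin []) ∧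
      (∀ u ∈ arr (m' .fin) (m' .nFin []), m .deg [u] ≤ m' .ptr [u]) ∧
      (∀ u < m .nVar [], ∀ q < m .deg [u], q < m' .ptr [u] → m.Edge u (m .nbr [u, q]) →
        m' .vis [m .nbr [u, q]] ≠ 0) ∧
      (∀ v < k, m' .vis [v] ≠ 0) ∧
      (m' .vis [r] ≠ 0 → (∀ v < m .nVar [], m' .vis [v] ≠ 0) ∧
        ∀ v < m .nVar [], Relation.ReflTransGen m.Edge (m' .fin [m' .nFin [] - 1]) v))
    (fun m' => 100 * (∑ u ∈ Finset.range (m .nVar []), (m .deg [u] - m' .ptr [u]) +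
          (m .nVar [] - m' .nFin []))) (by decide) ?_ ?_ ?_).mono ?_
  · intro k m' _ hF
    simp only [Exp.eval, Exp.evalList, hF.eq .nVar]
  · simp only [List.mem_cons, List.not_mem_nil, or_false, forall_eq_or_imp, forall_eq] at h₀
    refine ⟨⟨?_, ?_⟩, ?_⟩ <;> simp [Mem.write_of_ne, h₀]
  · rintro s m₁ hs ⟨f₁, f₂, f₃, f₄, f₅⟩ hm₁ hF
    refine halts_when (fun hvis => ?_) fun hvis => ?_
    · simp only [Exp.eval, Exp.evalList, hm₁] at hvis
      replace hvis : m₁ .vis [s] = 0 := by by_contra h; simp [h] at hvis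
      -- If `r` had been visited, then so would `s`.
      have hr0 : m₁ .vis [r] = 0 := by
        by_contra h
        exact (f₅ h).1 s hs hvis
      refine halts_cons (Halts.put (halts_cons (Halts.put (halts_cons (halts_assign (halts_cons
        ((halts_firstSearch_loop (m := m) (vis₀ := fun v => m₁ .vis [v] ≠ 0) (s := s) hE
          ?_ ?_).framed ?_)))))))
      · intro y hy
        simp only [List.mem_cons, List.not_mem_nil, or_false] at hy
        rcases hy with rfl | rfl | rfl <;> simp [Mem.write_of_ne, hF.eq .deg, hF.eq .nbr, hF.eq .fun0]
      · simp [Mem.write_of_ne, Mem.write_self, Exp.eval, Exp.evalList, hm₁]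
        have hV := f₁.push hs hvis
        simp only [Nat.zero_add] at hV
        have hmono : ∀ w, m₁ .vis [w] ≠ 0 → Function.update (m₁ .vis) [s] 1 [w] ≠ 0 := by
          intro w hw
          by_cases hwv : w = s
          · subst hwv; simp
          · rwa [Function.update_of_ne (by simpa using hwv)]
        refine { hV with
          done := f₂, seen := ?_, old := fun v _ => hmono v, reach := ?_, stack := ?_, root := ?_ }
        · exact fun u hu q hq hq' hE => hmono _ (f₃ u hu q hq hq' hE)
        · intro v hv hv'
          by_cases hvs : v = s
          · subst hvs; exact .inr .refl
          · rw [Function.update_of_ne (by simpa using hvs)] at hv'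
            exact .inl hv'
        · simp [arr, Relation.ReflTransGen.refl]
        · simp
      · rintro m₂ t ⟨h, ht⟩ hF₂
        simp only [Mem.write_of_ne, ne_eq, reduceCtorEq, not_false_eq_true] at ht
        have hroot : m₂ .fin [m₂ .nFin [] - 1] = s :=
          (by simpa using h.root : 0 < m₂ .nFin [] ∧ m₂ .fin [m₂ .nFin [] - 1] = s).2
        refine halts_nil ⟨?_, ?_⟩
        · simp only [Mem.write_of_ne, ne_eq, reduceCtorEq, not_false_eq_true, hroot]
          have hsv : m₂ .vis [s] ≠ 0 := by
            refine ((h.mem s).1 ?_).2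
            obtain ⟨-, hk, -⟩ : _ ∧ 0 < m₂ .nFin [] ∧ _ := h.root.resolve_left (by simp)
            exact List.mem_append_right _ (mem_arr.2 ⟨m₂ .nFin [] - 1, by omega, hroot⟩)
          refine ⟨h.toVisit, h.done, h.seen, ?_, ?_⟩
          · intro v hv
            rcases Nat.lt_succ_iff_lt_or_eq.1 hv with hv | rfl
            · exact h.old v (hv.trans hs) (f₄ v hv)
            · exact hsv
          · intro hrv
            -- `r` was unvisited before this search, so the search reached it from its root `s`; all
            -- that `r` reaches is then visited by closedness.
            have hsr : Relation.ReflTransGen m.Edge s r :=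
              (h.reach r hr hrv).resolve_left fun h' => h' hr0
            refine ⟨fun v hv => ?_, fun v hv => hsr.trans (hreach v hv)⟩
            have hrv' := hreach v hv
            clear hv
            have : v < m .nVar [] ∧ m₂ .vis [v] ≠ 0 := by
              induction hrv' with
              | refl => exact ⟨hr, hrv⟩
              | tail _ huv ih =>
                exact ⟨(hE _ _ huv).1, h.closed hE ih.1 ih.2 huv⟩
            exact this.2
        · simp only [Mem.write_of_ne, ne_eq, reduceCtorEq, not_false_eq_true, Exp.cost, Exp.costList]
          omega
    · simp only [Exp.eval, Exp.evalList, hm₁] at hvis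
      replace hvis : m₁ .vis [s] ≠ 0 := by intro h; simp [h] at hvis
      simp only [Mem.write_of_ne, ne_eq, reduceCtorEq, not_false_eq_true]
      refine ⟨⟨f₁, f₂, f₃, ?_, f₅⟩, by simp [Exp.cost, Exp.costList]⟩
      intro v hv
      rcases Nat.lt_succ_iff_lt_or_eq.1 hv with hv | rfl
      · exact f₄ v hv
      · exact hvis
  · rintro m' t ⟨⟨f₁, f₂, f₃, f₄, f₅⟩, -, -, ht⟩
    have hn := f₁.eq_of_all f₄
    rw [hn] at f₅ f₁ ht
    refine ⟨?_, fun v => ?_, (f₅ (f₄ r hr)).2⟩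
    · simp only [List.mem_cons, List.not_mem_nil, or_false, forall_eq_or_imp, forall_eq] at h₀
      simp [Mem.write_of_ne, h₀, Exp.cost, Exp.costList] at ht
      omega
    · have := f₁.mem v
      simp only [arr_zero, List.nil_append] at this
      exact this.trans ⟨fun h => h.1, fun h => ⟨h, f₄ v h⟩⟩

end Program
end FunCSP

-- The elimination ordering

namespace FunCSP

/-- The sum of `deg + 1` over the variables that have not been put out. -/
def restDeg (n : ℕ) (deg : List ℕ → ℕ) (l : List ℕ) : ℕ :=
  ∑ v ∈ Finset.range n, if v ∈ l then 0 else deg [v] + 1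

theorem restDeg_append {n : ℕ} {deg : List ℕ → ℕ} {l : List ℕ} {u : ℕ} (hu : u < n) (hl : u ∉ l) :
    restDeg n deg (l ++ [u]) + (deg [u] + 1) = restDeg n deg l := by
  have hu' := Finset.mem_range.2 hu
  rw [restDeg, restDeg, ← Finset.add_sum_erase _ _ hu',
    ← Finset.add_sum_erase _ (fun v => if v ∈ l then 0 else deg [v] + 1) hu',
    Finset.sum_congr rfl (g := fun v => if v ∈ l then 0 else deg [v] + 1)]
  · simp [hl]; omega
  · intro v hv
    simp [(Finset.mem_erase.1 hv).1]

theorem restDeg_nil (n : ℕ) (deg : List ℕ → ℕ) :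
    restDeg n deg [] = ∑ v ∈ Finset.range n, deg [v] + n := by
  simp [restDeg, Finset.sum_add_distrib]

theorem Visit.mono_push {vis : List ℕ → ℕ} {v w : ℕ} (h : vis [w] ≠ 0) :
    Function.update vis [v] 1 [w] ≠ 0 := by
  by_cases hwv : w = v
  · subst hwv; simp
  · rwa [Function.update_of_ne (by simpa using hwv)]

namespace Program

theorem halts_secondSearch_nbrs {m : Mem} {n : ℕ} (hfun : ∀ u v, m .fun0 [u, v] ≠ 0 → u < n)
    (hV : Visit n (m .vis') (m .stk) (m .ord) (m .sp []) (m .nOrd [])) :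
    Halts (forBelow .p (.get .deg [.get .u []]) (block [
      assign .v (.get .nbr [.get .u [], .get .p []]),
      when (.and (.get .fun0 [.get .v [], .get .u []]) (.not (.get .vis' [.get .v []]))) (block [
        .put .vis' [.get .v []] 1,
        .put .stk [.get .sp []] (.get .v []),
        inc .sp])])) m fun m' t => t ≤ 70 * (m .deg [m .u []] + 1) ∧
      Visit n (m' .vis') (m' .stk) (m .ord) (m' .sp []) (m .nOrd []) ∧
      ∀ v, m .vis' [v] ≠ 0 → m' .vis' [v] ≠ 0 := by
  refine (halts_for (m .deg [m .u []]) 45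
    (fun _ m' => Visit n (m' .vis') (m' .stk) (m .ord) (m' .sp []) (m .nOrd []) ∧
      ∀ v, m .vis' [v] ≠ 0 → m' .vis' [v] ≠ 0) (by decide) (by simp [Mem.write_of_ne]) ?_
      ⟨hV, fun _ => id⟩ ?_).mono ?_
  · intro k m' _ hF
    simp only [Exp.eval, Exp.evalList, hF.eq .deg, hF.eq .u]
  · rintro p m₁ hp ⟨h₁, h₂⟩ hmp hF
    have hf := hF.eq .fun0
    refine halts_cons (halts_assign (halts_cons (halts_when (fun hw => ?_) fun hw => ?_)))
    · refine halts_cons (Halts.put (halts_cons (Halts.put (halts_cons (halts_inc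
        (halts_nil (halts_nil ?_)))))))
      simp [Mem.write_of_ne, Mem.write_self, Exp.eval, Exp.evalList, Exp.cost, Exp.costList, hf] at hw ⊢
      exact ⟨h₁.push (hfun _ _ hw.1) hw.2, fun v hv => Visit.mono_push (h₂ v hv)⟩
    · refine halts_nil ?_
      simp only [Mem.write_of_ne, ne_eq, reduceCtorEq, not_false_eq_true]
      exact ⟨⟨h₁, h₂⟩, by simp [Exp.cost, Exp.costList]⟩
  · rintro m' t ⟨h, -, ht⟩
    simp only [Exp.cost, Exp.costList] at ht
    exact ⟨by omega, h⟩

/-- The variable `c` is the root of the very first search: it is entry 0 of the output, or the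
output is empty and `c` is alone on the stack. Putting out `u` releases `deg [u] + 1` units of
potential, which pay for scanning its neighbours. -/
theorem halts_secondSearch_loop {m : Mem} {n c : ℕ} (hfun : ∀ u v, m .fun0 [u, v] ≠ 0 → u < n)
    (hV : Visit n (m .vis') (m .stk) (m .ord) (m .sp []) (m .nOrd []))
    (hc : 0 < m .nOrd [] ∧ m .ord [0] = c ∨ m .nOrd [] = 0 ∧ m .sp [] = 1 ∧ m .stk [0] = c) :
    Halts (.while (.lt 0 (.get .sp [])) (block [
        dec .sp,
        assign .u (.get .stk [.get .sp []]),
        .put .ord [.get .nOrd []] (.get .u []),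
        inc .nOrd,
        forBelow .p (.get .deg [.get .u []]) (block [
          assign .v (.get .nbr [.get .u [], .get .p []]),
          when (.and (.get .fun0 [.get .v [], .get .u []]) (.not (.get .vis' [.get .v []]))) (block [
            .put .vis' [.get .v []] 1,
            .put .stk [.get .sp []] (.get .v []),
            inc .sp])])])) m fun m' t =>
      Visit n (m' .vis') (m' .stk) (m' .ord) 0 (m' .nOrd []) ∧
      (∀ v, m .vis' [v] ≠ 0 → m' .vis' [v] ≠ 0) ∧
      0 < m' .nOrd [] ∧ m' .ord [0] = c ∧
      t + 150 * restDeg n (m .deg) (arr (m' .ord) (m' .nOrd [])) ≤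
        150 * restDeg n (m .deg) (arr (m .ord) (m .nOrd [])) + 10 := by
  refine Halts.mono (Halts.loop
    (fun m' => Visit n (m' .vis') (m' .stk) (m' .ord) (m' .sp []) (m' .nOrd []) ∧
      (∀ v, m .vis' [v] ≠ 0 → m' .vis' [v] ≠ 0) ∧
      (0 < m' .nOrd [] ∧ m' .ord [0] = c ∨ m' .nOrd [] = 0 ∧ m' .sp [] = 1 ∧ m' .stk [0] = c))
    (fun m' => 150 * restDeg n (m .deg) (arr (m' .ord) (m' .nOrd []))) ⟨hV, fun _ => id, hc⟩ ?_) ?_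
  · rintro m₁ ⟨f₁, f₂, f₃⟩ hF hsp
    have hd := hF.eq .deg
    have hf := hF.eq .fun0
    obtain ⟨d, hd'⟩ : ∃ d, m₁ .sp [] = d + 1 := by
      refine Nat.exists_eq_succ_of_ne_zero fun h' => hsp ?_
      simp [Exp.eval, Exp.evalList, h']
    rw [hd'] at f₁ f₃
    have hcur : Function.update (m₁ .ord) [m₁ .nOrd []] (m₁ .stk [d]) [0] = c := by
      rcases f₃ with ⟨h, h'⟩ | ⟨h, h', h''⟩
      · rwa [Function.update_of_ne (by simp; omega)]
      · have : d = 0 := by omega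
        rw [h, Function.update_self, this, h'']
    refine halts_cons (halts_dec (halts_cons (halts_assign (halts_cons (Halts.put (halts_cons
      (halts_inc (halts_cons ((halts_secondSearch_nbrs (n := n) ?_ ?_).framed ?_)))))))))
    · simpa [Mem.write_of_ne, hf] using hfun
    · simpa [Mem.write_of_ne, Mem.write_self, Exp.eval, Exp.evalList, hd'] using f₁.pop
    · rintro m₂ t ⟨ht, h₁, h₂⟩ hF₂
      simp [Mem.write_of_ne, Mem.write_self, Exp.eval, Exp.evalList, hd', hd] at ht h₁ h₂
      have e₁ : m₂ .ord = Function.update (m₁ .ord) [m₁ .nOrd []] (m₁ .stk [d]) := by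
        rw [hF₂.eq .ord]
        simp [Mem.write_of_ne, Mem.write_self, Exp.eval, Exp.evalList, hd']
      have e₂ : m₂ .nOrd [] = m₁ .nOrd [] + 1 := by
        rw [hF₂.eq .nOrd]
        simp [Mem.write_of_ne, Mem.write_self]
      refine halts_nil ?_
      rw [e₁, e₂]
      refine ⟨⟨h₁, fun v hv => h₂ v (f₂ v hv), .inl ⟨by omega, hcur⟩⟩, ?_⟩
      have hnd := f₁.nodup
      rw [arr_succ, List.append_assoc, List.singleton_append, List.nodup_middle,
        List.nodup_cons, List.mem_append, not_or] at hnd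
      have := restDeg_append (deg := m .deg) f₁.top.1 hnd.1.2
      rw [arr_update_succ]
      simp only [Exp.cost, Exp.costList]
      omega
  · rintro m' t ⟨⟨f₁, f₂, f₃⟩, hsp, hF, ht⟩
    have : m' .sp [] = 0 := by
      by_contra h'
      have h'' : 0 < m' .sp [] := by omega
      simp [Exp.eval, Exp.evalList, h''] at hsp
    rw [this] at f₁ f₃
    obtain ⟨h₁, h₂⟩ := f₃.resolve_right (by simp)
    refine ⟨f₁, f₂, h₁, h₂, ht.trans ?_⟩
    simp [Exp.cost, Exp.costList]

/-- Only two properties of the ordering are needed: it lists every variable once, and it begins with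
the variable that the first search finished last. Its topological property plays no role when one
variable reaches all. -/
theorem halts_secondSearch {m : Mem} (hn : 0 < m .nVar [])
    (hfun : ∀ u v, m .fun0 [u, v] ≠ 0 → u < m .nVar [])
    (hfin : ∀ v, v ∈ arr (m .fin) (m .nVar []) ↔ v < m .nVar [])
    (h₀ : ∀ y ∈ [Name.vis', .nOrd], ∀ l, m y l = 0) :
    Halts secondSearch m fun m' t =>
      t ≤ 150 * (∑ v ∈ Finset.range (m .nVar []), m .deg [v]) + 300 * (m .nVar [] + 1) ∧
      (arr (m' .ord) (m .nVar [])).Nodup ∧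
      (∀ v, v ∈ arr (m' .ord) (m .nVar []) ↔ v < m .nVar []) ∧
      m' .ord [0] = m .fin [m .nVar [] - 1] := by
  refine (halts_forBelow (m .nVar []) 80
    (fun k m' => Visit (m .nVar []) (m' .vis') (m' .stk) (m' .ord) 0 (m' .nOrd []) ∧
      (∀ p < k, m' .vis' [m .fin [m .nVar [] - (p + 1)]] ≠ 0) ∧
      (0 < m' .nOrd [] ∧ m' .ord [0] = m .fin [m .nVar [] - 1] ∨ k = 0 ∧ m' .nOrd [] = 0))
    (fun m' => 150 * restDeg (m .nVar []) (m .deg) (arr (m' .ord) (m' .nOrd []))) (by decide)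
    ?_ ?_ ?_).mono ?_
  · intro k m' _ hF
    simp only [Exp.eval, Exp.evalList, hF.eq .nVar]
  · simp only [List.mem_cons, List.not_mem_nil, or_false, forall_eq_or_imp, forall_eq] at h₀
    refine ⟨⟨?_, ?_⟩, ?_⟩ <;> simp [Mem.write_of_ne, h₀]
  · rintro q m₁ hq ⟨f₁, f₂, f₃⟩ hm₁ hF
    have hs : m₁ .fin [m₁ .nVar [] - (m₁ .q [] + 1)] = m .fin [m .nVar [] - (q + 1)] := by
      rw [hF.eq .fin, hF.eq .nVar, hm₁]
    have hs' : m .fin [m .nVar [] - (q + 1)] < m .nVar [] :=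
      (hfin _).1 (mem_arr.2 ⟨m .nVar [] - (q + 1), by omega, rfl⟩)
    have hf₂ : ∀ {vis : List ℕ → ℕ}, (∀ v, m₁ .vis' [v] ≠ 0 → vis [v] ≠ 0) →
        vis [m .fin [m .nVar [] - (q + 1)]] ≠ 0 →
        ∀ p < q + 1, vis [m .fin [m .nVar [] - (p + 1)]] ≠ 0 := by
      intro vis h h' p hp
      rcases Nat.lt_succ_iff_lt_or_eq.1 hp with hp | rfl
      · exact h _ (f₂ p hp)
      · exact h'
    refine halts_cons (halts_assign (halts_cons (halts_when (fun hvis => ?_) fun hvis => ?_)))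
    · simp [Exp.eval, Exp.evalList, hs, Mem.write_same, Mem.write_of_ne] at hvis
      refine halts_cons (Halts.put (halts_cons (Halts.put (halts_cons (halts_assign (halts_cons
        ((halts_secondSearch_loop (n := m .nVar []) (c := m .fin [m .nVar [] - 1])
          ?_ ?_ ?_).framed ?_)))))))
      · simpa [Mem.write_of_ne, hF.eq .fun0] using hfun
      · simpa [Mem.write_of_ne, Mem.write_self, Exp.eval, Exp.evalList, hs] using f₁.push hs' hvis
      · simp [Mem.write_of_ne, Mem.write_self, Exp.eval, Exp.evalList, hs]
        rcases f₃ with h | ⟨rfl, h⟩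
        · exact .inl h
        · exact .inr ⟨h, rfl⟩
      · rintro m₂ t ⟨h₁, h₂, h₃, h₄, ht⟩ hF₂
        simp [Mem.write_of_ne, Mem.write_self, Exp.eval, Exp.evalList, hs, hF.eq .deg] at h₂ ht
        simp only [Mem.write_of_ne, ne_eq, reduceCtorEq, not_false_eq_true]
        refine halts_nil (halts_nil ⟨⟨h₁, hf₂ (fun v hv => h₂ v (Visit.mono_push hv)) (h₂ _ ?_),
          .inl ⟨h₃, h₄⟩⟩, ?_⟩)
        · simp
        · simp only [Exp.cost, Exp.costList]
          omega
    · simp [Exp.eval, Exp.evalList, hs, Mem.write_same, Mem.write_of_ne] at hvis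
      simp only [Mem.write_of_ne, ne_eq, reduceCtorEq, not_false_eq_true]
      refine halts_nil ⟨⟨f₁, hf₂ (fun _ => id) hvis, ?_⟩, by simp [Exp.cost, Exp.costList, Mem.write_of_ne]⟩
      -- In round 0 both stack and output are empty, so no variable is visited and this branch is
      -- impossible.
      rcases f₃ with h | ⟨rfl, h⟩
      · exact .inl h
      · have := (f₁.mem (m .fin [m .nVar [] - (0 + 1)])).2 ⟨hs', hvis⟩
        simp [h] at this
  · rintro m' t ⟨⟨f₁, f₂, f₃⟩, -, -, ht⟩
    have hall : ∀ v < m .nVar [], m' .vis' [v] ≠ 0 := by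
      intro v hv
      obtain ⟨p, hp, rfl⟩ := mem_arr.1 ((hfin v).2 hv)
      -- `fin` is read backwards, so `fin [p]` is treated in round `n - (p + 1)`.
      have := f₂ (m .nVar [] - (p + 1)) (by omega)
      rwa [show m .nVar [] - (m .nVar [] - (p + 1) + 1) = p by omega] at this
    have hk := f₁.eq_of_all hall
    rw [hk] at f₁ f₃
    refine ⟨?_, by simpa using f₁.nodup, fun v => ?_, (f₃.resolve_right (by omega)).2⟩
    · simp only [List.mem_cons, List.not_mem_nil, or_false, forall_eq_or_imp, forall_eq] at h₀
      simp [Mem.write_of_ne, h₀, Exp.cost, Exp.costList, restDeg_nil] at ht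
      omega
    · have := f₁.mem v
      simp only [arr_zero, List.nil_append] at this
      exact this.trans ⟨fun h => h.1, fun h => ⟨h, hall v h⟩⟩

end Program
end FunCSP

-- Composition and substitution of constraints

namespace FunCSP

namespace Mem

/-- `(x, y)` is in `(c_{jk} ∘ c_{ij}) ∩ c_{ik}`. -/
def Composed (m : Mem) (i j k x y : ℕ) : Prop :=
  (∃ b < m .size [j], m .rel [i, j, x, b] ≠ 0 ∧ m .rel [j, k, b, y] ≠ 0) ∧
    (m .inC [i, k] = 0 ∨ m .rel [i, k, x, y] ≠ 0)

open Classical in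
/-- The tables after the composition has been entered for the pairs of values in `A`. -/
noncomputable def relAfter (m : Mem) (i j k : ℕ) (A : ℕ → ℕ → Prop) (u v x y : ℕ) : ℕ :=
  if u = i ∧ v = k ∧ A x y then (if m.Composed i j k x y then 1 else 0)
  else if u = k ∧ v = i ∧ A y x then (if m.Composed i j k y x then 1 else 0)
  else m .rel [u, v, x, y]

theorem relAfter_of_ne {m : Mem} {i j k : ℕ} {A : ℕ → ℕ → Prop} {u v x y : ℕ}
    (h₁ : ¬ (u = i ∧ v = k)) (h₂ : ¬ (u = k ∧ v = i)) :
    m.relAfter i j k A u v x y = m .rel [u, v, x, y] := by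
  rw [relAfter, if_neg (fun h => h₁ ⟨h.1, h.2.1⟩), if_neg (fun h => h₂ ⟨h.1, h.2.1⟩)]

theorem relAfter_of_not {m : Mem} {i j k : ℕ} {A : ℕ → ℕ → Prop} {x y : ℕ} (hik : i ≠ k)
    (h : ¬ A x y) : m.relAfter i j k A i k x y = m .rel [i, k, x, y] := by
  rw [relAfter, if_neg (fun h' => h h'.2.2), if_neg (fun h' => hik h'.1)]

open Classical in
-- This matches the two writes of one inner round; the outer case is the later write, to the
-- transposed cell.
theorem relAfter_insert {m : Mem} {i j k : ℕ} {A A' : ℕ → ℕ → Prop} {x y : ℕ} (hik : i ≠ k)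
    (h : ∀ x' y', A' x' y' ↔ A x' y' ∨ x' = x ∧ y' = y) (u v x' y' : ℕ) :
    m.relAfter i j k A' u v x' y' =
      if [u, v, x', y'] = [k, i, y, x] then (if m.Composed i j k x y then 1 else 0)
      else if [u, v, x', y'] = [i, k, x, y] then (if m.Composed i j k x y then 1 else 0)
      else m.relAfter i j k A u v x' y' := by
  simp only [relAfter, h, List.cons.injEq, and_true]
  by_cases h₁ : u = i ∧ v = k
  · obtain ⟨rfl, rfl⟩ := h₁
    have : ¬ (u = v ∧ v = u ∧ x' = y ∧ y' = x) := fun h => hik h.1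
    by_cases h₂ : x' = x ∧ y' = y
    · obtain ⟨rfl, rfl⟩ := h₂
      simp [this]
    · simp [h₂, hik]
  · by_cases h₂ : u = k ∧ v = i
    · obtain ⟨rfl, rfl⟩ := h₂
      by_cases h₃ : x' = y ∧ y' = x
      · obtain ⟨rfl, rfl⟩ := h₃
        simp [hik.symm]
      · have h₄ : ¬ (y' = x ∧ x' = y) := fun h => h₃ h.symm
        simp [hik.symm, h₃, h₄]
    · have h₃ : ∀ X, ¬ (u = i ∧ v = k ∧ X) := fun X h => h₁ ⟨h.1, h.2.1⟩
      have h₄ : ∀ X, ¬ (u = k ∧ v = i ∧ X) := fun X h => h₂ ⟨h.1, h.2.1⟩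
      simp only [h₃, h₄, if_false]

end Mem

namespace Program

/-- `sup` holds the last support found. When the constraint is functional this is the only one. -/
theorem halts_findSupport {m : Mem} {x i j : ℕ} (hi : m .i [] = i) (hj : m .j [] = j)
    (hx : m .a [] = x) (halive : ∀ b < m .size [j], m .alive [j, b] ≠ 0)
    (h0 : m .found [] = 0) :
    Halts (forBelow .b (.get .size [.get .j []])
      (when (.and (.get .alive [.get .j [], .get .b []])
          (.get .rel [.get .i [], .get .j [], .get .a [], .get .b []])) (block [
        assign .found 1,
        assign .sup (.get .b [])]))) m fun m' t => t ≤ 50 * (m .size [j] + 1) ∧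
      (m' .found [] = 0 ∧ (∀ b < m .size [j], m .rel [i, j, x, b] = 0) ∨
        m' .found [] = 1 ∧ m' .sup [] < m .size [j] ∧ m .rel [i, j, x, m' .sup []] ≠ 0) := by
  subst hi hj hx
  refine (halts_for (m .size [m .j []]) 30
    (fun k m' => m' .found [] = 0 ∧ (∀ b < k, m .rel [m .i [], m .j [], m .a [], b] = 0) ∨
      m' .found [] = 1 ∧ m' .sup [] < k ∧ m .rel [m .i [], m .j [], m .a [], m' .sup []] ≠ 0)
    (by decide) (by simp [Mem.write_of_ne]) ?_ (by simp [h0]) ?_).mono ?_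
  · intro k m' _ hF
    simp only [Exp.eval, Exp.evalList, hF.eq .size, hF.eq .j]
  · rintro b m₁ hb h hmb hF
    have e₁ := hF.eq .rel
    have e₂ := hF.eq .alive
    have e₃ := hF.eq .i
    have e₄ := hF.eq .j
    have e₅ := hF.eq .a
    have hal := halive b hb
    refine halts_when (fun hw => ?_) fun hw => ?_
    · refine halts_cons (halts_assign (halts_cons (halts_assign (halts_nil ?_))))
      simp [Mem.write_of_ne, Mem.write_self, Exp.eval, Exp.evalList, Exp.cost, Exp.costList,
        e₁, e₂, e₃, e₄, e₅, hmb] at hw ⊢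
      exact hw.2
    · simp [Exp.eval, Exp.evalList, Exp.cost, Exp.costList,
        e₁, e₂, e₃, e₄, e₅, hmb, hal] at hw ⊢
      rcases h with ⟨h₁, h₂⟩ | ⟨h₁, h₂, h₃⟩
      · refine .inl ⟨h₁, fun b' hb' => ?_⟩
        rcases Nat.lt_or_eq_of_le hb' with hb' | rfl
        · exact h₂ b' hb'
        · exact hw
      · exact .inr ⟨h₁, by omega, h₃⟩
  · rintro m' t ⟨h, -, ht⟩
    simp only [Exp.cost, Exp.costList] at ht
    exact ⟨by omega, h⟩

open Classical in
-- The table is updated in place. This is harmless: $c_{jk}$ is a table other than the one being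
-- written, since `i`, `j`, `k` are distinct, and the entry of $c_{ik}$ is read before it is
-- overwritten, by `hA`. Hypothesis `hC` says that testing the one recorded support decides the
-- composition.
theorem halts_compose_row {m₀ m : Mem} {x i j k : ℕ} {A : ℕ → ℕ → Prop}
    (hi : m .i [] = i) (hj : m .j [] = j) (hk : m .k [] = k) (hx : m .a [] = x)
    (hij : i ≠ j) (hjk : j ≠ k) (hik : i ≠ k)
    (hinC : m .inC = m₀ .inC)
    (hrel : ∀ u v x y, m .rel [u, v, x, y] = m₀.relAfter i j k A u v x y)
    (hA : ∀ y, ¬ A x y)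
    (hC : ∀ y, m₀.Composed i j k x y ↔ m .found [] ≠ 0 ∧ m₀ .rel [j, k, m .sup [], y] ≠ 0 ∧
      (m₀ .inC [i, k] = 0 ∨ m₀ .rel [i, k, x, y] ≠ 0)) :
    Halts (forBelow .c (.get .size [.get .k []]) (block [
      assign .new (.and (.and (.get .found []) (.get .rel [.get .j [], .get .k [], .get .sup [], .get .c []]))
        (.or (.not (.get .inC [.get .i [], .get .k []]))
          (.get .rel [.get .i [], .get .k [], .get .a [], .get .c []]))),
      .put .rel [.get .i [], .get .k [], .get .a [], .get .c []] (.get .new []),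
      .put .rel [.get .k [], .get .i [], .get .c [], .get .a []] (.get .new [])])) m
    fun m' t => t ≤ 80 * (m .size [k] + 1) ∧
      ∀ u v x' y', m' .rel [u, v, x', y'] =
        m₀.relAfter i j k (fun x' y' => A x' y' ∨ x' = x ∧ y' < m .size [k]) u v x' y' := by
  subst hi hj hk hx
  refine (halts_for (m .size [m .k []]) 60
    (fun l m' => ∀ u v x' y', m' .rel [u, v, x', y'] =
        m₀.relAfter (m .i []) (m .j []) (m .k [])
          (fun x' y' => A x' y' ∨ x' = m .a [] ∧ y' < l) u v x' y')
    (by decide) (by simp [Mem.write_of_ne]) ?_ (by simpa using hrel) ?_).mono ?_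
  · intro k m' _ hF
    simp only [Exp.eval, Exp.evalList, hF.eq .size, hF.eq .k]
  · rintro y m₁ hy h hmy hF
    have e₁ := hF.eq .found
    have e₂ := hF.eq .inC
    have e₃ := hF.eq .i
    have e₄ := hF.eq .j
    have e₅ := hF.eq .a
    have e₆ := hF.eq .sup
    have e₇ := hF.eq .k
    refine halts_cons (halts_assign (halts_cons (Halts.put (halts_cons (Halts.put (halts_nil ?_))))))
    simp [Mem.write_of_ne, Mem.write_self, Exp.eval, Exp.evalList, Exp.cost, Exp.costList,
      e₁, e₂, e₃, e₄, e₅, e₆, e₇, hmy]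
    have r₁ : m₁ .rel [m .j [], m .k [], m .sup [], y] = m₀ .rel [m .j [], m .k [], m .sup [], y] := by
      rw [h, Mem.relAfter_of_ne (fun h => hij h.1.symm) (fun h => hjk h.1)]
    have r₂ : m₁ .rel [m .i [], m .k [], m .a [], y] = m₀ .rel [m .i [], m .k [], m .a [], y] := by
      rw [h, Mem.relAfter_of_not hik (by simp [hA])]
    have hcond : ((¬m .found [] = 0 ∧ ¬m₁ .rel [m .j [], m .k [], m .sup [], y] = 0) ∧
        (¬m .inC [m .i [], m .k []] = 0 → ¬m₁ .rel [m .i [], m .k [], m .a [], y] = 0)) ↔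
        m₀.Composed (m .i []) (m .j []) (m .k []) (m .a []) y := by
      rw [hC, r₁, r₂, hinC]
      tauto
    intro u v x' y'
    rw [Mem.relAfter_insert (A := fun x' y' => A x' y' ∨ x' = m .a [] ∧ y' < y) hik
      (x := m .a []) (y := y) (by intro x' y'; rw [Nat.le_iff_lt_or_eq]; tauto)]
    simp only [Function.update_apply, hcond]
    rw [h]
  · rintro m' t ⟨h, -, ht⟩
    simp only [Exp.cost, Exp.costList] at ht
    exact ⟨by omega, h⟩

theorem halts_compose {m : Mem} {D i j k : ℕ} (hi : m .i [] = i) (hj : m .j [] = j)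
    (hk : m .k [] = k) (hij : i ≠ j) (hjk : j ≠ k) (hik : i ≠ k) (hD : ∀ v, m .size [v] ≤ D)
    (halive : ∀ b < m .size [j], m .alive [j, b] ≠ 0) (hfun : m.Fun i j) :
    Halts compose m fun m' t => t ≤ 200 * (D + 1) ^ 2 ∧
      ∀ u v x y, m' .rel [u, v, x, y] =
        m.relAfter i j k (fun x y => x < m .size [i] ∧ y < m .size [k]) u v x y := by
  refine (halts_for (m .size [i]) (130 * (D + 1) + 20)
    (fun l m' => ∀ u v x y, m' .rel [u, v, x, y] =
        m.relAfter i j k (fun x y => x < l ∧ y < m .size [k]) u v x y)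
    (by decide) (by simp [Mem.write_of_ne]) ?_ (by simp [Mem.relAfter]) ?_).mono ?_
  · intro k m' _ hF
    simp only [Exp.eval, Exp.evalList, hF.eq .size, hF.eq .i, hi]
  · rintro x m₁ hx h hmx hF
    have e₁ := hF.eq .size
    have e₂ := hF.eq .inC
    have e₃ := hF.eq .i
    have e₄ := hF.eq .j
    have e₅ := hF.eq .k
    have e₆ := hF.eq .alive
    refine halts_cons (halts_assign (halts_cons ((halts_findSupport (x := x) (i := i) (j := j)
      ?_ ?_ ?_ ?_ ?_).framed ?_)))
    · simp [Mem.write_of_ne, e₃, hi]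
    · simp [Mem.write_of_ne, e₄, hj]
    · simp [Mem.write_of_ne, hmx]
    · simpa [Mem.write_of_ne, e₁, e₆] using halive
    · simp [Mem.write_same]
    · rintro m₂ t₂ ⟨ht₂, hsup⟩ hF₂
      simp only [Mem.write_of_ne, ne_eq, reduceCtorEq, not_false_eq_true, e₁] at ht₂ hsup
      have hr : ∀ b, m₁ .rel [i, j, x, b] = m .rel [i, j, x, b] := fun b => by
        rw [h, Mem.relAfter_of_ne (fun h => hjk h.2) (fun h => hik h.1)]
      simp only [hr] at hsup
      have hs₂ : m₂ .size = m .size := by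
        rw [hF₂.eq .size, Mem.write_of_ne (by decide), e₁]
      refine halts_cons ((halts_compose_row (m₀ := m) (x := x) (i := i) (j := j) (k := k)
        (A := fun x' y' => x' < x ∧ y' < m .size [k]) ?_ ?_ ?_ ?_ hij hjk hik ?_ ?_ ?_ ?_).mono ?_)
      · rw [hF₂.eq .i, Mem.write_of_ne (by decide), e₃, hi]
      · rw [hF₂.eq .j, Mem.write_of_ne (by decide), e₄, hj]
      · rw [hF₂.eq .k, Mem.write_of_ne (by decide), e₅, hk]
      · rw [hF₂.eq .a, Mem.write_of_ne (by decide), hmx]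
      · rw [hF₂.eq .inC, Mem.write_of_ne (by decide), e₂]
      · rw [hF₂.eq .rel, Mem.write_of_ne (by decide)]; exact h
      · simp
      · intro y
        rcases hsup with ⟨h₁, h₂⟩ | ⟨h₁, h₂, h₃⟩
        · simp only [Mem.Composed, h₁]
          constructor
          · rintro ⟨⟨b, hb, hb', -⟩, -⟩
            exact absurd (h₂ b hb) hb'
          · exact fun h => absurd rfl h.1
        · simp only [Mem.Composed, h₁]
          constructor
          · rintro ⟨⟨b, hb, hb', hb''⟩, h'⟩
            -- Functionality identifies an arbitrary support with the recorded one.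
            obtain rfl := hfun x hx b hb _ h₂ hb' h₃
            exact ⟨one_ne_zero, hb'', h'⟩
          · exact fun h' => ⟨⟨_, h₂, h₃, h'.2.1⟩, h'.2.2⟩
      · rintro m₃ t₃ ⟨ht₃, h₃⟩
        refine halts_nil ⟨?_, ?_⟩
        · intro u v x' y'
          rw [h₃, hs₂]
          congr 1
          funext x' y'
          rw [Nat.lt_succ_iff_lt_or_eq]
          simp only [eq_iff_iff]
          tauto
        · have := hD j
          have := hD k
          rw [hs₂] at ht₃
          simp only [Exp.cost]
          omega
  · rintro m' t ⟨h, -, ht⟩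
    have := hD i
    simp only [Exp.cost, Exp.costList] at ht
    refine ⟨?_, h⟩
    have := Nat.mul_le_mul this (le_refl (130 * (D + 1) + 20 + (1 + (1 + 0 + 0)) + 12))
    nlinarith

/-- The result of `substitute`. -/
structure _root_.FunCSP.Mem.Substituted (m m' : Mem) (i j k : ℕ) : Prop where
  rel : ∀ u v x y, m' .rel [u, v, x, y] =
    m.relAfter i j k (fun x y => x < m .size [i] ∧ y < m .size [k]) u v x y
  inC : ∀ u v, m' .inC [u, v] =
    if [u, v] = [j, k] ∨ [u, v] = [k, j] then 0 else
    if [u, v] = [i, k] ∨ [u, v] = [k, i] then 1 else m .inC [u, v]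
  nbrOK : m'.NbrOK
  deg : ∀ v, m' .deg [v] =
    if m .inC [i, k] = 0 ∧ (v = i ∨ v = k) then m .deg [v] + 1 else m .deg [v]
  nbr : ∀ p, m' .nbr [j, p] = m .nbr [j, p]

/-- The constraint $c_{jk}$ is deleted only from `inC`; the arrays of neighbours keep stale entries.
This is why `NbrOK` is a one-sided condition, and why `deg` is a bound to be controlled rather than
the true degree. -/
theorem halts_substitute {m : Mem} {D i j k : ℕ} (hi : m .i [] = i) (hj : m .j [] = j)
    (hk : m .k [] = k) (hij : i ≠ j) (hjk : j ≠ k) (hik : i ≠ k) (hD : ∀ v, m .size [v] ≤ D)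
    (halive : ∀ b < m .size [j], m .alive [j, b] ≠ 0) (hfun : m.Fun i j)
    (hinC : ∀ u v, m .inC [u, v] ≤ 1) (hsymm : ∀ u v, m .inC [u, v] = m .inC [v, u])
    (hnbr : m.NbrOK) :
    Halts substitute m fun m' t => t ≤ 400 * (D + 1) ^ 2 ∧ m.Substituted m' i j k := by
  have hremove : ∀ {m' : Mem}, m'.NbrOK →
      ((m'.write .inC [j, k] 0).write .inC [k, j] 0).NbrOK := by
    intro m' h u v huv
    simp only [Mem.write_of_ne, ne_eq, reduceCtorEq, not_false_eq_true]
    refine h u v fun h0 => huv ?_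
    simp [Mem.write_same, h0]
  have hD1 : 1 ≤ (D + 1) ^ 2 := Nat.one_le_pow _ _ (by omega)
  refine halts_cons ((halts_compose hi hj hk hij hjk hik hD halive hfun).framed ?_)
  rintro m₁ t₁ ⟨ht₁, h₁⟩ hF₁
  have e₁ := hF₁.eq .inC
  have e₂ := hF₁.eq .nbr
  have e₃ := hF₁.eq .deg
  have hi₁ : m₁ .i [] = i := by rw [hF₁.eq .i, hi]
  have hj₁ : m₁ .j [] = j := by rw [hF₁.eq .j, hj]
  have hk₁ : m₁ .k [] = k := by rw [hF₁.eq .k, hk]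
  refine halts_cons (halts_when (fun hw => ?_) fun hw => ?_)
  · simp only [Exp.eval, Exp.evalList, hi₁, hk₁, e₁] at hw
    replace hw : m .inC [i, k] = 0 := by by_contra h; simp [h] at hw
    refine (halts_addCon (by decide) (by decide) m₁ (by rwa [hi₁, hk₁])).framed ?_
    rintro m₂ t₂ ⟨ht₂, g₁, g₂, g₃⟩ hF₂
    rw [hi₁, hk₁] at g₁ g₂ g₃
    have hj₂ : m₂ .j [] = j := by rw [hF₂.eq .j, hj₁]
    have hk₂ : m₂ .k [] = k := by rw [hF₂.eq .k, hk₁]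
    have hok : m₂.NbrOK := nbrOK_addCon (m := m₁)
      (by simpa only [Mem.NbrOK, e₁, e₂, e₃] using hnbr) hik g₁ g₂ g₃
    rw [e₁] at g₁
    rw [e₃] at g₂
    rw [e₂, e₃] at g₃
    refine halts_cons (Halts.put (halts_cons (Halts.put (halts_nil ⟨?_, ?_⟩))))
    · simp [Exp.cost, Exp.costList]
      omega
    simp only [Exp.eval, Exp.evalList, hj₂, hk₂, Mem.write_of_ne, ne_eq, reduceCtorEq,
      not_false_eq_true]
    constructor <;> try simp only [Mem.write_of_ne, ne_eq, reduceCtorEq, not_false_eq_true]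
    · rw [hF₂.eq .rel]; exact h₁
    · intro u v
      simp only [Mem.write_self, Function.update_apply, g₁]
      split_ifs <;> grind
    · exact hremove hok
    · intro v
      simp [g₂, hw]
    · intro p
      rw [g₃, if_neg (by simp [hij.symm]), if_neg (by simp [hjk])]
  · simp only [Exp.eval, Exp.evalList, hi₁, hk₁, e₁] at hw
    replace hw : m .inC [i, k] ≠ 0 := by intro h; simp [h] at hw
    have hw₁ : m .inC [i, k] = 1 := by have := hinC i k; omega
    have hw₂ : m .inC [k, i] = 1 := by rw [hsymm, hw₁]
    refine halts_cons (Halts.put (halts_cons (Halts.put (halts_nil ⟨?_, ?_⟩))))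
    · simp [Exp.cost, Exp.costList]
      omega
    simp only [Exp.eval, Exp.evalList, hj₁, hk₁, Mem.write_of_ne, ne_eq, reduceCtorEq,
      not_false_eq_true]
    constructor <;> try simp only [Mem.write_of_ne, ne_eq, reduceCtorEq, not_false_eq_true]
    · exact h₁
    · intro u v
      simp only [Mem.write_self, Function.update_apply, e₁]
      split_ifs <;> grind
    · exact hremove (by simpa only [Mem.NbrOK, e₁, e₂, e₃] using hnbr)
    · intro v
      simp [hw, e₃]
    · intro p
      rw [e₂]

end Program
end FunCSP

-- Revision of the domain of the center

namespace FunCSP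

/-- The value `x` of `i` has a support in the domain of `j`. -/
def Mem.Supp (m : Mem) (i j x : ℕ) : Prop := ∃ b < m .size [j], m .rel [i, j, x, b] ≠ 0

namespace Program

theorem halts_testSupport {m : Mem} {x i j : ℕ} (hi : m .i [] = i) (hj : m .j [] = j)
    (hx : m .a [] = x) (halive : ∀ b < m .size [j], m .alive [j, b] ≠ 0)
    (h0 : m .found [] = 0) :
    Halts (forBelow .b (.get .size [.get .j []])
      (when (.and (.get .alive [.get .j [], .get .b []])
          (.get .rel [.get .i [], .get .j [], .get .a [], .get .b []])) (assign .found 1))) m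
    fun m' t => t ≤ 50 * (m .size [j] + 1) ∧ (m' .found [] ≠ 0 ↔ m.Supp i j x) := by
  subst hi hj hx
  refine (halts_for (m .size [m .j []]) 30
    (fun k m' => m' .found [] ≠ 0 ↔ ∃ b < k, m .rel [m .i [], m .j [], m .a [], b] ≠ 0)
    (by decide) (by simp [Mem.write_of_ne]) ?_ (by simp [h0]) ?_).mono ?_
  · intro k m' _ hF
    simp only [Exp.eval, Exp.evalList, hF.eq .size, hF.eq .j]
  · rintro b m₁ hb h hmb hF
    have e₁ := hF.eq .rel
    have e₂ := hF.eq .alive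
    have e₃ := hF.eq .i
    have e₄ := hF.eq .j
    have e₅ := hF.eq .a
    have hal := halive b hb
    rw [Nat.exists_lt_succ_right]
    refine halts_when (fun hw => halts_assign ?_) fun hw => ?_ <;>
    simp [Mem.write_self, Exp.eval, Exp.evalList, Exp.cost, Exp.costList,
        e₁, e₂, e₃, e₄, e₅, hmb, hal] at hw ⊢
    · exact .inr hw
    · simpa [hw] using h
  · rintro m' t ⟨h, -, ht⟩
    simp only [Exp.cost, Exp.costList] at ht
    exact ⟨by omega, h⟩

open Classical in
-- Values are removed from the domain of `i` while supports are sought in that of `j ≠ i`, so the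
-- removals do not affect later tests. `cnt` counts the surviving values, and it is zero exactly
-- when the domain has become empty.
theorem halts_revise {m : Mem} {D i j : ℕ} (hi : m .i [] = i) (hj : m .j [] = j)
    (hij : i ≠ j) (hD : ∀ v, m .size [v] ≤ D)
    (halive : ∀ b < m .size [j], m .alive [j, b] ≠ 0) :
    Halts revise m fun m' t => t ≤ 200 * (D + 1) ^ 2 ∧
      (∀ v a, m' .alive [v, a] =
        if v = i ∧ a < m .size [i] ∧ ¬ m.Supp i j a then 0 else m .alive [v, a]) ∧
      m' .consistent [] =
        if ∃ a < m .size [i], m .alive [i, a] ≠ 0 ∧ m.Supp i j a then m .consistent [] else 0 := by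
  refine halts_cons (halts_assign (halts_cons ((halts_for (m .size [i]) (50 * (D + 1) + 60)
    (fun k m' => (∀ v a, m' .alive [v, a] =
        if v = i ∧ a < k ∧ ¬ m.Supp i j a then 0 else m .alive [v, a]) ∧
      (m' .cnt [] ≠ 0 ↔ ∃ a < k, m .alive [i, a] ≠ 0 ∧ m.Supp i j a))
    (by decide) (by simp [Mem.write_of_ne]) ?_ (by simp [Mem.write_of_ne, Mem.write_self]) ?_).framed ?_)))
  · intro k m' _ hF
    simp [Exp.eval, Exp.evalList, hF.eq .size, hF.eq .i, Mem.write_of_ne, hi]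
  · rintro x m₁ hx ⟨h₁, h₂⟩ hmx hF
    have e₁ : m₁ .rel = m .rel := by rw [hF.eq .rel, Mem.write_of_ne (by decide)]
    have e₂ : m₁ .size = m .size := by rw [hF.eq .size, Mem.write_of_ne (by decide)]
    have e₃ : m₁ .i [] = i := by rw [hF.eq .i, Mem.write_of_ne (by decide), hi]
    have e₄ : m₁ .j [] = j := by rw [hF.eq .j, Mem.write_of_ne (by decide), hj]
    have hal : m₁ .alive [i, x] = m .alive [i, x] := by simp [h₁]
    rw [Nat.exists_lt_succ_right]
    refine halts_when (fun hw => ?_) fun hw => ?_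
    · simp only [Exp.eval, Exp.evalList, e₃, hmx, hal] at hw
      refine halts_cons (halts_assign (halts_cons ((halts_testSupport (x := x) (i := i) (j := j)
        ?_ ?_ ?_ ?_ ?_).framed ?_)))
      · simp [Mem.write_of_ne, e₃]
      · simp [Mem.write_of_ne, e₄]
      · simp [Mem.write_of_ne, hmx]
      · simp only [Mem.write_of_ne, ne_eq, reduceCtorEq, not_false_eq_true, e₂, h₁, hij.symm,
          false_and, if_false]
        exact halive
      · simp [Mem.write_same]
      rintro m₂ t₂ ⟨ht₂, hs⟩ hF₂
      have hs' : (m₁.write .found [] (Exp.eval m₁ 0)).Supp i j x ↔ m.Supp i j x := by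
        simp only [Mem.Supp, Mem.write_of_ne, ne_eq, reduceCtorEq, not_false_eq_true, e₁, e₂]
      rw [hs'] at hs
      simp only [Mem.write_of_ne, ne_eq, reduceCtorEq, not_false_eq_true, e₂] at ht₂
      have := hD j
      have g₁ : m₂ .alive = m₁ .alive := by rw [hF₂.eq .alive, Mem.write_of_ne (by decide)]
      have g₂ : m₂ .cnt = m₁ .cnt := by rw [hF₂.eq .cnt, Mem.write_of_ne (by decide)]
      have g₃ : m₂ .i [] = i := by rw [hF₂.eq .i, Mem.write_of_ne (by decide), e₃]
      have g₄ : m₂ .a [] = x := by rw [hF₂.eq .a, Mem.write_of_ne (by decide), hmx]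
      refine halts_cons (Halts.ite (fun hf => halts_inc (halts_nil ⟨⟨?_, ?_⟩, ?_⟩))
        fun hf => Halts.put (halts_nil ⟨⟨?_, ?_⟩, ?_⟩))
      · have hsx := hs.1 hf
        intro v a
        simp only [Mem.write_of_ne, ne_eq, reduceCtorEq, not_false_eq_true, g₁, h₁]
        congr 1
        simp only [eq_iff_iff, Nat.lt_succ_iff_lt_or_eq]
        constructor
        · rintro ⟨h, h', h''⟩; exact ⟨h, .inl h', h''⟩
        · rintro ⟨h, h' | rfl, h''⟩
          · exact ⟨h, h', h''⟩
          · exact absurd hsx h''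
      · simp [Mem.write_same, hw, hs.1 hf]
      · simp [Exp.cost, Exp.costList]; omega
      · have hsx : ¬ m.Supp i j x := fun h => hs.2 h hf
        intro v a
        simp only [Mem.write_self, Exp.evalList, Exp.eval, Function.update_apply, g₁, g₃, g₄, h₁]
        by_cases hva : v = i ∧ a = x
        · obtain ⟨rfl, rfl⟩ := hva
          simp [hsx]
        · rw [if_neg (by simpa using hva)]
          congr 1
          simp only [eq_iff_iff, Nat.lt_succ_iff_lt_or_eq]
          constructor
          · rintro ⟨h, h', h''⟩; exact ⟨h, .inl h', h''⟩
          · rintro ⟨h, h' | rfl, h''⟩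
            · exact ⟨h, h', h''⟩
            · exact absurd ⟨h, rfl⟩ hva
      · have hsx : ¬ m.Supp i j x := fun h => hs.2 h hf
        simpa [Mem.write_of_ne, g₂, hsx] using h₂
      · simp [Exp.cost, Exp.costList]; omega
    · simp only [Exp.eval, Exp.evalList, e₃, hmx, hal] at hw
      refine ⟨⟨?_, by simpa [hw] using h₂⟩, by simp [Exp.cost, Exp.costList]⟩
      intro v a
      rw [h₁]
      -- A value already removed reads 0 in both cases of the formula.
      by_cases hva : v = i ∧ a = x
      · obtain ⟨rfl, rfl⟩ := hva
        simp [hw]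
      · congr 1
        simp only [eq_iff_iff, Nat.lt_succ_iff_lt_or_eq]
        constructor
        · rintro ⟨h, h', h''⟩; exact ⟨h, .inl h', h''⟩
        · rintro ⟨h, h' | rfl, h''⟩
          · exact ⟨h, h', h''⟩
          · exact absurd ⟨h, rfl⟩ hva
  · rintro m₁ t ⟨⟨h₁, h₂⟩, -, ht⟩ hF
    have e₁ : m₁ .consistent [] = m .consistent [] := by
      rw [hF.eq .consistent, Mem.write_of_ne (by decide)]
    have := hD i
    have := Nat.mul_le_mul this (le_refl (50 * (D + 1) + 60 + (1 + (1 + 0 + 0)) + 12))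
    simp only [Exp.cost, Exp.costList] at ht
    refine halts_cons (halts_when (fun hw => halts_assign (halts_nil ⟨?_, ?_, ?_⟩))
      fun hw => halts_nil ⟨?_, h₁, ?_⟩)
    · simp only [Exp.cost, Exp.costList]
      nlinarith
    · simpa [Mem.write_of_ne] using h₁
    · have hc : m₁ .cnt [] = 0 := by by_contra h; simp [Exp.eval, Exp.evalList, h] at hw
      rw [if_neg fun h => h₂.2 h hc]
      simp [Mem.write_same]
    · simp only [Exp.cost, Exp.costList]
      nlinarith
    · have hc : m₁ .cnt [] ≠ 0 := by intro h; simp [Exp.eval, Exp.evalList, h] at hw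
      rw [if_pos (h₂.1 hc), e₁]

end Program
end FunCSP

-- The invariant of the elimination

namespace FunCSP

/-- `s` is a solution of the problem in the memory, with values and variables as numbers. -/
def Mem.Sol (m : Mem) (s : ℕ → ℕ) : Prop :=
  (∀ v < m .nVar [], s v < m .size [v] ∧ m .alive [v, s v] ≠ 0) ∧
    ∀ u v, m .inC [u, v] ≠ 0 → m .rel [u, v, s u, s v] ≠ 0

/-- The invariant of the elimination with `c`, where `m₀` is the memory after the setup, the
variables in `L` will be eliminated, and those in `Z` need not be put into `L`. -/
structure Elim (m₀ m : Mem) (c : ℕ) (Z : ℕ → Prop) (L : List ℕ) : Prop where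
  nVar : m .nVar = m₀ .nVar
  size : m .size = m₀ .size
  fun0 : m .fun0 = m₀ .fun0
  center_lt : c < m₀ .nVar []
  center_elim : m .elim [c] = 0
  inC_le : ∀ u v, m .inC [u, v] ≤ 1
  inC_symm : ∀ u v, m .inC [u, v] = m .inC [v, u]
  inC_ne : ∀ u v, m .inC [u, v] ≠ 0 → u ≠ v
  inC_lt : ∀ u v, m .inC [u, v] ≠ 0 → u < m₀ .nVar []
  rel_le : ∀ u v a b, m .rel [u, v, a, b] ≤ 1
  rel_symm : ∀ u v a b, m .rel [u, v, a, b] = m .rel [v, u, b, a]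
  alive : ∀ v < m₀ .nVar [], v ≠ c → ∀ b < m₀ .size [v], m .alive [v, b] = 1
  alive_le : ∀ a < m₀ .size [c], m .alive [c, a] ≤ 1
  nbrOK : m.NbrOK
  deg_le : ∀ v, v ≠ c → m .deg [v] ≤ m₀ .deg [v] + if m .inC [c, v] = 0 then 0 else 1
  done : ∀ v < m₀ .nVar [], m .elim [v] ≠ 0 → m .inC [c, v] ≠ 0 ∧
    (∀ k, k ≠ c → m .inC [v, k] = 0) ∧ m.Fun c v ∧
    ∀ a < m₀ .size [c], m .alive [c, a] ≠ 0 → m.Supp c v a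
  todo : ∀ v ∈ L, v < m₀ .nVar [] ∧ v ≠ c ∧ m .elim [v] = 0 ∧ m .inC [c, v] ≠ 0 ∧ m.Fun c v
  cover : ∀ u v, m₀.Edge u v → Z v ∨ v ∈ L ∨ m .elim [v] ≠ 0 ∨
    u ≠ c ∧ m .elim [u] = 0 ∧ m .inC [u, v] ≠ 0
  edge_fun : ∀ u v, m₀.Edge u v → u ≠ c → v ≠ c → m.Fun u v
  sol_iff : ∀ s, m.Sol s ↔ m₀.Sol s
  of_consistent : m .consistent [] = 1 →
    (∀ v < m₀ .nVar [], 0 < m₀ .size [v]) ∧ ∃ a < m₀ .size [c], m .alive [c, a] ≠ 0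
  consistent : (∃ s, m.Sol s) → m .consistent [] = 1

namespace Elim

variable {m₀ m m' : Mem} {c j k : ℕ} {Z : ℕ → Prop} {L L' : List ℕ}

theorem congr (h : Elim m₀ m c Z L) (hm : ∀ y ∈ [Name.nVar, .size, .fun0, .inC, .rel, .alive, .nbr,
    .deg, .elim, .consistent], m' y = m y) : Elim m₀ m' c Z L := by
  simp only [List.mem_cons, List.not_mem_nil, or_false, forall_eq_or_imp, forall_eq] at hm
  obtain ⟨h₁, h₂, h₃, h₄, h₅, h₆, h₇, h₈, h₉, h₁₀⟩ := hm
  have hF : ∀ u v, m'.Fun u v ↔ m.Fun u v := Mem.Fun.congr h₂ h₅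
  have hS : ∀ u v a, m'.Supp u v a ↔ m.Supp u v a := by simp only [Mem.Supp, h₂, h₅, implies_true]
  have hSol : ∀ s, m'.Sol s ↔ m.Sol s := by simp only [Mem.Sol, h₁, h₂, h₄, h₅, h₆, implies_true]
  have hN : m'.NbrOK ↔ m.NbrOK := by simp only [Mem.NbrOK, h₄, h₇, h₈]
  constructor <;> try simp only [h₁, h₂, h₃, h₄, h₅, h₆, h₈, h₉, h₁₀, hF, hS, hSol, hN]
  exacts [h.nVar, h.size, h.fun0, h.center_lt, h.center_elim, h.inC_le, h.inC_symm, h.inC_ne,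
    h.inC_lt, h.rel_le, h.rel_symm, h.alive, h.alive_le, h.nbrOK, h.deg_le, h.done, h.todo, h.cover,
    h.edge_fun, h.sol_iff, h.of_consistent, h.consistent]

theorem of_ready {D : ℕ} (h : m.Ready D) (hc : c < m .nVar []) (hL : ∀ v, v ∈ L ↔ m.Edge c v) :
    Elim m m c (· = c) L := by
  have hsymm : ∀ u v, m.Con u v → m.Con v u := fun u v h => h.symm
  have hlt : ∀ u v, m.Con u v → u < m .nVar [] ∧ u ≠ v := by
    rintro u v ⟨p, hp, ⟨rfl, rfl⟩ | ⟨rfl, rfl⟩⟩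
    · exact ⟨h.conA_lt p hp, h.con_ne p hp⟩
    · exact ⟨h.conB_lt p hp, (h.con_ne p hp).symm⟩
  have hE : ∀ u v, m.Edge u v → m.Con u v ∧ m.Fun u v := fun u v => (h.fun0_iff u v).1
  constructor
  case nVar => rfl
  case size => rfl
  case fun0 => rfl
  case center_lt => exact hc
  case center_elim => exact h.elim c hc
  case inC_le => exact h.inC_le
  case inC_symm =>
    intro u v
    have h₁ := h.inC_le u v
    have h₂ := h.inC_le v u
    have h₃ := h.inC_iff u v
    have h₄ := h.inC_iff v u
    by_cases hC : m.Con u v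
    · have := h₃.2 hC; have := h₄.2 (hsymm _ _ hC); omega
    · have h₅ := h₃.not.2 hC
      have h₆ := h₄.not.2 fun h => hC (hsymm _ _ h)
      omega
  case inC_ne => exact fun u v huv => (hlt u v ((h.inC_iff u v).1 huv)).2
  case inC_lt => exact fun u v huv => (hlt u v ((h.inC_iff u v).1 huv)).1
  case rel_le => exact h.rel_le
  case rel_symm => exact h.rel_symm
  case alive => exact fun v hv _ => h.alive v hv
  case alive_le => exact fun a ha => (h.alive c hc a ha).le
  case nbrOK => exact h.nbrOK
  case deg_le => exact fun v _ => Nat.le_add_right _ _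
  case done => exact fun v hv hv' => absurd (h.elim v hv) hv'
  case todo =>
    intro v hv
    obtain ⟨h₁, h₂⟩ := hE _ _ ((hL v).1 hv)
    have h₃ := hlt _ _ h₁
    have h₄ := (hlt _ _ (hsymm _ _ h₁)).1
    exact ⟨h₄, h₃.2.symm, h.elim v h₄, (h.inC_iff _ _).2 h₁, h₂⟩
  case cover =>
    intro u v huv
    by_cases hu : u = c
    · subst hu; exact .inr (.inl ((hL v).2 huv))
    · have h₁ := (hE _ _ huv).1
      exact .inr (.inr (.inr ⟨hu, h.elim u (hlt _ _ h₁).1, (h.inC_iff _ _).2 h₁⟩))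
  case edge_fun => exact fun u v huv _ _ => (hE u v huv).2
  case sol_iff => exact fun s => Iff.rfl
  case of_consistent =>
    intro h'
    have h₁ := h.consistent.1 h'
    exact ⟨h₁, 0, h₁ c hc, by rw [h.alive c hc 0 (h₁ c hc)]; exact one_ne_zero⟩
  case consistent =>
    rintro ⟨s, hs⟩
    exact h.consistent.2 fun v hv => (Nat.zero_le _).trans_lt (hs.1 v hv).1

set_option maxHeartbeats 1000000 in
-- Only the tables of $c_{ck}$ and $c_{kc}$ change and only the pair $\{j,k\}$ loses its constraint,
-- so most of the invariant carries over by comparing pairs of variables. The substance lies in the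
-- solutions (`hSol`), in the functionality of the new $c_{ck}$ (`hFc`) and in `cover`.
theorem substitute (h : Elim m₀ m c Z L) (hj : j < m₀ .nVar []) (hcj : c ≠ j) (hkc : k ≠ c)
    (hjk : m .inC [j, k] ≠ 0) (hCj : m .inC [c, j] ≠ 0) (hFj : m.Fun c j)
    (hZ : Z j) (hL : ∀ v, v ∈ L' ↔ v ∈ L ∨ m₀.Edge j k ∧ v = k) (hs : m.Substituted m' c j k)
    (hm : ∀ y ∈ [Name.nVar, .size, .fun0, .alive, .elim, .consistent], m' y = m y) :
    Elim m₀ m' c Z L' ∧ m' .inC [c, j] ≠ 0 ∧ m'.Fun c j ∧ m' .inC [j, k] = 0 ∧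
      (∀ v, m .inC [j, v] = 0 → m' .inC [j, v] = 0) ∧ m' .deg [j] = m .deg [j] := by
  simp only [List.mem_cons, List.not_mem_nil, or_false, forall_eq_or_imp, forall_eq] at hm
  obtain ⟨hn, hsz, hf, hal, hel, hco⟩ := hm
  have hne : j ≠ k := h.inC_ne j k hjk
  have hk : k < m₀ .nVar [] := h.inC_lt k j (by rwa [h.inC_symm])
  -- An eliminated variable is constrained only with `c`, and `k` still has a constraint with `j`.
  have hk' : m .elim [k] = 0 := by
    by_contra hk'
    exact hjk (by rw [h.inC_symm]; exact (h.done k hk hk').2.1 j hcj.symm)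
  -- the new tables
  have hrel : ∀ u v x y, ¬ (u = c ∧ v = k) → ¬ (u = k ∧ v = c) →
      m' .rel [u, v, x, y] = m .rel [u, v, x, y] := fun u v x y h₁ h₂ => by
    rw [hs.rel, Mem.relAfter_of_ne h₁ h₂]
  have hnew : ∀ x < m .size [c], ∀ y < m .size [k],
      (m' .rel [c, k, x, y] ≠ 0 ↔ m.Composed c j k x y) := fun x hx y hy => by
    rw [hs.rel, Mem.relAfter, if_pos ⟨rfl, rfl, hx, hy⟩]
    simp
  have hrs : ∀ u v x y, m' .rel [u, v, x, y] = m' .rel [v, u, y, x] := by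
    intro u v x y
    rw [hs.rel, hs.rel]
    simp only [Mem.relAfter, h.rel_symm u v x y]
    grind
  have hFun : ∀ u v, ¬ (u = c ∧ v = k) → ¬ (u = k ∧ v = c) → (m'.Fun u v ↔ m.Fun u v) := by
    intro u v h₁ h₂
    simp only [Mem.Fun, hsz, hrel u v _ _ h₁ h₂]
  -- There are two sources of functionality: a constraint that is already functional stays so under
  -- intersection, and a composition of functional constraints is functional.
  have hFc : m .inC [c, k] ≠ 0 ∧ m.Fun c k ∨ m.Fun j k → m'.Fun c k := by
    intro hor x hx y hy y' hy' h₁ h₂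
    rw [hsz] at hx hy hy'
    rw [hnew x hx y hy] at h₁
    rw [hnew x hx y' hy'] at h₂
    rcases hor with ⟨hck, hor⟩ | hor
    · exact hor x hx y hy y' hy' (h₁.2.resolve_left hck) (h₂.2.resolve_left hck)
    · obtain ⟨⟨b, hb, h₃, h₄⟩, -⟩ := h₁
      obtain ⟨⟨b', hb', h₅, h₆⟩, -⟩ := h₂
      obtain rfl := hFj x hx b hb b' hb' h₃ h₅
      exact hor b hb y hy y' hy' h₄ h₆
  -- the new constraints
  have hinC : ∀ u v, ¬ (u = j ∧ v = k) → ¬ (u = k ∧ v = j) → ¬ (u = c ∧ v = k) →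
      ¬ (u = k ∧ v = c) → m' .inC [u, v] = m .inC [u, v] := by
    intro u v h₁ h₂ h₃ h₄
    rw [hs.inC, if_neg (by simp; tauto), if_neg (by simp; tauto)]
  have hCk : m' .inC [c, k] = 1 := by
    rw [hs.inC, if_neg (by simp [hcj, hkc.symm]), if_pos (.inl rfl)]
  have hC0 : m' .inC [j, k] = 0 := by rw [hs.inC, if_pos (.inl rfl)]
  have hCpos : ∀ v, m .inC [c, v] ≠ 0 → m' .inC [c, v] ≠ 0 := by
    intro v hv
    by_cases hvk : v = k
    · subst hvk; omega
    · rwa [hinC c v (by simp [hcj]) (by simp [hkc.symm]) (by simp [hvk]) (by simp [hkc.symm])]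
  have hCzero : ∀ u v, v ≠ c → u ≠ c → m .inC [u, v] = 0 → m' .inC [u, v] = 0 := by
    intro u v hv hu h0
    rw [hs.inC]
    split_ifs with h₁ h₂
    · rfl
    · simp [hv, hu] at h₂
    · exact h0
  have hCs : ∀ u v, m' .inC [u, v] = m' .inC [v, u] := by
    intro u v
    rw [hs.inC, hs.inC, h.inC_symm u v]
    simp only [List.cons.injEq, and_true]
    grind
  have hSupp : ∀ v a, v ≠ k → (m'.Supp c v a ↔ m.Supp c v a) := by
    intro v a hv
    have : ∀ b, m' .rel [c, v, a, b] = m .rel [c, v, a, b] := fun b =>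
      hrel _ _ _ _ (by simp [hv]) (by simp [hkc.symm])
    simp only [Mem.Supp, hsz, this]
  have hSol : ∀ s, m'.Sol s ↔ m.Sol s := by
    intro s
    simp only [Mem.Sol, hn, hsz, hal]
    refine and_congr_right fun hdom => ?_
    have hsc := (hdom c (h.nVar ▸ h.center_lt)).1
    have hsj := (hdom j (h.nVar ▸ hj)).1
    have hsk := (hdom k (h.nVar ▸ hk)).1
    constructor
    · intro hall u v huv
      have h₁ := (hnew _ hsc _ hsk).1 (hall c k (by omega))
      by_cases hck : u = c ∧ v = k
      · obtain ⟨rfl, rfl⟩ := hck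
        exact h₁.2.resolve_left huv
      by_cases hkc' : u = k ∧ v = c
      · obtain ⟨rfl, rfl⟩ := hkc'
        rw [h.rel_symm]
        exact h₁.2.resolve_left (by rwa [h.inC_symm])
      have hcj' := hall c j (hCpos j hCj)
      rw [hrel _ _ _ _ (by simp [hne]) (by simp [hkc.symm])] at hcj'
      -- The composition supplies some `b` in the domain of `j`; functionality of $c_{cj}$ forces `b
      -- = s j`.
      have hjk' : m .rel [j, k, s j, s k] ≠ 0 := by
        obtain ⟨⟨b, hb, h₂, h₃⟩, -⟩ := h₁
        rwa [hFj _ hsc _ hsj b hb hcj' h₂]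
      by_cases hjk₁ : u = j ∧ v = k
      · obtain ⟨rfl, rfl⟩ := hjk₁
        exact hjk'
      by_cases hjk₂ : u = k ∧ v = j
      · obtain ⟨rfl, rfl⟩ := hjk₂
        rwa [h.rel_symm]
      have := hall u v (by rwa [hinC u v hjk₁ hjk₂ hck hkc'])
      rwa [hrel _ _ _ _ hck hkc'] at this
    · intro hall u v huv
      have h₁ : m' .rel [c, k, s c, s k] ≠ 0 := by
        rw [hnew _ hsc _ hsk]
        refine ⟨⟨s j, hsj, hall c j hCj, hall j k hjk⟩, ?_⟩
        by_cases hck : m .inC [c, k] = 0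
        · exact .inl hck
        · exact .inr (hall c k hck)
      by_cases hck : u = c ∧ v = k
      · obtain ⟨rfl, rfl⟩ := hck
        exact h₁
      by_cases hkc' : u = k ∧ v = c
      · obtain ⟨rfl, rfl⟩ := hkc'
        rwa [hrs]
      by_cases hjk₁ : u = j ∧ v = k
      · obtain ⟨rfl, rfl⟩ := hjk₁
        exact absurd hC0 huv
      by_cases hjk₂ : u = k ∧ v = j
      · obtain ⟨rfl, rfl⟩ := hjk₂
        exact absurd hC0 (by rwa [hCs])
      rw [hrel _ _ _ _ hck hkc']
      exact hall u v (by rwa [← hinC u v hjk₁ hjk₂ hck hkc'])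
  have hFcj : m'.Fun c j := (hFun c j (by simp [hne]) (by simp [hkc.symm])).2 hFj
  refine ⟨?_, hCpos j hCj, hFcj, hC0, ?_, ?_⟩
  · constructor
    case nVar => rw [hn, h.nVar]
    case size => rw [hsz, h.size]
    case fun0 => rw [hf, h.fun0]
    case center_lt => exact h.center_lt
    case center_elim => rw [hel]; exact h.center_elim
    case inC_le =>
      intro u v
      have := h.inC_le u v
      rw [hs.inC]; split_ifs <;> omega
    case inC_symm => exact hCs
    case inC_ne =>
      rintro u _ huv rfl
      rw [hs.inC, if_neg (by simp; grind), if_neg (by simp; grind)] at huv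
      exact h.inC_ne u u huv rfl
    case inC_lt =>
      intro u v huv
      rw [hs.inC] at huv
      split_ifs at huv with h₁ h₂
      · exact absurd rfl huv
      · simp only [List.cons.injEq, and_true] at h₂
        rcases h₂ with ⟨rfl, -⟩ | ⟨rfl, -⟩
        exacts [h.center_lt, hk]
      · exact h.inC_lt u v huv
    case rel_le =>
      intro u v a b
      have := h.rel_le u v a b
      rw [hs.rel, Mem.relAfter]; split_ifs <;> omega
    case rel_symm => exact hrs
    case alive => rw [hal]; exact h.alive
    case alive_le => rw [hal]; exact h.alive_le
    case nbrOK => exact hs.nbrOK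
    case deg_le =>
      intro v hv
      have h₁ := h.deg_le v hv
      rw [hs.deg]
      -- `k` gains an entry only if $c_{ck}$ was absent. From now on it is present, since no
      -- constraint on `c` is ever deleted, so the extra 1 is used at most once.
      by_cases hvk : v = k
      · subst hvk
        rw [hCk]
        by_cases h₂ : m .inC [c, v] = 0
        · rw [if_pos h₂] at h₁
          simp only [h₂, or_true, and_self, if_true, one_ne_zero, if_false]
          omega
        · rw [if_neg h₂] at h₁
          simp only [h₂, false_and, if_false, one_ne_zero]
          exact h₁
      · rw [if_neg (by tauto)]
        refine h₁.trans (Nat.add_le_add_left ?_ _)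
        by_cases h₂ : m .inC [c, v] = 0
        · rw [if_pos h₂]; exact Nat.zero_le _
        · rw [if_neg h₂, if_neg (hCpos v h₂)]
    case done =>
      rw [hel, hal]
      intro v hv hv'
      -- The rewritten constraint does not concern an eliminated variable, so its functionality and
      -- its supports persist.
      have hvk : v ≠ k := by rintro rfl; exact hv' hk'
      have hvc : v ≠ c := by rintro rfl; exact hv' h.center_elim
      obtain ⟨h₁, h₂, h₃, h₄⟩ := h.done v hv hv'
      refine ⟨hCpos v h₁, fun w hw => hCzero v w hw hvc (h₂ w hw), ?_, fun a ha ha' => ?_⟩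
      · exact (hFun c v (by simp [hvk]) (by simp [hkc.symm])).2 h₃
      · exact (hSupp v a hvk).2 (h₄ a ha ha')
    case todo =>
      rw [hel]
      intro v hv
      by_cases hvk : v = k
      · subst hvk
        refine ⟨hk, hkc, hk', by omega, hFc ?_⟩
        rcases (hL v).1 hv with hv | ⟨hv, -⟩
        · exact .inl (h.todo v hv).2.2.2
        · exact .inr (h.edge_fun _ _ hv hcj.symm hkc)
      · obtain ⟨h₁, h₂, h₃, h₄, h₅⟩ := h.todo v (((hL v).1 hv).resolve_right fun h => hvk h.2)
        exact ⟨h₁, h₂, h₃, hCpos v h₄, (hFun c v (by simp [hvk]) (by simp [hkc.symm])).2 h₅⟩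
    case cover =>
      rw [hel]
      intro u v huv
      rcases h.cover u v huv with h₁ | h₁ | h₁ | ⟨h₁, h₂, h₃⟩
      · exact .inl h₁
      · exact .inr (.inl ((hL v).2 (.inl h₁)))
      · exact .inr (.inr (.inl h₁))
      · by_cases hjk₁ : u = j ∧ v = k
        · obtain ⟨rfl, rfl⟩ := hjk₁
          exact .inr (.inl ((hL v).2 (.inr ⟨huv, rfl⟩)))
        by_cases hjk₂ : u = k ∧ v = j
        · obtain ⟨rfl, rfl⟩ := hjk₂
          exact .inl hZ
        refine .inr (.inr (.inr ⟨h₁, h₂, ?_⟩))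
        by_cases hkc' : u = k ∧ v = c
        · obtain ⟨rfl, rfl⟩ := hkc'
          rw [hCs, hCk]; exact one_ne_zero
        rwa [hinC u v hjk₁ hjk₂ (fun h => h₁ h.1) hkc']
    case edge_fun =>
      intro u v huv hu hv
      exact (hFun u v (fun h => hu h.1) (fun h => hv h.2)).2 (h.edge_fun u v huv hu hv)
    case sol_iff => exact fun s => (hSol s).trans (h.sol_iff s)
    case of_consistent => rw [hco, hal]; exact h.of_consistent
    case consistent => simp only [hSol, hco]; exact h.consistent
  · intro v hv
    by_cases hvc : v = c
    · subst hvc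
      exact absurd hv (by rwa [h.inC_symm])
    · exact hCzero j v hvc hcj.symm hv
  · rw [hs.deg, if_neg]
    rintro ⟨-, h | h⟩
    exacts [hcj h.symm, hne h]

open Classical in
-- Once all constraints of `j` except the one with `c` have been moved and the domain of `c` has
-- been revised, `j` may be marked as eliminated and no longer needs an excuse.
theorem finish (h : Elim m₀ m c (fun v => v = c ∨ v = j) L) (hj : j < m₀ .nVar []) (hcj : c ≠ j)
    (hCj : m .inC [c, j] ≠ 0) (hFj : m.Fun c j) (hjL : j ∉ L)
    (h0 : ∀ v, v ≠ c → m .inC [j, v] = 0)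
    (hal : ∀ v a, m' .alive [v, a] =
      if v = c ∧ a < m .size [c] ∧ ¬ m.Supp c j a then 0 else m .alive [v, a])
    (hco : m' .consistent [] =
      if ∃ a < m .size [c], m .alive [c, a] ≠ 0 ∧ m.Supp c j a then m .consistent [] else 0)
    (hel : ∀ v, m' .elim [v] = if v = j then 1 else m .elim [v])
    (hm : ∀ y ∈ [Name.nVar, .size, .fun0, .inC, .rel, .nbr, .deg], m' y = m y) :
    Elim m₀ m' c (· = c) L := by
  simp only [List.mem_cons, List.not_mem_nil, or_false, forall_eq_or_imp, forall_eq] at hm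
  obtain ⟨hn, hsz, hf, hin, hr, hnb, hd⟩ := hm
  have hF : ∀ u v, m'.Fun u v ↔ m.Fun u v := Mem.Fun.congr hsz hr
  have hS : ∀ u v a, m'.Supp u v a ↔ m.Supp u v a := by simp only [Mem.Supp, hsz, hr, implies_true]
  have hN : m'.NbrOK ↔ m.NbrOK := by simp only [Mem.NbrOK, hin, hnb, hd]
  have hsz' := h.size
  have hac : ∀ a < m₀ .size [c], m' .alive [c, a] ≠ 0 ↔ m .alive [c, a] ≠ 0 ∧ m.Supp c j a := by
    intro a ha
    rw [hal]
    split_ifs with h'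
    · simp [h'.2.2]
    · have : m.Supp c j a := by
        by_contra h''
        exact h' ⟨rfl, hsz' ▸ ha, h''⟩
      simp [this]
  have hav : ∀ v, v ≠ c → ∀ a, m' .alive [v, a] = m .alive [v, a] := fun v hv a => by
    rw [hal, if_neg fun h => hv h.1]
  have hSol : ∀ s, m'.Sol s ↔ m.Sol s := by
    intro s
    simp only [Mem.Sol, hn, hsz, hin, hr]
    constructor
    · rintro ⟨h₁, h₂⟩
      refine ⟨fun v hv => ⟨(h₁ v hv).1, fun h' => (h₁ v hv).2 ?_⟩, h₂⟩
      rw [hal, h', ite_self]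
    · rintro ⟨h₁, h₂⟩
      refine ⟨fun v hv => ⟨(h₁ v hv).1, ?_⟩, h₂⟩
      rw [hal, if_neg]
      · exact (h₁ v hv).2
      · rintro ⟨rfl, -, h'⟩
        exact h' ⟨s j, (h₁ j (h.nVar ▸ hj)).1, h₂ v j hCj⟩
  constructor <;> try simp only [hn, hsz, hf, hin, hr, hd, hF, hS, hN]
  case nVar => exact h.nVar
  case size => exact h.size
  case fun0 => exact h.fun0
  case center_lt => exact h.center_lt
  case center_elim => rw [hel, if_neg hcj]; exact h.center_elim
  case inC_le => exact h.inC_le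
  case inC_symm => exact h.inC_symm
  case inC_ne => exact h.inC_ne
  case inC_lt => exact h.inC_lt
  case rel_le => exact h.rel_le
  case rel_symm => exact h.rel_symm
  case alive =>
    intro v hv hvc b hb
    rw [hav v hvc]; exact h.alive v hv hvc b hb
  case alive_le =>
    intro a ha
    have := h.alive_le a ha
    rw [hal]; split_ifs <;> omega
  case nbrOK => exact h.nbrOK
  case deg_le => exact h.deg_le
  case done =>
    intro v hv hv'
    by_cases hvj : v = j
    · subst hvj
      exact ⟨hCj, h0, hFj, fun a ha ha' => ((hac a ha).1 ha').2⟩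
    · rw [hel, if_neg hvj] at hv'
      obtain ⟨h₁, h₂, h₃, h₄⟩ := h.done v hv hv'
      exact ⟨h₁, h₂, h₃, fun a ha ha' => h₄ a ha ((hac a ha).1 ha').1⟩
  case todo =>
    intro v hv
    rw [hel, if_neg (by rintro rfl; exact hjL hv)]
    exact h.todo v hv
  case cover =>
    intro u v huv
    simp only [hel]
    by_cases hvj : v = j
    · exact .inr (.inr (.inl (by simp [hvj])))
    · rw [if_neg hvj]
      rcases h.cover u v huv with (h₁ | h₁) | h₁ | h₁ | ⟨h₁, h₂, h₃⟩
      · exact .inl h₁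
      · exact absurd h₁ hvj
      · exact .inr (.inl h₁)
      · exact .inr (.inr (.inl h₁))
      · by_cases huj : u = j
        · subst huj
          by_cases hvc : v = c
          · exact .inl hvc
          · exact absurd (h0 v hvc) h₃
        · rw [if_neg huj]
          exact .inr (.inr (.inr ⟨h₁, h₂, h₃⟩))
  case edge_fun => exact h.edge_fun
  case sol_iff => exact fun s => (hSol s).trans (h.sol_iff s)
  case of_consistent =>
    intro h'
    rw [hco] at h'
    split_ifs at h' with h''
    · obtain ⟨a, ha, h₁⟩ := h''
      rw [hsz'] at ha
      exact ⟨(h.of_consistent h').1, a, ha, (hac a ha).2 h₁⟩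
  case consistent =>
    rintro ⟨s, hs⟩
    have hs' := (hSol s).1 hs
    have hcn := h.nVar ▸ h.center_lt
    rw [hco, if_pos ⟨s c, (hs'.1 c hcn).1, (hs'.1 c hcn).2, s j, (hs'.1 j (h.nVar ▸ hj)).1,
      hs'.2 c j hCj⟩]
    exact h.consistent ⟨s, hs'⟩

/-- Between leaving the list and being marked as eliminated, `j` is covered by the excuse `Z`. -/
theorem pop (h : Elim m₀ m c Z (L ++ [j])) : Elim m₀ m c (fun v => Z v ∨ v = j) L :=
  { h with
    todo := fun v hv => h.todo v (List.mem_append_left _ hv)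
    cover := fun u v huv => by
      rcases h.cover u v huv with h₁ | h₁ | h₁
      · exact .inl (.inl h₁)
      · rcases List.mem_append.1 h₁ with h₁ | h₁
        · exact .inr (.inl h₁)
        · exact .inl (.inr (List.mem_singleton.1 h₁))
      · exact .inr (.inr h₁) }

/-- If `L` is empty, then everything reachable from the center has been eliminated. -/
theorem elim_of_reachable (h : Elim m₀ m c (· = c) []) {v : ℕ}
    (hv : Relation.ReflTransGen m₀.Edge c v) : v = c ∨ m .elim [v] ≠ 0 := by
  induction hv with
  | refl => exact .inl rfl
  | @tail u v _ huv ih =>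
    -- The last alternative contradicts the induction hypothesis: `u` is the center or has been
    -- eliminated.
    rcases h.cover u v huv with h₁ | h₁ | h₁ | ⟨h₁, h₂, -⟩
    · exact .inl h₁
    · simp at h₁
    · exact .inr h₁
    · exact absurd h₂ (ih.resolve_left h₁)

end Elim
end FunCSP

-- Eliminating all variables with one center

namespace FunCSP

/-- The list of the variables to be eliminated, and the table of its members. -/
structure Mem.ListOK (m : Mem) : Prop where
  nodup : (arr (m .lst) (m .nL [])).Nodup
  mem : ∀ v, m .inL [v] ≠ 0 ↔ v ∈ arr (m .lst) (m .nL [])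

theorem Mem.ListOK.congr {m m' : Mem} (h : m.ListOK) (h₁ : m' .lst = m .lst) (h₂ : m' .nL = m .nL)
    (h₃ : m' .inL = m .inL) : m'.ListOK := by
  constructor <;> simp only [h₁, h₂, h₃]
  exacts [h.nodup, h.mem]

namespace Program

theorem halts_insertL {x : Name} (hx : x ∉ [Name.inL, .lst, .nL]) {m : Mem} (hm : m.ListOK) :
    Halts (insertL x) m fun m' t => t ≤ 40 ∧ m'.ListOK ∧
      ∀ v, v ∈ arr (m' .lst) (m' .nL []) ↔ v ∈ arr (m .lst) (m .nL []) ∨ v = m x [] := by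
  simp only [List.mem_cons, List.not_mem_nil, or_false, not_or] at hx
  refine halts_when (fun hw => ?_) fun hw => ?_
  · refine halts_cons (Halts.put (halts_cons (Halts.put (halts_cons (halts_inc (halts_nil ?_))))))
    simp [Mem.write_of_ne, Mem.write_self, Exp.eval, Exp.evalList, Exp.cost, Exp.costList, hx] at hw ⊢
    have hmem := (hm.mem (m x [])).not.1 (by by_contra h; simp [h] at hw)
    constructor
    · constructor
      · simp only [Mem.write_of_ne, Mem.write_self, ne_eq, reduceCtorEq, not_false_eq_true,
          Function.update_self, arr_update_succ]
        exact List.nodup_append.2 ⟨hm.nodup, by simp, by simpa using fun a ha => by rintro rfl; exact hmem ha⟩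
      · intro v
        simp only [Mem.write_of_ne, Mem.write_self, ne_eq, reduceCtorEq, not_false_eq_true,
          Function.update_self, arr_update_succ, List.mem_append, List.mem_singleton, ← hm.mem]
        by_cases hv : v = m x []
        · simp [hv]
        · simp [hv, Function.update_of_ne]
    · intro v
      simp [arr_update_succ]
  · simp only [Exp.eval, Exp.evalList] at hw
    have hmem := (hm.mem (m x [])).1 (by intro h; simp [h] at hw)
    refine ⟨by simp [Exp.cost, Exp.costList], hm, fun v => ?_⟩
    constructor
    · exact .inl
    · rintro (h | rfl)
      exacts [h, hmem]

/-- While `j` is eliminated, its own array does not change, because new entries are made only for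
`c` and `k`; hence the bound of the loop is constant. The array may contain stale entries, which the
test of `inC` skips but which still cost time. This is covered by `deg_le`. -/
theorem halts_eliminate {m₀ m : Mem} {D c j : ℕ} (hi : m .i [] = c) (hj : m .j [] = j)
    (hD : ∀ v, m₀ .size [v] ≤ D) (hm : m.ListOK)
    (h : Elim m₀ m c (fun v => v = c ∨ v = j) (arr (m .lst) (m .nL [])))
    (hjn : j < m₀ .nVar []) (hcj : c ≠ j) (hC : m .inC [c, j] ≠ 0)
    (hF : m.Fun c j) (hjL : j ∉ arr (m .lst) (m .nL [])) :
    Halts eliminate m fun m' t => t ≤ 1000 * (m₀ .deg [j] + 2) * (D + 1) ^ 2 ∧ m'.ListOK ∧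
      Elim m₀ m' c (· = c) (arr (m' .lst) (m' .nL [])) ∧
      ∀ v, m' .elim [v] = if v = j then 1 else m .elim [v] := by
  have hD1 : 1 ≤ (D + 1) ^ 2 := Nat.one_le_pow _ _ (by omega)
  have hdeg : m .deg [j] ≤ m₀ .deg [j] + 1 := by
    have := h.deg_le j hcj.symm
    split_ifs at this <;> omega
  refine halts_cons ((halts_for (m .deg [j]) (400 * (D + 1) ^ 2 + 150)
    (fun p m' => m'.ListOK ∧
      Elim m₀ m' c (fun v => v = c ∨ v = j) (arr (m' .lst) (m' .nL [])) ∧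
      m' .inC [c, j] ≠ 0 ∧ m'.Fun c j ∧ j ∉ arr (m' .lst) (m' .nL []) ∧
      m' .deg [j] = m .deg [j] ∧ (∀ q, m' .nbr [j, q] = m .nbr [j, q]) ∧
      ∀ q < p, m .nbr [j, q] ≠ c → m' .inC [j, m .nbr [j, q]] = 0)
    (by decide) ?_ ?_ ⟨hm, h, hC, hF, hjL, rfl, fun _ => rfl, by simp⟩ ?_).framed ?_)
  · rintro k m' w ⟨h₁, h₂, h₃, h₄, h₅, h₆, h₇, h₈⟩
    refine ⟨h₁.congr (by simp [Mem.write_of_ne]) (by simp [Mem.write_of_ne])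
      (by simp [Mem.write_of_ne]), ?_, ?_, ?_, ?_, ?_, ?_, ?_⟩
    · simpa [Mem.write_of_ne] using h₂.congr (m' := m'.write .p [] w) (by simp [Mem.write_of_ne])
    all_goals simpa [Mem.write_of_ne, Mem.Fun]
  · rintro p m' ⟨-, -, -, -, -, h₆, -, -⟩ hFr
    simp only [Exp.eval, Exp.evalList, hFr.eq .j, hj, h₆]
  · rintro p m₁ hp ⟨h₁, h₂, h₃, h₄, h₅, h₆, h₇, h₈⟩ hmp hFr
    have e₁ : m₁ .i [] = c := by rw [hFr.eq .i, hi]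
    have e₂ : m₁ .j [] = j := by rw [hFr.eq .j, hj]
    refine halts_cons (halts_assign ?_)
    simp only [Exp.eval, Exp.evalList, Exp.cost, Exp.costList, e₂, hmp, h₇]
    generalize hk : m .nbr [j, p] = k at *
    have E₂ : Elim m₀ (m₁.write .k [] k) c (fun v => v = c ∨ v = j) (arr (m₁ .lst) (m₁ .nL [])) :=
      h₂.congr (by simp [Mem.write_of_ne])
    have h₉ : (m₁.write .k [] k).ListOK :=
      h₁.congr (by simp [Mem.write_of_ne]) (by simp [Mem.write_of_ne]) (by simp [Mem.write_of_ne])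
    have hk₂ : (m₁.write .k [] k) .k [] = k := by simp [Mem.write_same]
    have hFr₂ : ∀ y, y ≠ .k → (m₁.write .k [] k) y = m₁ y := fun y hy => Mem.write_of_ne hy _ _ _
    generalize m₁.write .k [] k = m₂ at *
    have hF₂ : m₂.Fun c j := (Mem.Fun.congr (hFr₂ .size (by decide)) (hFr₂ .rel (by decide)) _ _).2 h₄
    have h₈' : ∀ {m' : Mem}, (∀ v, m₁ .inC [j, v] = 0 → m' .inC [j, v] = 0) →
        (k ≠ c → m' .inC [j, k] = 0) → ∀ q < p + 1, m .nbr [j, q] ≠ c →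
          m' .inC [j, m .nbr [j, q]] = 0 := by
      intro m' g₁ g₂ q hq hq'
      rcases Nat.lt_succ_iff_lt_or_eq.1 hq with hq | rfl
      · exact g₁ _ (h₈ q hq hq')
      · rw [hk] at hq' ⊢; exact g₂ hq'
    have hi₂ : m₂ .i [] = c := by rw [hFr₂ .i (by decide), e₁]
    have hj₂ : m₂ .j [] = j := by rw [hFr₂ .j (by decide), e₂]
    refine halts_cons (halts_when (fun hw => ?_) fun hw => halts_nil ⟨⟨h₉, ?_, ?_, hF₂, ?_, ?_, ?_, ?_⟩, ?_⟩)
    · simp only [Exp.eval, Exp.evalList, hi₂, hj₂, hk₂] at hw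
      have hjk : m₂ .inC [j, k] ≠ 0 := by intro h; simp [h] at hw
      have hkc : k ≠ c := by rintro rfl; simp at hw
      have hjk' := E₂.inC_ne j k hjk
      refine halts_cons ((halts_substitute hi₂ hj₂ hk₂ hcj hjk' hkc.symm (by rwa [E₂.size])
        (by rw [E₂.size]; intro b hb; rw [E₂.alive j hjn hcj.symm b hb]; exact one_ne_zero)
        hF₂ E₂.inC_le E₂.inC_symm E₂.nbrOK).framed ?_)
      rintro m₃ t₃ ⟨ht₃, hsub⟩ hFr₃
      have hcommon : ∀ y ∈ [Name.nVar, .size, .fun0, .alive, .elim, .consistent], m₃ y = m₂ y := by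
        intro y hy
        simp only [List.mem_cons, List.not_mem_nil, or_false] at hy
        rcases hy with rfl | rfl | rfl | rfl | rfl | rfl <;> exact hFr₃.eq _
      have hC₂ : m₂ .inC [c, j] ≠ 0 := by rwa [hFr₂ .inC (by decide)]
      have h₉' : m₃.ListOK := h₉.congr (hFr₃.eq .lst) (hFr₃.eq .nL) (hFr₃.eq .inL)
      have hlst : arr (m₃ .lst) (m₃ .nL []) = arr (m₁ .lst) (m₁ .nL []) := by
        rw [hFr₃.eq .lst, hFr₃.eq .nL, hFr₂ .lst (by decide), hFr₂ .nL (by decide)]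
      have hk₃ : m₃ .k [] = k := by rw [hFr₃.eq .k, hk₂]
      have hj₃ : m₃ .j [] = j := by rw [hFr₃.eq .j, hj₂]
      have hf₃ : m₃ .fun0 = m₀ .fun0 := by rw [hFr₃.eq .fun0, E₂.fun0]
      refine halts_cons (halts_when (fun hw' => ?_) fun hw' => halts_nil (halts_nil ?_))
      · simp only [Exp.eval, Exp.evalList, hj₃, hk₃, hf₃] at hw'
        refine (halts_insertL (by decide) h₉').framed ?_
        rintro m₄ t₄ ⟨ht₄, h₉'', hmem⟩ hFr₄
        rw [hlst, hk₃] at hmem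
        obtain ⟨g₁, g₂, g₃, g₄, g₅, g₆⟩ := E₂.substitute hjn hcj hkc hjk hC₂ hF₂ (.inr rfl)
          (L' := arr (m₄ .lst) (m₄ .nL [])) (fun v => by
            rw [hmem]; exact or_congr_right ⟨fun h => ⟨hw', h⟩, fun h => h.2⟩) hsub hcommon
        refine halts_nil (halts_nil ⟨⟨h₉'', ?_, ?_, ?_, ?_, ?_, ?_, ?_⟩, ?_⟩)
        · refine g₁.congr ?_
          intro y hy
          simp only [List.mem_cons, List.not_mem_nil, or_false] at hy
          rcases hy with rfl | rfl | rfl | rfl | rfl | rfl | rfl | rfl | rfl | rfl <;> exact hFr₄.eq _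
        · rwa [hFr₄.eq .inC]
        · exact (Mem.Fun.congr (hFr₄.eq .size) (hFr₄.eq .rel) _ _).2 g₃
        · rw [hmem, not_or]
          exact ⟨h₅, hjk'⟩
        · rw [hFr₄.eq .deg, g₆, hFr₂ .deg (by decide), h₆]
        · intro q
          rw [hFr₄.eq .nbr, hsub.nbr, hFr₂ .nbr (by decide), h₇]
        · refine h₈' (fun v hv => ?_) fun _ => ?_
          · rw [hFr₄.eq .inC]; exact g₅ v (by rwa [hFr₂ .inC (by decide)])
          · rw [hFr₄.eq .inC]; exact g₄
        · simp only [Exp.cost, Exp.costList]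
          omega
      · simp only [Exp.eval, Exp.evalList, hj₃, hk₃, hf₃] at hw'
        obtain ⟨g₁, g₂, g₃, g₄, g₅, g₆⟩ := E₂.substitute hjn hcj hkc hjk hC₂ hF₂ (.inr rfl)
          (L' := arr (m₃ .lst) (m₃ .nL [])) (fun v => by
            rw [hlst]; exact ⟨.inl, fun h => h.resolve_right fun h => h.1 hw'⟩) hsub hcommon
        refine ⟨⟨h₉', g₁, g₂, g₃, by rwa [hlst], ?_, ?_, ?_⟩, ?_⟩
        · rw [g₆, hFr₂ .deg (by decide), h₆]
        · intro q
          rw [hsub.nbr, hFr₂ .nbr (by decide), h₇]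
        · exact h₈' (fun v hv => g₅ v (by rwa [hFr₂ .inC (by decide)])) fun _ => g₄
        · simp only [Exp.cost, Exp.costList]
          omega
    · rw [hFr₂ .lst (by decide), hFr₂ .nL (by decide)]; exact E₂
    · rwa [hFr₂ .inC (by decide)]
    · rwa [hFr₂ .lst (by decide), hFr₂ .nL (by decide)]
    · rw [hFr₂ .deg (by decide), h₆]
    · intro q; rw [hFr₂ .nbr (by decide), h₇]
    · rw [← hFr₂ .inC (by decide)] at h₈' 
      refine h₈' (fun v => id) fun hkc => ?_
      simp only [Exp.eval, Exp.evalList, hi₂, hj₂, hk₂] at hw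
      by_contra hne
      simp [hkc, hne] at hw
    · simp only [Exp.cost, Exp.costList]
      omega
  · rintro m₁ t₁ ⟨⟨h₁, h₂, h₃, h₄, h₅, h₆, h₇, h₈⟩, -, ht₁⟩ hFr₁
    have hi₁ : m₁ .i [] = c := by rw [hFr₁.eq .i, hi]
    have hj₁ : m₁ .j [] = j := by rw [hFr₁.eq .j, hj]
    refine halts_cons ((halts_revise hi₁ hj₁ hcj (by rwa [h₂.size])
      (by rw [h₂.size]; intro b hb; rw [h₂.alive j hjn hcj.symm b hb]; exact one_ne_zero)).framed ?_)
    rintro m₂ t₂ ⟨ht₂, g₁, g₂⟩ hFr₂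
    have hj₂ : m₂ .j [] = j := by rw [hFr₂.eq .j, hj₁]
    refine halts_cons (Halts.put (halts_nil ?_))
    simp only [Exp.eval, Exp.evalList, Exp.cost, Exp.costList, hj₂]
    have hlst : ∀ y ∈ [Name.lst, .nL, .inL], (m₂.write .elim [j] 1) y = m₁ y := by
      intro y hy
      simp only [List.mem_cons, List.not_mem_nil, or_false] at hy
      rcases hy with rfl | rfl | rfl <;> rw [Mem.write_of_ne (by decide)] <;> exact hFr₂.eq _
    refine ⟨?_, h₁.congr (hlst _ (by decide)) (hlst _ (by decide)) (hlst _ (by decide)), ?_, ?_⟩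
    · simp only [Exp.cost, Exp.costList] at ht₁
      have := Nat.mul_le_mul hdeg (le_refl (400 * (D + 1) ^ 2 + 150 + (1 + (1 + (1 + 0))) + 12))
      nlinarith
    · rw [hlst .lst (by decide), hlst .nL (by decide)]
      refine h₂.finish hjn hcj h₃ h₄ h₅ ?_ ?_ ?_ ?_ ?_
      · intro v hv
        by_contra hne
        obtain ⟨q, hq, rfl⟩ := h₂.nbrOK j v hne
        rw [h₇] at hv hne
        exact hne (h₈ q (h₆ ▸ hq) hv)
      · intro v a
        rw [Mem.write_of_ne (by decide), g₁]
      · rw [Mem.write_of_ne (by decide), g₂]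
      · intro v
        rw [Mem.write_same, hFr₂.eq .elim]
        simp
      · intro y hy
        simp only [List.mem_cons, List.not_mem_nil, or_false] at hy
        rcases hy with rfl | rfl | rfl | rfl | rfl | rfl | rfl <;>
          rw [Mem.write_of_ne (by decide)] <;> exact hFr₂.eq _
    · intro v
      rw [Mem.write_same, hFr₂.eq .elim, hFr₁.eq .elim]
      simp

/-- The potential assigns `deg + 2` to each variable not yet eliminated; eliminating `j` releases
its share. -/
theorem sum_elim {n j : ℕ} {f g h : List ℕ → ℕ} (hj : j < n) (hg : g [j] = 0)
    (hh : ∀ v, h [v] = if v = j then 1 else g [v]) :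
    ∑ v ∈ Finset.range n, (if h [v] = 0 then f [v] + 2 else 0) + (f [j] + 2) =
      ∑ v ∈ Finset.range n, (if g [v] = 0 then f [v] + 2 else 0) := by
  have hj' := Finset.mem_range.2 hj
  rw [← Finset.add_sum_erase _ _ hj',
    ← Finset.add_sum_erase _ (fun v => if g [v] = 0 then f [v] + 2 else 0) hj',
    Finset.sum_congr rfl (g := fun v => if g [v] = 0 then f [v] + 2 else 0)]
  · simp [hh, hg]; omega
  · intro v hv
    simp [hh, (Finset.mem_erase.1 hv).1]

/-- A variable in the list has not been eliminated (`todo`), so each round spends the share of a new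
variable. The factor 1100 instead of 1000 absorbs the overhead of the round. -/
theorem halts_process_loop {m₀ m : Mem} {D c : ℕ} (hi : m .i [] = c)
    (hD : ∀ v, m₀ .size [v] ≤ D) (hm : m.ListOK)
    (h : Elim m₀ m c (· = c) (arr (m .lst) (m .nL []))) :
    Halts (.while (.lt 0 (.get .nL [])) (block [
      dec .nL,
      assign .j (.get .lst [.get .nL []]),
      .put .inL [.get .j []] 0,
      eliminate])) m fun m' t => Elim m₀ m' c (· = c) [] ∧
      t ≤ 1100 * (D + 1) ^ 2 * (∑ v ∈ Finset.range (m₀ .nVar []), m₀ .deg [v] + 2 * m₀ .nVar []) +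
        10 := by
  have hD1 : 1 ≤ (D + 1) ^ 2 := Nat.one_le_pow _ _ (by omega)
  refine (Halts.loop (fun m' => m'.ListOK ∧ Elim m₀ m' c (· = c) (arr (m' .lst) (m' .nL [])))
    (fun m' => 1100 * (D + 1) ^ 2 *
      ∑ v ∈ Finset.range (m₀ .nVar []), if m' .elim [v] = 0 then m₀ .deg [v] + 2 else 0)
    ⟨hm, h⟩ ?_).mono ?_
  · rintro m₁ ⟨h₁, h₂⟩ hFr hw
    obtain ⟨d, hd⟩ : ∃ d, m₁ .nL [] = d + 1 := by
      refine Nat.exists_eq_succ_of_ne_zero fun h' => hw ?_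
      simp [Exp.eval, Exp.evalList, h']
    have hi₁ : m₁ .i [] = c := by rw [hFr.eq .i, hi]
    obtain ⟨hnd, hmem⟩ := h₁
    rw [hd, arr_succ] at h₂ hmem hnd
    set j := m₁ .lst [d] with hj
    have hjL : j ∉ arr (m₁ .lst) d := fun h' => (List.nodup_append.1 hnd).2.2 j h' j (by simp) rfl
    obtain ⟨hjn, hjc, hje, hjC, hjF⟩ := h₂.todo j (by simp)
    refine halts_cons (halts_dec (halts_cons (halts_assign (halts_cons (Halts.put ?_)))))
    simp only [Exp.eval, Exp.evalList, Exp.cost, Exp.costList, hd, Mem.write_of_ne, Mem.write_same,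
      ne_eq, reduceCtorEq, not_false_eq_true, if_true, Nat.add_sub_cancel, ← hj]
    have hF₂ : ∀ y, y ≠ .nL → y ≠ .j → y ≠ .inL →
        ((m₁.write .nL [] d).write .j [] j).write .inL [j] 0 y = m₁ y := fun y a b c => by
      rw [Mem.write_of_ne c, Mem.write_of_ne b, Mem.write_of_ne a]
    have hnL : ((m₁.write .nL [] d).write .j [] j).write .inL [j] 0 .nL [] = d := by
      simp [Mem.write_of_ne, Mem.write_same]
    have hj₂ : ((m₁.write .nL [] d).write .j [] j).write .inL [j] 0 .j [] = j := by
      simp [Mem.write_of_ne, Mem.write_same]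
    have hinL : ∀ v, ((m₁.write .nL [] d).write .j [] j).write .inL [j] 0 .inL [v] =
        if v = j then 0 else m₁ .inL [v] := by
      intro v
      simp [Mem.write_of_ne, Mem.write_same]
    generalize ((m₁.write .nL [] d).write .j [] j).write .inL [j] 0 = m₂ at *
    have hlst := hF₂ .lst (by decide) (by decide) (by decide)
    refine halts_cons ((halts_eliminate (m₀ := m₀) (c := c) (j := j) ?_ hj₂ hD ?_ ?_ hjn hjc.symm
      ?_ ?_ ?_).mono ?_)
    · rw [hF₂ .i (by decide) (by decide) (by decide), hi₁]
    · constructor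
      · rw [hlst, hnL]; exact (List.nodup_append.1 hnd).1
      · intro v
        rw [hlst, hnL, hinL]
        by_cases hv : v = j
        · subst hv; simp [hjL]
        · rw [if_neg hv, hmem]; simp [hv]
    · rw [hlst, hnL]
      refine h₂.pop.congr ?_
      intro y hy
      simp only [List.mem_cons, List.not_mem_nil, or_false] at hy
      rcases hy with rfl | rfl | rfl | rfl | rfl | rfl | rfl | rfl | rfl | rfl <;>
        exact hF₂ _ (by decide) (by decide) (by decide)
    · rwa [hF₂ .inC (by decide) (by decide) (by decide)]
    · exact (Mem.Fun.congr (hF₂ .size (by decide) (by decide) (by decide))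
        (hF₂ .rel (by decide) (by decide) (by decide)) _ _).2 hjF
    · rwa [hlst, hnL]
    · rintro m₃ t ⟨ht, g₁, g₂, g₃⟩
      rw [hF₂ .elim (by decide) (by decide) (by decide)] at g₃
      refine halts_nil ⟨⟨g₁, g₂⟩, ?_⟩
      have hsum := sum_elim (f := m₀ .deg) hjn hje g₃
      rw [← hsum]
      nlinarith
  · rintro m' t ⟨⟨h₁, h₂⟩, hw, -, ht⟩
    have h0 : m' .nL [] = 0 := by
      by_contra h'
      have h'' : 0 < m' .nL [] := by omega
      simp [Exp.eval, Exp.evalList, h''] at hw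
    rw [h0] at h₂
    refine ⟨h₂, ?_⟩
    have hle : ∑ v ∈ Finset.range (m₀ .nVar []), (if m .elim [v] = 0 then m₀ .deg [v] + 2 else 0) ≤
        ∑ v ∈ Finset.range (m₀ .nVar []), m₀ .deg [v] + 2 * m₀ .nVar [] := by
      calc _ ≤ ∑ v ∈ Finset.range (m₀ .nVar []), (m₀ .deg [v] + 2) :=
            Finset.sum_le_sum fun v _ => by split_ifs <;> omega
        _ = _ := by simp [Finset.sum_add_distrib, mul_comm]
    have := Nat.mul_le_mul (le_refl (1100 * (D + 1) ^ 2)) hle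
    simp only [Exp.cost, Exp.costList] at ht
    omega

theorem halts_process {m₀ m : Mem} {D c : ℕ} (hi : m .i [] = c) (hc : c < m₀ .nVar [])
    (h₀ : m₀.Ready D) (hinL : ∀ l, m .inL l = 0)
    (hm : ∀ y ∈ [Name.nVar, .size, .fun0, .inC, .rel, .alive, .nbr, .deg, .elim, .consistent],
      m y = m₀ y) :
    Halts process m fun m' t => Elim m₀ m' c (· = c) [] ∧
      t ≤ 1200 * (D + 1) ^ 2 * (∑ v ∈ Finset.range (m₀ .nVar []), m₀ .deg [v] + 2 * m₀ .nVar [] + 1) := by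
  have hD1 : 1 ≤ (D + 1) ^ 2 := Nat.one_le_pow _ _ (by omega)
  have hdeg : m₀ .deg [c] ≤ ∑ v ∈ Finset.range (m₀ .nVar []), m₀ .deg [v] :=
    Finset.single_le_sum (f := fun v => m₀ .deg [v]) (fun _ _ => Nat.zero_le _)
      (Finset.mem_range.2 hc)
  refine halts_cons (halts_assign (halts_cons ((halts_for (m₀ .deg [c]) 80
    (fun p m' => m'.ListOK ∧ ∀ v, v ∈ arr (m' .lst) (m' .nL []) ↔
      ∃ q < p, m₀ .nbr [c, q] = v ∧ m₀ .inC [c, v] ≠ 0 ∧ m₀ .fun0 [c, v] ≠ 0)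
    (by decide) ?_ ?_ ?_ ?_).framed ?_)))
  · rintro k m' w ⟨h₁, h₂⟩
    exact ⟨h₁.congr (by simp [Mem.write_of_ne]) (by simp [Mem.write_of_ne])
      (by simp [Mem.write_of_ne]), by simpa [Mem.write_of_ne] using h₂⟩
  · intro k m' _ hFr
    simp only [Exp.eval, Exp.evalList, hFr.eq .deg, hFr.eq .i]
    simp [Mem.write_of_ne, hi, hm .deg]
  · refine ⟨⟨?_, ?_⟩, ?_⟩ <;> simp [Mem.write_of_ne, Mem.write_same, hinL, Exp.eval]
  · rintro p m₁ hp ⟨h₁, h₂⟩ hmp hFr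
    have e₁ : m₁ .i [] = c := by rw [hFr.eq .i, Mem.write_of_ne (by decide), hi]
    have e₂ : m₁ .nbr = m₀ .nbr := by
      rw [hFr.eq .nbr, Mem.write_of_ne (by decide), hm _ (by decide)]
    have e₃ : m₁ .inC = m₀ .inC := by
      rw [hFr.eq .inC, Mem.write_of_ne (by decide), hm _ (by decide)]
    have e₄ : m₁ .fun0 = m₀ .fun0 := by
      rw [hFr.eq .fun0, Mem.write_of_ne (by decide), hm _ (by decide)]
    refine halts_cons (halts_assign (halts_cons (halts_when (fun hw => ?_) fun hw => ?_)))
    · refine (halts_insertL (by decide) (h₁.congr (by simp [Mem.write_of_ne])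
        (by simp [Mem.write_of_ne]) (by simp [Mem.write_of_ne]))).mono ?_
      rintro m₂ t ⟨ht, g₁, g₂⟩
      simp [Mem.write_of_ne, Mem.write_same, Exp.eval, Exp.evalList, e₁, e₂, e₃, e₄, hmp] at hw g₂
      refine halts_nil ⟨⟨g₁, fun v => ?_⟩, ?_⟩
      · rw [g₂, h₂, Nat.exists_lt_succ_right]
        refine or_congr_right ⟨?_, fun h => h.1.symm⟩
        rintro rfl
        exact ⟨rfl, hw⟩
      · simp only [Exp.cost, Exp.costList]
        omega
    · simp [Mem.write_of_ne, Mem.write_same, Exp.eval, Exp.evalList, e₁, e₂, e₃, e₄, hmp] at hw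
      refine halts_nil ⟨⟨h₁.congr (by simp [Mem.write_of_ne]) (by simp [Mem.write_of_ne])
        (by simp [Mem.write_of_ne]), fun v => ?_⟩, by simp [Exp.cost, Exp.costList]⟩
      simp only [Mem.write_of_ne, ne_eq, reduceCtorEq, not_false_eq_true]
      rw [h₂, Nat.exists_lt_succ_right]
      refine ⟨.inl, fun h => h.resolve_right ?_⟩
      rintro ⟨rfl, h₃, h₄⟩
      exact h₄ (hw h₃)
  · rintro m₁ t₁ ⟨⟨h₁, h₂⟩, -, ht₁⟩ hFr
    have hE : Elim m₀ m₁ c (· = c) (arr (m₁ .lst) (m₁ .nL [])) := by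
      refine (Elim.of_ready h₀ hc (L := arr (m₁ .lst) (m₁ .nL [])) fun v => ?_).congr ?_
      · rw [h₂]
        constructor
        · rintro ⟨q, -, -, -, h⟩; exact h
        · intro h
          have hC := (h₀.inC_iff c v).2 ((h₀.fun0_iff c v).1 h).1
          obtain ⟨q, hq, hv⟩ := h₀.nbrOK c v hC
          exact ⟨q, hq, hv, hC, h⟩
      · intro y hy
        rw [← hm y hy]
        simp only [List.mem_cons, List.not_mem_nil, or_false] at hy
        rcases hy with rfl | rfl | rfl | rfl | rfl | rfl | rfl | rfl | rfl | rfl <;>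
          rw [hFr.eq _, Mem.write_of_ne (by decide)]
    refine halts_cons ((halts_process_loop (by rw [hFr.eq .i, Mem.write_of_ne (by decide), hi])
      h₀.size_le h₁ hE).mono ?_)
    rintro m₂ t₂ ⟨g₁, ht₂⟩
    refine halts_nil ⟨g₁, ?_⟩
    simp only [Exp.cost, Exp.costList] at ht₁ ⊢
    nlinarith

end Program
end FunCSP

-- The whole algorithm

namespace FunCSP
namespace Program

/-- The loop of `linearElimination`, started after an ordering has been found. -/
theorem halts_eliminateAll {m₀ m : Mem} {D c : ℕ} (hn : 0 < m₀ .nVar []) (h₀ : m₀.Ready D)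
    (hinL : ∀ l, m .inL l = 0)
    (hm : ∀ y ∈ [Name.nVar, .size, .fun0, .inC, .rel, .alive, .nbr, .deg, .elim, .consistent],
      m y = m₀ y)
    (hord : (arr (m .ord) (m₀ .nVar [])).Nodup)
    (hmem : ∀ v, v ∈ arr (m .ord) (m₀ .nVar []) ↔ v < m₀ .nVar []) (hc : m .ord [0] = c)
    (hreach : ∀ v < m₀ .nVar [], Relation.ReflTransGen m₀.Edge c v) :
    Halts (forBelow .q (.get .nVar []) (block [
      assign .i (.get .ord [.get .q []]),
      when (.not (.get .elim [.get .i []])) process])) m fun m' t =>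
      Elim m₀ m' c (· = c) [] ∧ (∀ v < m₀ .nVar [], v ≠ c → m' .elim [v] ≠ 0) ∧
      t ≤ 1300 * (D + 1) ^ 2 *
        (∑ v ∈ Finset.range (m₀ .nVar []), m₀ .deg [v] + 2 * m₀ .nVar [] + 1) := by
  have hD1 : 1 ≤ (D + 1) ^ 2 := Nat.one_le_pow _ _ (by omega)
  have hc' : c < m₀ .nVar [] := (hmem c).1 (mem_arr.2 ⟨0, hn, hc⟩)
  have hnV := hm .nVar (by decide)
  -- Before round 0 nothing has changed except the counter, and the potential holds the cost of one
  -- call of `process`. After it only `c` is left, and the potential is 0.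
  refine (halts_forBelow (m₀ .nVar []) 30
    (fun q m' => (q = 0 ∧ ∀ y, y ≠ .q → m' y = m y) ∨
      0 < q ∧ Elim m₀ m' c (· = c) [] ∧ ∀ v < m₀ .nVar [], v ≠ c → m' .elim [v] ≠ 0)
    (fun m' => if m' .q [] = 0 then 1200 * (D + 1) ^ 2 *
      (∑ v ∈ Finset.range (m₀ .nVar []), m₀ .deg [v] + 2 * m₀ .nVar [] + 1) else 0)
    (by decide) ?_ ?_ ?_).mono ?_
  · intro k m' _ hF
    simp only [Exp.eval, Exp.evalList, hF.eq .nVar, hnV]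
  · exact .inl ⟨rfl, fun y hy => Mem.write_of_ne hy _ _ _⟩
  · rintro q m₁ hq hI hmq hF
    have ho : m₁ .ord = m .ord := hF.eq .ord
    refine halts_cons (halts_assign ?_)
    simp only [Exp.eval, Exp.evalList, hmq, ho]
    rcases hI with ⟨rfl, hI⟩ | ⟨hq0, hE, hel⟩
    · have hag : ∀ y, y ≠ .q → y ≠ .i → (m₁.write .i [] (m .ord [0])) y = m y := fun y h₁ h₂ => by
        rw [Mem.write_of_ne h₂, hI y h₁]
      have helim : (m₁.write .i [] (m .ord [0])) .elim [m .ord [0]] = 0 := by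
        rw [hag _ (by decide) (by decide), hm _ (by decide), hc]
        exact h₀.elim c hc'
      have hi : (m₁.write .i [] (m .ord [0])) .i [] = m .ord [0] := by simp [Mem.write_same]
      refine halts_cons (halts_when (fun hw => ?_) fun hw => ?_)
      · refine (halts_process (m₀ := m₀) (D := D) (c := c) (by rw [hi, hc]) hc' h₀
          (by rw [hag _ (by decide) (by decide)]; exact hinL) ?_).framed ?_
        · intro y hy
          rw [← hm y hy]
          simp only [List.mem_cons, List.not_mem_nil, or_false] at hy
          rcases hy with rfl | rfl | rfl | rfl | rfl | rfl | rfl | rfl | rfl | rfl <;>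
            exact hag _ (by decide) (by decide)
        · rintro m₂ t ⟨hE, ht⟩ hF₂
          refine halts_nil ⟨.inr ⟨by omega, ?_, ?_⟩, ?_⟩
          · refine hE.congr ?_
            intro y hy
            simp only [List.mem_cons, List.not_mem_nil, or_false] at hy
            rcases hy with rfl | rfl | rfl | rfl | rfl | rfl | rfl | rfl | rfl | rfl <;>
              exact Mem.write_of_ne (by decide) _ _ _
          · intro v hv hvc
            rw [Mem.write_of_ne (by decide)]
            exact (hE.elim_of_reachable (hreach v hv)).resolve_left hvc
          · simp only [Mem.write_same, if_true, Exp.cost, Exp.costList, zero_add, one_ne_zero,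
              if_false]
            omega
      · simp [Exp.eval, Exp.evalList, hi, helim] at hw
    · have hoq : m .ord [q] ≠ c := by
        intro h
        rw [← hc] at h
        have := (List.nodup_map_iff_inj_on (List.nodup_range)).1 hord q (by simpa using hq) 0
          (by simpa using hn) h
        omega
      have hon := (hmem _).1 (mem_arr.2 ⟨q, hq, rfl⟩)
      have h₁ := hel _ hon hoq
      refine halts_cons (halts_when (fun hw => ?_) fun hw => halts_nil ⟨.inr ⟨by omega, ?_, ?_⟩, ?_⟩)
      · simp [Exp.eval, Exp.evalList, Mem.write_same, Mem.write_of_ne, h₁] at hw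
      · refine hE.congr ?_
        intro y hy
        simp only [List.mem_cons, List.not_mem_nil, or_false] at hy
        rcases hy with rfl | rfl | rfl | rfl | rfl | rfl | rfl | rfl | rfl | rfl <;>
          rw [Mem.write_of_ne (by decide), Mem.write_of_ne (by decide)]
      · simpa [Mem.write_of_ne] using hel
      · simp [Mem.write_same, Exp.cost, Exp.costList, hq0.ne']
  · rintro m' t ⟨hI, -, -, ht⟩
    rcases hI with ⟨h, -⟩ | ⟨-, hE, hel⟩
    · omega
    · refine ⟨hE, hel, ?_⟩
      simp only [Mem.write_same, if_true, Exp.cost, Exp.costList] at ht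
      replace ht := (Nat.le_add_right _ _).trans ht
      generalize ∑ v ∈ Finset.range (m₀ .nVar []), m₀ .deg [v] = X at *
      nlinarith [Nat.mul_le_mul hD1 (le_refl (X + 2 * m₀ .nVar [] + 1))]

theorem halts_linearElimination {m : Mem} {D r : ℕ} (hm : m.IsInput D) (hr : r < m .nVar [])
    (hreach : ∀ v < m .nVar [], Relation.ReflTransGen (fun u v => m.Con u v ∧ m.Fun u v) r v) :
    Halts linearElimination m fun m' t => ∃ m₀ c, m₀.Ready D ∧
      (∀ y ∈ [Name.nVar, .nCon, .conA, .conB, .size, .rel], m₀ y = m y) ∧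
      Elim m₀ m' c (· = c) [] ∧ (∀ v < m .nVar [], v ≠ c → m' .elim [v] ≠ 0) ∧
      t ≤ 10000 * (m .nVar [] + m .nCon [] + 1) * (D + 1) ^ 2 := by
  have hD1 : 1 ≤ (D + 1) ^ 2 := Nat.one_le_pow _ _ (by omega)
  refine halts_cons ((halts_setup hm).framed ?_)
  rintro m₁ t₁ ⟨ht₁, h₁⟩ hF₁
  have hn := hF₁.eq .nVar
  have hC := hF₁.eq .nCon
  have hag : ∀ y ∈ [Name.nVar, .nCon, .conA, .conB, .size, .rel], m₁ y = m y := by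
    intro y hy
    simp only [List.mem_cons, List.not_mem_nil, or_false] at hy
    rcases hy with rfl | rfl | rfl | rfl | rfl | rfl <;> exact hF₁.eq _
  have hEdge : ∀ u v, m₁.Edge u v ↔ m.Con u v ∧ m.Fun u v := by
    intro u v
    rw [Mem.Edge, h₁.fun0_iff, Mem.Fun.congr (hF₁.eq .size) (hF₁.eq .rel), Mem.Con, Mem.Con,
      Mem.ConBelow.congr (hF₁.eq .conA) (hF₁.eq .conB), hC]
  have hlt : ∀ u v, m₁.Con u v → u < m₁ .nVar [] := by
    rintro u v ⟨p, hp, ⟨rfl, rfl⟩ | ⟨rfl, rfl⟩⟩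
    exacts [h₁.conA_lt p hp, h₁.conB_lt p hp]
  have hE : ∀ u v, m₁.Edge u v → v < m₁ .nVar [] ∧ ∃ q < m₁ .deg [u], m₁ .nbr [u, q] = v := by
    intro u v huv
    have hc := ((h₁.fun0_iff u v).1 huv).1
    exact ⟨hlt v u hc.symm, h₁.nbrOK u v ((h₁.inC_iff u v).2 hc)⟩
  have hreach₁ : ∀ v < m₁ .nVar [], Relation.ReflTransGen m₁.Edge r v := by
    intro v hv
    exact Relation.ReflTransGen.mono (fun u v => (hEdge u v).2) _ _ (hreach v (hn ▸ hv))
  have hzero : ∀ y, y ∉ [Name.nVar, .nCon, .conA, .conB, .size, .rel] → y ∉ setup.writes →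
      ∀ l, m₁ y l = 0 := by
    intro y hy hy' l
    rw [hF₁ y hy', hm.zero y hy l]
  refine halts_cons (halts_cons ((halts_firstSearch hE ?_ (hn ▸ hr) hreach₁).framed ?_))
  · intro y hy
    simp only [List.mem_cons, List.not_mem_nil, or_false] at hy
    rcases hy with rfl | rfl | rfl <;> exact hzero _ (by decide) (by decide)
  rintro m₂ t₂ ⟨ht₂, g₁, g₂⟩ hF₂
  have hn₂ := hF₂.eq .nVar
  have hn0 : 0 < m₁ .nVar [] := by rw [hn]; omega
  refine halts_cons ((halts_secondSearch (m := m₂) (by rwa [hn₂]) ?_ (by rwa [hn₂]) ?_).framed ?_)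
  · rw [hF₂.eq .fun0, hn₂]
    exact fun u v huv => hlt u v ((h₁.fun0_iff u v).1 huv).1
  · intro y hy
    simp only [List.mem_cons, List.not_mem_nil, or_false] at hy
    rcases hy with rfl | rfl <;> rw [hF₂.eq _] <;> exact hzero _ (by decide) (by decide)
  rintro m₃ t₃ ⟨ht₃, k₁, k₂, k₃⟩ hF₃
  rw [hn₂] at k₁ k₂ k₃ ht₃
  rw [hF₂.eq .deg] at ht₃
  refine halts_nil (halts_cons ((halts_eliminateAll (m₀ := m₁) (D := D)
    (c := m₂ .fin [m₁ .nVar [] - 1]) hn0 h₁ ?_ ?_ k₁ k₂ k₃ g₂).mono ?_))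
  · rw [hF₃.eq .inL, hF₂.eq .inL]
    exact hzero _ (by decide) (by decide)
  · intro y hy
    simp only [List.mem_cons, List.not_mem_nil, or_false] at hy
    rcases hy with rfl | rfl | rfl | rfl | rfl | rfl | rfl | rfl | rfl | rfl <;>
      rw [hF₃.eq _, hF₂.eq _]
  · rintro m₄ t₄ ⟨hE₄, hel, ht₄⟩
    refine halts_nil ⟨m₁, _, h₁, hag, hE₄, hn ▸ hel, ?_⟩
    -- The handshake identity turns each bound into a multiple of `nVar + nCon + 1`.
    have hsum := h₁.sum_deg
    rw [hsum] at ht₂ ht₃ ht₄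
    rw [hn, hC] at ht₂ ht₃ ht₄
    nlinarith [Nat.zero_le (m .nVar [] * (D ^ 2 + 2 * D)), Nat.zero_le (m .nCon [] * (D ^ 2 + 2 * D))]

end Program
end FunCSP

-- The encoded input

namespace FunCSP
namespace Encoding

variable {V α : Type*} [Fintype V] {P : CSP V α}

theorem init_eq_zero (E : Encoding P) (y : Name)
    (hy : y ∉ [Name.nVar, .nCon, .conA, .conB, .size, .rel]) (l : List ℕ) : E.init y l = 0 := by
  cases y <;> first | rfl | simp at hy

theorem init_size (E : Encoding P) (v : V) : E.init .size [E.num v] = (P.dom v).card := by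
  simp [init]

theorem init_rel (E : Encoding P) {u v : V} (huv : P.graph.Adj u v) {x y : α} (hx : x ∈ P.dom u)
    (hy : y ∈ P.dom v) : E.init .rel [E.num u, E.num v, E.idx u x, E.idx v y] ≠ 0 ↔ P.rel u v x y := by
  simp only [init, ne_eq, ite_eq_right_iff, one_ne_zero, imp_false, not_not]
  constructor
  · rintro ⟨u', v', -, hu, hv, x', hx', y', hy', hxx, hyy, h⟩
    obtain rfl := E.num.injective (Fin.ext hu)
    obtain rfl := E.num.injective (Fin.ext hv)
    obtain rfl := (E.idx_bijOn _).injOn hx' hx hxx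
    obtain rfl := (E.idx_bijOn _).injOn hy' hy hyy
    exact h
  · exact fun h => ⟨u, v, huv, rfl, rfl, x, hx, y, hy, rfl, rfl, h⟩

theorem idx_lt (E : Encoding P) {v : V} {x : α} (hx : x ∈ P.dom v) : E.idx v x < (P.dom v).card :=
  (E.idx_bijOn v).mapsTo hx

theorem exists_idx (E : Encoding P) {v : V} {a : ℕ} (ha : a < (P.dom v).card) :
    ∃ x ∈ P.dom v, E.idx v x = a := (E.idx_bijOn v).surjOn ha

theorem exists_num (E : Encoding P) {w : ℕ} (hw : w < Fintype.card V) : ∃ v, (E.num v : ℕ) = w :=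
  ⟨E.num.symm ⟨w, hw⟩, by simp⟩

theorem init_con (E : Encoding P) (u v : V) :
    E.init.Con (E.num u) (E.num v) ↔ P.graph.Adj u v := by
  have hn : E.init .nCon [] = E.cons.length := rfl
  have hA : ∀ p (hp : p < E.cons.length), E.init .conA [p] = E.num (E.cons[p]).1 := fun p hp => by
    simp [init, hp]
  have hB : ∀ p (hp : p < E.cons.length), E.init .conB [p] = E.num (E.cons[p]).2 := fun p hp => by
    simp [init, hp]
  have h := E.mem_cons s(u, v)
  rw [SimpleGraph.mem_edgeSet] at h
  rw [← h, List.mem_map, Mem.Con, hn]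
  constructor
  · rintro ⟨p, hp, h⟩
    rw [hA p hp, hB p hp] at h
    refine ⟨E.cons[p], List.getElem_mem hp, ?_⟩
    simpa only [Sym2.eq_iff, Fin.val_inj, E.num.apply_eq_iff_eq] using h
  · rintro ⟨c, hc, h⟩
    obtain ⟨p, hp, rfl⟩ := List.getElem_of_mem hc
    refine ⟨p, hp, ?_⟩
    rw [hA p hp, hB p hp]
    simpa only [Sym2.eq_iff, Fin.val_inj, E.num.apply_eq_iff_eq] using h

theorem init_fun (E : Encoding P) {u v : V} (huv : P.graph.Adj u v) :
    E.init.Fun (E.num u) (E.num v) ↔ P.FunctionalOn u v := by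
  simp only [Mem.Fun, init_size]
  constructor
  · intro h a ha b hb b' hb' h₁ h₂
    exact (E.idx_bijOn v).injOn hb hb' (h _ (E.idx_lt ha) _ (E.idx_lt hb) _ (E.idx_lt hb')
      ((E.init_rel huv ha hb).2 h₁) ((E.init_rel huv ha hb').2 h₂))
  · intro h a ha b hb b' hb' h₁ h₂
    obtain ⟨x, hx, rfl⟩ := E.exists_idx ha
    obtain ⟨y, hy, rfl⟩ := E.exists_idx hb
    obtain ⟨y', hy', rfl⟩ := E.exists_idx hb'
    rw [h x hx y hy y' hy' ((E.init_rel huv hx hy).1 h₁) ((E.init_rel huv hx hy').1 h₂)]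

theorem isInput_init (E : Encoding P) : E.init.IsInput P.maxDom := by
  have hadj : ∀ p (hp : p < E.cons.length), P.graph.Adj (E.cons[p]).1 (E.cons[p]).2 := fun p hp =>
    (P.graph.mem_edgeSet).1 ((E.mem_cons _).1 (List.mem_map.2 ⟨_, List.getElem_mem hp, rfl⟩))
  refine ⟨⟨?_, ?_, ?_, ?_, ?_, ?_⟩, E.init_eq_zero⟩
  · intro v
    by_cases hv : v < Fintype.card V
    · obtain ⟨v, rfl⟩ := E.exists_num hv
      rw [init_size]
      exact Finset.le_sup (f := fun v => (P.dom v).card) (Finset.mem_univ v)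
    · simp [init, hv]
  · intro p hp
    replace hp : p < E.cons.length := hp
    simp [init, hp]
  · intro p hp
    replace hp : p < E.cons.length := hp
    simp [init, hp]
  · intro p hp
    replace hp : p < E.cons.length := hp
    simpa [init, hp, Fin.val_inj] using (hadj p hp).ne
  · intro u v a b
    simp only [init]
    congr 1
    simp only [eq_iff_iff]
    constructor <;>
    · rintro ⟨u, v, huv, h₁, h₂, x, hx, y, hy, h₃, h₄, h⟩
      exact ⟨v, u, huv.symm, h₂, h₁, y, hy, x, hx, h₄, h₃, (P.rel_symm _ _ _ _).1 h⟩
  · intro u v a b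
    simp only [init]
    split_ifs <;> omega

theorem length_cons (E : Encoding P) : E.cons.length = P.numCon := by
  classical
  have : P.graph.edgeSet = ((E.cons.map fun c => s(c.1, c.2)).toFinset : Set (Sym2 V)) := by
    ext z; simp [← E.mem_cons]
  rw [CSP.numCon, this, Set.ncard_coe_finset, List.toFinset_card_of_nodup E.cons_nodup,
    List.length_map]

theorem reach_init (E : Encoding P) {u v : V} (h : P.Reachable u v) :
    Relation.ReflTransGen (fun u v => E.init.Con u v ∧ E.init.Fun u v) (E.num u) (E.num v) :=
  Relation.ReflTransGen.lift (p := fun u v => E.init.Con u v ∧ E.init.Fun u v)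
    (fun v => (E.num v : ℕ))
    (fun _ _ h => ⟨(E.init_con _ _).2 h.1, (E.init_fun h.1).2 h.2⟩) _ _ h

end Encoding

/-- Paths of functional constraints make the constraint graph connected, and a connected graph on
`n` vertices has at least `n - 1` edges. This removes `n` from the time bound. -/
theorem CSP.card_le_numCon {V α : Type*} [Fintype V] {P : CSP V α} {r : V}
    (hr : ∀ v, P.Reachable r v) : Fintype.card V ≤ P.numCon + 1 := by
  have hreach : ∀ v, P.graph.Reachable r v := fun v => by
    induction hr v with
    | refl => exact .rfl
    | tail _ h ih => exact ih.trans h.1.reachable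
  have hcon : P.graph.Connected :=
    { preconnected := fun u v => (hreach u).symm.trans (hreach v), nonempty := ⟨r⟩ }
  have := hcon.card_vert_le_card_edgeSet_add_one
  rwa [Nat.card_eq_fintype_card] at this

end FunCSP

-- The decoded output

namespace FunCSP
namespace Encoding

variable {V α : Type*} [Fintype V] {P : CSP V α}

/-- The assignment `s`, with values and variables as numbers. -/
noncomputable def code (E : Encoding P) (s : V → α) (w : ℕ) : ℕ :=
  if h : w < Fintype.card V then E.idx (E.num.symm ⟨w, h⟩) (s (E.num.symm ⟨w, h⟩)) else 0

theorem code_num (E : Encoding P) (s : V → α) (v : V) : E.code s (E.num v) = E.idx v (s v) := by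
  simp [code]

variable {E : Encoding P} {m₀ m : Mem} {D : ℕ} {c : V}

/-- Membership in the domains has to be assumed: outside them `idx` is arbitrary, and a foreign
value may share its number with a legitimate one. -/
theorem sol_iff_of_ready (h₀ : m₀.Ready D)
    (hm₀ : ∀ y ∈ [Name.nVar, .nCon, .conA, .conB, .size, .rel], m₀ y = E.init y) {s : V → α}
    (hs : ∀ v, s v ∈ P.dom v) : m₀.Sol (E.code s) ↔ P.IsSolution s := by
  simp only [List.mem_cons, List.not_mem_nil, or_false, forall_eq_or_imp, forall_eq] at hm₀
  obtain ⟨e₁, e₂, e₃, e₄, e₅, e₆⟩ := hm₀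
  have hn : E.init .nVar [] = Fintype.card V := rfl
  have hcon : ∀ u v, m₀ .inC [u, v] ≠ 0 ↔ E.init.Con u v := fun u v => by
    rw [h₀.inC_iff, Mem.Con, Mem.Con, Mem.ConBelow, Mem.ConBelow, e₂, e₃, e₄]
  constructor
  · rintro ⟨-, h⟩
    refine ⟨hs, fun u v huv => ?_⟩
    have := h _ _ ((hcon _ _).2 ((E.init_con u v).2 huv))
    rwa [code_num, code_num, e₆, E.init_rel huv (hs u) (hs v)] at this
  · rintro ⟨-, h⟩
    refine ⟨fun w hw => ?_, fun u v huv => ?_⟩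
    · have hw' := hw
      rw [e₁, hn] at hw'
      obtain ⟨v, rfl⟩ := E.exists_num hw'
      have : E.code s (E.num v) < m₀ .size [E.num v] := by
        rw [code_num, e₅, init_size]; exact E.idx_lt (hs v)
      exact ⟨this, by simp [h₀.alive _ hw _ this]⟩
    · rw [hcon] at huv
      have hlt : u < Fintype.card V ∧ v < Fintype.card V := by
        obtain ⟨p, hp, ⟨rfl, rfl⟩ | ⟨rfl, rfl⟩⟩ := huv
        exacts [⟨E.isInput_init.conA_lt p hp, E.isInput_init.conB_lt p hp⟩,
          ⟨E.isInput_init.conB_lt p hp, E.isInput_init.conA_lt p hp⟩]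
      obtain ⟨u, rfl⟩ := E.exists_num hlt.1
      obtain ⟨v, rfl⟩ := E.exists_num hlt.2
      have hadj := (E.init_con u v).1 huv
      rw [code_num, code_num, e₆, E.init_rel hadj (hs u) (hs v)]
      exact h u v hadj

theorem decode_adj (h : Elim m₀ m (E.num c) (· = E.num c) []) (u v : V) :
    (E.decode m).graph.Adj u v ↔ m .inC [E.num u, E.num v] ≠ 0 := by
  have h₁ := h.inC_le (E.num u) (E.num v)
  have h₂ := h.inC_symm (E.num u) (E.num v)
  have h₃ : m .inC [E.num u, E.num v] ≠ 0 → u ≠ v := fun hc huv => h.inC_ne _ _ hc (by rw [huv])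
  rw [decode, SimpleGraph.fromRel_adj, ← h₂, or_self]
  constructor
  · rintro ⟨-, h⟩; omega
  · exact fun h => ⟨h₃ h, by omega⟩

theorem decode_rel (h : Elim m₀ m (E.num c) (· = E.num c) []) (u v : V) (x y : α) :
    (E.decode m).rel u v x y ↔ m .rel [E.num u, E.num v, E.idx u x, E.idx v y] ≠ 0 := by
  have h₁ := h.rel_le (E.num u) (E.num v) (E.idx u x) (E.idx v y)
  have h₂ := h.rel_symm (E.num u) (E.num v) (E.idx u x) (E.idx v y)
  simp only [decode, ← h₂, and_self]
  omega

theorem mem_decode_dom (h : Elim m₀ m (E.num c) (· = E.num c) [])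
    (hn : m₀ .nVar = E.init .nVar) (hsz : m₀ .size = E.init .size) (v : V) (x : α) :
    x ∈ (E.decode m).dom v ↔ x ∈ P.dom v ∧ m .alive [E.num v, E.idx v x] ≠ 0 := by
  simp only [decode, Finset.mem_filter, and_congr_right_iff]
  intro hx
  have hlt : E.idx v x < m₀ .size [E.num v] := by rw [hsz, init_size]; exact E.idx_lt hx
  by_cases hv : v = c
  · subst hv
    have := h.alive_le _ hlt
    omega
  · simp [h.alive (E.num v) (by rw [hn]; exact (E.num v).2)
      (fun h => hv (E.num.injective (Fin.ext h))) _ hlt]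

theorem sol_iff_decode (h : Elim m₀ m (E.num c) (· = E.num c) [])
    (hn : m₀ .nVar = E.init .nVar) (hsz : m₀ .size = E.init .size) {s : V → α}
    (hs : ∀ v, s v ∈ P.dom v) : m.Sol (E.code s) ↔ (E.decode m).IsSolution s := by
  have hcard : E.init .nVar [] = Fintype.card V := rfl
  simp only [Mem.Sol, CSP.IsSolution, mem_decode_dom h hn hsz, decode_adj h, decode_rel h, hs,
    true_and, h.nVar, h.size, hn, hsz, hcard]
  constructor
  · rintro ⟨h₁, h₂⟩
    refine ⟨fun v => ?_, fun u v huv => ?_⟩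
    · simpa only [code_num] using (h₁ _ (E.num v).2).2
    · simpa only [code_num] using h₂ _ _ huv
  · rintro ⟨h₁, h₂⟩
    refine ⟨fun w hw => ?_, fun u v huv => ?_⟩
    · obtain ⟨v, rfl⟩ := E.exists_num hw
      rw [code_num, init_size]
      exact ⟨E.idx_lt (hs v), h₁ v⟩
    · have hu := h.inC_lt _ _ huv
      have hv := h.inC_lt _ _ (by rwa [h.inC_symm] at huv)
      rw [hn] at hu hv
      obtain ⟨u, rfl⟩ := E.exists_num hu
      obtain ⟨v, rfl⟩ := E.exists_num hv
      rw [code_num, code_num]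
      exact h₂ u v huv

/-- Every variable other than `c` has been eliminated, so `done` describes all constraints that are
left. -/
theorem decode_isStar (h : Elim m₀ m (E.num c) (· = E.num c) [])
    (hn : m₀ .nVar = E.init .nVar) (hsz : m₀ .size = E.init .size)
    (helim : ∀ v < E.init .nVar [], v ≠ E.num c → m .elim [v] ≠ 0) : (E.decode m).IsStar c := by
  have hlt : ∀ v, (E.num v : ℕ) < E.init .nVar [] := fun v => (E.num v).2
  have hne : ∀ {v}, v ≠ c → (E.num v : ℕ) ≠ E.num c := fun hv h => hv (E.num.injective (Fin.ext h))
  have hdone := fun v (hv : v ≠ c) => h.done (E.num v) (by rw [hn]; exact hlt v)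
    (helim _ (hlt v) (hne hv))
  refine ⟨fun u v => ?_, fun v hv => ?_⟩
  · rw [decode_adj h]
    constructor
    · refine fun huv => ⟨fun h' => h.inC_ne _ _ huv (by rw [h']), ?_⟩
      by_contra! hc
      exact huv ((hdone u hc.1).2.1 _ (hne hc.2))
    · rintro ⟨huv, rfl | rfl⟩
      · exact (hdone v huv.symm).1
      · rw [h.inC_symm]; exact (hdone u huv).1
  · intro x hx y hy y' hy' h₁ h₂
    rw [decode_rel h] at h₁ h₂
    rw [mem_decode_dom h hn hsz] at hx hy hy'
    have hF := (hdone v hv).2.2.1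
    simp only [Mem.Fun, h.size, hsz, init_size] at hF
    exact (E.idx_bijOn v).injOn hy.1 hy'.1 (hF _ (E.idx_lt hx.1) _ (E.idx_lt hy.1) _
      (E.idx_lt hy'.1) h₁ h₂)

/-- Choose a support of `x` at each leaf. Domains of leaves are intact, so the supports are live,
and in a star the leaves do not constrain one another. -/
theorem decode_extend (h : Elim m₀ m (E.num c) (· = E.num c) [])
    (hn : m₀ .nVar = E.init .nVar) (hsz : m₀ .size = E.init .size)
    (helim : ∀ v < E.init .nVar [], v ≠ E.num c → m .elim [v] ≠ 0) {x : α}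
    (hx : x ∈ (E.decode m).dom c) : ∃ s, (E.decode m).IsSolution s ∧ s c = x := by
  classical
  have hlt : ∀ v, (E.num v : ℕ) < m₀ .nVar [] := fun v => by rw [hn]; exact (E.num v).2
  have hx' := hx
  rw [mem_decode_dom h hn hsz] at hx'
  have key : ∀ v, ∃ y ∈ (E.decode m).dom v, (v = c → y = x) ∧
      (v ≠ c → (E.decode m).rel c v x y) := by
    intro v
    by_cases hv : v = c
    · subst hv; exact ⟨x, hx, fun _ => rfl, fun h => (h rfl).elim⟩
    have hne : (E.num v : ℕ) ≠ E.num c := fun h => hv (E.num.injective (Fin.ext h))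
    obtain ⟨b, hb, hr⟩ := (h.done (E.num v) (hlt v) (helim _ (E.num v).2 hne)).2.2.2 (E.idx c x)
      (by rw [hsz, init_size]; exact E.idx_lt hx'.1) hx'.2
    rw [h.size] at hb
    have hal := h.alive _ (hlt v) hne b hb
    rw [hsz, init_size] at hb
    obtain ⟨y, hy, rfl⟩ := E.exists_idx hb
    exact ⟨y, (mem_decode_dom h hn hsz v y).2 ⟨hy, by simp [hal]⟩, fun h => (hv h).elim,
      fun _ => (decode_rel h _ _ _ _).2 hr⟩
  choose s hs hsc hsr using key
  refine ⟨s, ⟨hs, fun u v huv => ?_⟩, hsc c rfl⟩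
  obtain ⟨hne, rfl | rfl⟩ := ((decode_isStar h hn hsz helim).1 u v).1 huv
  · rw [hsc u rfl]; exact hsr v hne.symm
  · rw [hsc v rfl, CSP.rel_symm]; exact hsr u hne

end Encoding

/-- A leaf is only on its constraint with the center. If the leaf comes first, functionality towards
the leaf excludes the case in which the center would have to be free of other constraints. -/
theorem CSP.IsStar.isCanonical {V α : Type*} {P : CSP V α} {c : V} (h : P.IsStar c) :
    P.IsCanonical := by
  have honly : ∀ v, v ≠ c → P.OnlyConstraint c v := fun v hv k hk =>
    (((h.1 v k).1 hk).2).resolve_left hv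
  intro i j hij _
  obtain ⟨hne, rfl | rfl⟩ := (h.1 i j).1 hij
  · exact ⟨fun _ => .inr (honly j hne.symm), fun _ => honly j hne.symm⟩
  · exact ⟨fun _ => .inl (honly i hne), fun hn => (hn (h.2 i hne)).elim⟩

end FunCSP


-- The main theorem

theorem mainTheorem3 :
    ∃ K : ℕ, ∀ (V α : Type*) [Fintype V] (P : CSP V α) (E : Encoding P),
      (∃ r, ∀ v, P.Reachable r v) →
      ∃ (m : Mem) (t : ℕ),
        Exec Program.linearElimination E.init m t ∧
        t ≤ K * (max P.numCon 1 * (max P.maxDom 1) ^ 2) ∧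
        (m .consistent [] = 1 ↔ P.Satisfiable) ∧
        (E.decode m).Equivalent P ∧
        (E.decode m).IsCanonical ∧
        ∃ c, (E.decode m).IsStar c ∧
          ∀ x ∈ (E.decode m).dom c, ∃ s, (E.decode m).IsSolution s ∧ s c = x := by
  -- 160000 = 10000 · 4 · 4: the number of variables and constraints plus 1 is at most `4 * max e
  -- 1`, and `(d + 1) ^ 2` is at most `4 * (max d 1) ^ 2`.
  refine ⟨160000, fun V α _ P E ⟨r, hr⟩ => ?_⟩
  have hV : E.init .nVar [] = Fintype.card V := rfl
  have hC : E.init .nCon [] = P.numCon := E.length_cons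
  obtain ⟨m, t, hexec, m₀, c, h₀, hm₀, h, helim, ht⟩ := Program.halts_linearElimination
    E.isInput_init (E.num r).2 fun w hw => by
      obtain ⟨v, rfl⟩ := E.exists_num hw
      exact E.reach_init (hr v)
  have hn := hm₀ .nVar (by decide)
  have hsz := hm₀ .size (by decide)
  obtain ⟨c, rfl⟩ := E.exists_num (show c < Fintype.card V from hV ▸ hn ▸ h.center_lt)
  have hstar := Encoding.decode_isStar h hn hsz helim
  have hext := fun x => Encoding.decode_extend (x := x) h hn hsz helim
  have heq : (E.decode m).Equivalent P := by
    have key : ∀ s : V → α, (∀ v, s v ∈ P.dom v) → ((E.decode m).IsSolution s ↔ P.IsSolution s) :=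
      fun s hs => by
        rw [← Encoding.sol_iff_decode h hn hsz hs, h.sol_iff, Encoding.sol_iff_of_ready h₀ hm₀ hs]
    -- Domains only shrink, so a solution of either problem takes its values in the original domains
    -- and `key` applies.
    exact fun s => ⟨fun hs => (key s fun v => (Finset.mem_filter.1 (hs.1 v)).1).1 hs,
      fun hs => (key s hs.1).2 hs⟩
  refine ⟨m, t, hexec, ?_, ⟨fun hc => ?_, fun ⟨s, hs⟩ => ?_⟩, heq, hstar.isCanonical, c, hstar, hext⟩
  · refine ht.trans ?_
    rw [hV, hC]
    have h₁ := CSP.card_le_numCon hr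
    have h₂ : Fintype.card V + P.numCon + 1 ≤ 4 * max P.numCon 1 := by omega
    have h₃ : (P.maxDom + 1) ^ 2 ≤ (2 * max P.maxDom 1) ^ 2 := Nat.pow_le_pow_left (by omega) 2
    calc _ ≤ 10000 * (4 * max P.numCon 1) * (2 * max P.maxDom 1) ^ 2 := by gcongr
      _ = _ := by ring
  · obtain ⟨-, a, ha, hal⟩ := h.of_consistent hc
    rw [hsz, Encoding.init_size] at ha
    obtain ⟨x, hx, rfl⟩ := E.exists_idx ha
    obtain ⟨s, hs, -⟩ := hext x ((Encoding.mem_decode_dom h hn hsz c x).2 ⟨hx, hal⟩)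
    exact ⟨s, (heq s).1 hs⟩
  · exact h.consistent ⟨_, (h.sol_iff _).2 ((Encoding.sol_iff_of_ready h₀ hm₀ hs.1).2 hs)⟩
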